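/- **Ground field.** Let $K_0$ be a field, $v\ge 0$, $\mathbb K=K_0(q_1,\dots,q_v)$ a rational function field, and let $\mathbb G$ be $\mathbb K(x,x_1,\dots,x_v)$ (for $v=0$: $\mathbb K(x)$) or $\mathbb K(x_1,\dots,x_v)$; if $x$ is present, assume $\operatorname{char}K_0=0$. Let $\sigma$ be the automorphism of $\mathbb G$ over $\mathbb K$ with $\sigma(x)=x+1$, $\sigma(x_i)=q_ix_i$. For $f=p/q\in\mathbb G$ in lowest terms let $\mathrm{ev}(f,k)=p(k,q_1^k,\dots,q_v^k)/q(k,q_1^k,\dots,q_v^k)$ ($0$ if the denominator vanishes); $L(f)$ is the least $\delta\ge 0$ with $q(k,q_1^k,\dots,q_v^k)\ne0$ for all $k\ge\delta$, and $Z(f)=\max(L(1/p),L(1/q))$ for $f\neq 0$. Let $\mathcal R$ be the set of roots of unity $\ne1$ in $\mathbb K$. **Expressions.** $\mathrm{Prod}^*(\mathbb G)$ is the smallest set of formal terms containing $1$, all $\mathrm{RPow}(r)$ ($r\in\mathcal R$), all $\mathrm{Prod}(l,f\odot p)$ with $p\in\mathrm{Prod}^*(\mathbb G)$, $f\in\mathbb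 G^*$, $l\ge Z(f)$, and closed under $\odot$ and under powers $p^{z}$, $z\in\mathbb Z\setminus\{0\}$. $\mathrm{SumProd}(\mathbb G)$ is the smallest set containing $\mathbb G\cup\mathrm{Prod}^*(\mathbb G)$ and closed under $\oplus$, $\odot$, powers with exponent $k\ge1$, and $\mathrm{Sum}(l,\cdot)$, $l\ge0$. $\Sigma\Pi(\mathbb G)$ consists of the terms $\mathrm{Sum}(l,f)$, $\mathrm{RPow}(r)$ and $\mathrm{Prod}(l,f\odot p)$ of this kind. Terms are evaluated by $\mathrm{RPow}(r)(n)=r^n$, $\mathrm{Sum}(l,f)(n)=\sum_{i=l}^nf(i)$, $\mathrm{Prod}(l,f)(n)=\prod_{i=l}^nf(i)$ and the obvious rules for $\oplus,\odot$, powers. A term is in *reduced representation* if it has the form $(f_1\odot P_1)\oplus\dots\oplus(f_r\odot P_r)$, $r\ge 0$ (the term $0$ if $r=0$), $f_i\in\mathbb G^*$, where $P_i=a_{i,1}^{z_{i,1}}\odot\dots\odot a_{i,n_i}^{z_{i,n_i}}$ ($n_i\ge0$), $a_{i,j}\in\Sigma\Pi(\mathbb G)$ pairwise different for fixed $i$,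 $z_{i,j}\ge1$ for sums, $z_{i,j}\neq0$ for $\mathrm{Prod}$'s, $1\le z_{i,j}<\mathrm{ord}(r)$ for $\mathrm{RPow}(r)$, and the $P_i$ pairwise differ even up to the order of factors. An element $T\in\Sigma\Pi(\mathbb G)$ is identified with $1\odot T^1$. A term $H$ is in *sum-product reduced form* if it is in reduced representation and for all $\mathrm{Sum}(l,A)$, $\mathrm{Prod}(l,A)$ occurring recursively in $H$: $A$ is in reduced representation, $l\ge L(f_i)$ for the coefficients $f_i$ of $A$, and $l$ is at least the lower bound of each $\mathrm{Sum}$ and $\mathrm{Prod}$ inside $A$. For $W\subseteq\Sigma\Pi(\mathbb G)$ let $\mathrm{SumProd}(W,\mathbb G)$ be the set of terms in reduced representation with all $a_{i,j}\in W$. $W$ is *shift-stable* if the summand/multiplicand of each element of $W$ is built by sums and products from $W$; it is *canonical reduced* if any $A,B\in\mathrm{SumProd}(W,\mathbb G)$ with $A(n)=B(n)$ for all large $n$ are equal up to permutations of the operands of $\oplus$ and $\odot$; it is *$\sigma$-reduced* if it is canonical reduced, shift-stable, and all its elements are in sum-product reduced form. **Extensions.** An *APS-extension* $\mathbb E=\mathbb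 G\langle t_1\rangle\dots\langle t_e\rangle$ of $(\mathbb G,\sigma)$ is a tower of rings $\mathbb A_0=\mathbb G$, $\mathbb A_i=\mathbb A_{i-1}\langle t_i\rangle$, $\mathbb E=\mathbb A_e$, with an automorphism $\sigma$ of $\mathbb E$ extending that of $\mathbb G$, where each $t_i$ is an A-monomial ($\mathbb A_i=\mathbb A_{i-1}[t_i]$ subject to $t_i^\nu=1$, $\nu>1$, with $\sigma(t_i)/t_i\in\mathbb A_{i-1}^*$ a primitive $\nu$th root of unity), a P-monomial (Laurent polynomials $\mathbb A_{i-1}[t_i,t_i^{-1}]$, $\sigma(t_i)/t_i\in\mathbb A_{i-1}^*$) or an S-monomial (polynomials $\mathbb A_{i-1}[t_i]$, $\sigma(t_i)-t_i\in\mathbb A_{i-1}$). It is *simple* if for each A- or P-monomial $\sigma(t_i)/t_i=h\,t_1^{m_1}\cdots t_{i-1}^{m_{i-1}}$ with $h\in\mathbb G^*$, $m_j\in\mathbb Z$ and $m_j=0$ if $t_j$ is an S-monomial; it is *basic* if for each P-monomial this holds with $m_j=0$ whenever $t_j$ is an A- or S-monomial, and for each A-monomial $\sigma(t_i)/t_i\in\mathbb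 G^*$ is fixed by $\sigma$. It is an *RΠΣ-extension* if $\{c\in\mathbb E:\sigma(c)=c\}=\{c\in\mathbb G:\sigma(c)=c\}$. An *induced evaluation function* extends $\mathrm{ev}$, $L$, $Z$ from $\mathbb G$ step by step: with integers $l_i\ge0$, where $l_i=1$ for an A-monomial, $l_i\ge\max(L(a),Z(a))$ with $a=\sigma^{-1}(\sigma(t_i)/t_i)$ for a P-monomial, and $l_i\ge L(b)$ with $b=\sigma^{-1}(\sigma(t_i)-t_i)$ for an S-monomial, put $\mathrm{ev}(t_i,n)=\prod_{k=l_i}^n\mathrm{ev}(\sigma^{-1}(\sigma(t_i)/t_i),k)$ for A- and P-monomials and $\mathrm{ev}(t_i,n)=\sum_{k=l_i}^n\mathrm{ev}(\sigma^{-1}(\sigma(t_i)-t_i),k)$ for S-monomials; for $f=\sum_kf_kt_i^k$ with $f_k\in\mathbb A_{i-1}$ (and $0\le k<\nu$, $k\in\mathbb Z$, $k\ge0$ for A-, P-, S-monomials, respectively) put $\mathrm{ev}(f,n)=\sum_k\mathrm{ev}(f_k,n)\,\mathrm{ev}(t_i,n)^k$ and, if $f\notin\mathbb A_{i-1}$,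 $L(f)=\max(l_i-1,\max_kL(f_k))$; further $Z(h\,t_1^{m_1}\cdots t_e^{m_e})=Z(h)$ for $h\in\mathbb G^*$ and $m_j=0$ at S-monomials. We write $\mathrm{expr}(t_i)=T_i$ ($1\le i\le e$) if $T_i=\mathrm{RPow}(\sigma(t_i)/t_i)$ with $\sigma(t_i)/t_i\in\mathcal R$ for an A-monomial, $T_i=\mathrm{Prod}(l_i,F)$ for a P-monomial and $T_i=\mathrm{Sum}(l_i,F)$ for an S-monomial, where $F$ arises from a representation of $\sigma^{-1}(\sigma(t_i)/t_i)$, resp. $\sigma^{-1}(\sigma(t_i)-t_i)$, as a sum of pairwise different power products in the $t_j$ (exponents as above) with coefficients in $\mathbb G^*$, by replacing $t_j$ by $T_j$, $+$ by $\oplus$ and $\cdot$ by $\odot$ (in any order of the summands and factors). **Statement.** Let $W=\{T_1,\dots,T_e\}\subset\Sigma\Pi(\mathbb G)$ with $T_1,\dots,T_e$ pairwise different and in sum-product reduced form, such that for each $i$ the sums and products of which the summand/multiplicand of $T_i$ is built are contained in $\{T_1,\dots,T_{i-1}\}$ (in particular, $W$ is shift-stable). 1. Suppose that in no $\mathrm{Prod}(l,A)\in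 W$ the multiplicand $A$ contains a factor $\mathrm{RPow}(r)^z$ outside of its inner products. Then $W$ is $\sigma$-reduced over $\mathbb G$ if and only if there is a basic RΠΣ-extension $\mathbb G\langle t_1\rangle\dots\langle t_e\rangle$ of $(\mathbb G,\sigma)$ with an induced evaluation function such that $\mathrm{expr}(t_i)=T_i$ for $1\le i\le e$. 2. Without this supposition, $W$ is $\sigma$-reduced over $\mathbb G$ if and only if there is a simple RΠΣ-extension $\mathbb G\langle t_1\rangle\dots\langle t_e\rangle$ of $(\mathbb G,\sigma)$ with an induced evaluation function such that $\mathrm{expr}(t_i)=T_i$ for $1\le i\le e$. -/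

import Mathlib

noncomputable section

namespace SigmaReduction

universe u

/-! ## The ground field -/

/-- The constant field `K = K₀(q_1, …, q_v)`. -/
abbrev ConstField (K₀ : Type u) [Field K₀] (v : ℕ) : Type u :=
  FractionRing (MvPolynomial (Fin v) K₀)

/-- The element `q_i` of `K`. -/
def qElem (K₀ : Type u) [Field K₀] (v : ℕ) (i : Fin v) : ConstField K₀ v :=
  algebraMap (MvPolynomial (Fin v) K₀) (ConstField K₀ v) (MvPolynomial.X i)

/-- Polynomials over `K`: `K[x, x_1, …, x_v]` if `d = 1`, and `K[x_1, …, x_v]` if `d = 0`. Only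
`d ≤ 1` is used. -/
abbrev GroundPoly (K₀ : Type u) [Field K₀] (d v : ℕ) : Type u :=
  MvPolynomial (Fin d ⊕ Fin v) (ConstField K₀ v)

/-- The ground field `𝔾`: the multibasic mixed field `K(x, x_1, …, x_v)` if `d = 1` (for `v = 0`
this is the rational field `K(x)`), and the multibasic field `K(x_1, …, x_v)` if `d = 0`. -/
abbrev GroundField (K₀ : Type u) [Field K₀] (d v : ℕ) : Type u :=
  FractionRing (GroundPoly K₀ d v)

section Ground

variable (K₀ : Type u) [Field K₀] (d v : ℕ)

lemma qElem_ne_zero (i : Fin v) : qElem K₀ v i ≠ 0 := by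
  unfold qElem
  rw [Ne, FaithfulSMul.algebraMap_eq_zero_iff]
  exact MvPolynomial.X_ne_zero i

/-- The point `(k, q_1^k, …, q_v^k)` at which rational functions are evaluated. -/
def evalPoint (k : ℕ) : Fin d ⊕ Fin v → ConstField K₀ v :=
  Sum.elim (fun _ => (k : ConstField K₀ v)) (fun i => qElem K₀ v i ^ k)

open Classical in
/-- Evaluation of `f = p / q` (`p`, `q` coprime) at `k`, with value `0` at the poles. -/
def groundEv (f : GroundField K₀ d v) (k : ℕ) : ConstField K₀ v :=
  let p := IsFractionRing.num (GroundPoly K₀ d v) f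
  let q : GroundPoly K₀ d v := IsFractionRing.den (GroundPoly K₀ d v) f
  if MvPolynomial.eval (evalPoint K₀ d v k) q = 0 then 0
  else MvPolynomial.eval (evalPoint K₀ d v k) p / MvPolynomial.eval (evalPoint K₀ d v k) q

/-- `L(f)`: the minimal `δ` such that the reduced denominator of `f` has no zero at any
`k ≥ δ`. -/
def groundL (f : GroundField K₀ d v) : ℕ :=
  sInf {δ : ℕ | ∀ k ≥ δ, MvPolynomial.eval (evalPoint K₀ d v k)
    (IsFractionRing.den (GroundPoly K₀ d v) f : GroundPoly K₀ d v) ≠ 0}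

/-- `Z(f) = max (L(1/p)) (L(1/q))` for `f = p / q` with `p`, `q` coprime. -/
def groundZ (f : GroundField K₀ d v) : ℕ :=
  max (groundL K₀ d v
        (algebraMap (GroundPoly K₀ d v) _ (IsFractionRing.num (GroundPoly K₀ d v) f))⁻¹)
      (groundL K₀ d v
        (algebraMap (GroundPoly K₀ d v) _
          (IsFractionRing.den (GroundPoly K₀ d v) f : GroundPoly K₀ d v))⁻¹)

/-- The shift `x ↦ x + 1`, `x_i ↦ q_i x_i` on polynomials. -/
def polyShift : GroundPoly K₀ d v ≃ₐ[ConstField K₀ v] GroundPoly K₀ d v :=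
  AlgEquiv.ofAlgHom
    (MvPolynomial.aeval (Sum.elim
      (fun j => (MvPolynomial.X (Sum.inl j) + 1 : GroundPoly K₀ d v))
      (fun i => MvPolynomial.C (qElem K₀ v i) * MvPolynomial.X (Sum.inr i))))
    (MvPolynomial.aeval (Sum.elim
      (fun j => (MvPolynomial.X (Sum.inl j) - 1 : GroundPoly K₀ d v))
      (fun i => MvPolynomial.C (qElem K₀ v i)⁻¹ * MvPolynomial.X (Sum.inr i))))
    (by
      apply MvPolynomial.algHom_ext
      rintro (j | i)
      · simp
      · simp only [AlgHom.coe_comp, Function.comp_apply, MvPolynomial.aeval_X, Sum.elim_inr,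
          map_mul, MvPolynomial.algHom_C, MvPolynomial.algebraMap_eq, AlgHom.id_apply]
        rw [← mul_assoc, ← MvPolynomial.C_mul, inv_mul_cancel₀ (qElem_ne_zero K₀ v i),
          MvPolynomial.C_1, one_mul])
    (by
      apply MvPolynomial.algHom_ext
      rintro (j | i)
      · simp
      · simp only [AlgHom.coe_comp, Function.comp_apply, MvPolynomial.aeval_X, Sum.elim_inr,
          map_mul, MvPolynomial.algHom_C, MvPolynomial.algebraMap_eq, AlgHom.id_apply]
        rw [← mul_assoc, ← MvPolynomial.C_mul, mul_inv_cancel₀ (qElem_ne_zero K₀ v i),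
          MvPolynomial.C_1, one_mul])

/-- The automorphism `σ` of `𝔾` with `σ|_K = id`, `σ(x) = x + 1`, `σ(x_i) = q_i x_i`. -/
def groundShift : GroundField K₀ d v ≃+* GroundField K₀ d v :=
  IsFractionRing.ringEquivOfRingEquiv (polyShift K₀ d v).toRingEquiv

end Ground

/-! ## The term algebra -/

/-- Terms built from elements of `G` by the formal operations power, `⊕`, `⊙`, `Sum`, `Prod`,
`RPow`. -/
inductive Term (K G : Type u) : Type u
  | base (g : G) : Term K G
  | rpow (r : K) : Term K G
  | pow (a : Term K G) (z : ℤ) : Term K G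
  | add (a b : Term K G) : Term K G
  | mul (a b : Term K G) : Term K G
  | sum (l : ℕ) (a : Term K G) : Term K G
  | prod (l : ℕ) (a : Term K G) : Term K G

/-- `r ∈ R`: a root of unity different from `1`. Its order is `orderOf r`. -/
def IsNontrivialRootOfUnity {K : Type u} [Field K] (r : K) : Prop :=
  r ≠ 1 ∧ IsOfFinOrder r

/-- Terms over the ground field. -/
abbrev SPTerm (K₀ : Type u) [Field K₀] (d v : ℕ) : Type u :=
  Term (ConstField K₀ v) (GroundField K₀ d v)

section Terms

variable {K₀ : Type u} [Field K₀] {d v : ℕ}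

/-- `Prod*(𝔾)`: power products of nested products. -/
inductive IsProdStar : SPTerm K₀ d v → Prop
  | one : IsProdStar (.base 1)
  | rpow (r : ConstField K₀ v) : IsNontrivialRootOfUnity r → IsProdStar (.rpow r)
  | prod (l : ℕ) (f : GroundField K₀ d v) (p : SPTerm K₀ d v) : IsProdStar p → f ≠ 0 →
      groundZ K₀ d v f ≤ l → IsProdStar (.prod l (.mul (.base f) p))
  | mul (p q : SPTerm K₀ d v) : IsProdStar p → IsProdStar q → IsProdStar (.mul p q)
  | pow (p : SPTerm K₀ d v) (z : ℤ) : IsProdStar p → z ≠ 0 → IsProdStar (.pow p z)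

/-- `SumProd(𝔾)`: expressions in terms of nested sums over nested products. -/
inductive IsSumProd : SPTerm K₀ d v → Prop
  | base (g : GroundField K₀ d v) : IsSumProd (.base g)
  | prodStar (p : SPTerm K₀ d v) : IsProdStar p → IsSumProd p
  | add (f g : SPTerm K₀ d v) : IsSumProd f → IsSumProd g → IsSumProd (.add f g)
  | mul (f g : SPTerm K₀ d v) : IsSumProd f → IsSumProd g → IsSumProd (.mul f g)
  | pow (f : SPTerm K₀ d v) (k : ℤ) : IsSumProd f → 1 ≤ k → IsSumProd (.pow f k)
  | sum (l : ℕ) (f : SPTerm K₀ d v) : IsSumProd f → IsSumProd (.sum l f)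

/-- `Π(𝔾)`: the nested products. -/
def IsPi (a : SPTerm K₀ d v) : Prop :=
  (∃ r, IsNontrivialRootOfUnity r ∧ a = .rpow r) ∨
  ∃ (l : ℕ) (f : GroundField K₀ d v) (p : SPTerm K₀ d v), IsProdStar p ∧ f ≠ 0 ∧
    groundZ K₀ d v f ≤ l ∧ a = .prod l (.mul (.base f) p)

/-- `Σ(𝔾)`: the nested sums. -/
def IsSigma (a : SPTerm K₀ d v) : Prop :=
  ∃ (l : ℕ) (f : SPTerm K₀ d v), IsSumProd f ∧ a = .sum l f

/-- The value `F(n) = ev(F, n)` of a term. -/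
def termValue : SPTerm K₀ d v → ℕ → ConstField K₀ v
  | .base g, n => groundEv K₀ d v g n
  | .rpow r, n => ∏ _i ∈ Finset.Icc 1 n, r
  | .pow a z, n => termValue a n ^ z
  | .add a b, n => termValue a n + termValue b n
  | .mul a b, n => termValue a n * termValue b n
  | .sum l a, n => ∑ i ∈ Finset.Icc l n, termValue a i
  | .prod l a, n => ∏ i ∈ Finset.Icc l n, termValue a i

end Terms

section Shape

variable {K G : Type u}

/-- The sums and products of which a term is built (not looking inside sums and products). -/
def Term.atoms : Term K G → Set (Term K G)
  | .base _ => ∅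
  | .rpow r => {.rpow r}
  | .pow a _ => a.atoms
  | .add a b => a.atoms ∪ b.atoms
  | .mul a b => a.atoms ∪ b.atoms
  | .sum l a => {.sum l a}
  | .prod l a => {.prod l a}

/-- All sums and products that occur recursively in a term. -/
def Term.allAtoms : Term K G → Set (Term K G)
  | .base _ => ∅
  | .rpow r => {.rpow r}
  | .pow a _ => a.allAtoms
  | .add a b => a.allAtoms ∪ b.allAtoms
  | .mul a b => a.allAtoms ∪ b.allAtoms
  | .sum l a => insert (.sum l a) a.allAtoms
  | .prod l a => insert (.prod l a) a.allAtoms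

/-- Equality up to permutations of the operands in `⊕` and `⊙`; sums and products themselves are
regarded as indecomposable symbols. -/
inductive Term.OperandPerm : Term K G → Term K G → Prop
  | refl (a) : OperandPerm a a
  | symm (a b) : OperandPerm a b → OperandPerm b a
  | trans (a b c) : OperandPerm a b → OperandPerm b c → OperandPerm a c
  | add_comm (a b) : OperandPerm (.add a b) (.add b a)
  | add_assoc (a b c) : OperandPerm (.add (.add a b) c) (.add a (.add b c))
  | mul_comm (a b) : OperandPerm (.mul a b) (.mul b a)
  | mul_assoc (a b c) : OperandPerm (.mul (.mul a b) c) (.mul a (.mul b c))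
  | add_congr (a a' b b') : OperandPerm a a' → OperandPerm b b' →
      OperandPerm (.add a b) (.add a' b')
  | mul_congr (a a' b b') : OperandPerm a a' → OperandPerm b b' →
      OperandPerm (.mul a b) (.mul a' b')
  | pow_congr (a a' z) : OperandPerm a a' → OperandPerm (.pow a z) (.pow a' z)

/-- `(…((a_1 ⊕ a_2) ⊕ a_3) ⊕ …)`; the empty sum is `0 ∈ G`. -/
def Term.addList [Zero G] : List (Term K G) → Term K G
  | [] => .base 0
  | a :: as => as.foldl .add a

/-- `(…((a_1 ⊙ a_2) ⊙ a_3) ⊙ …)`; the empty product is `1 ∈ G`. -/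
def Term.mulList [One G] : List (Term K G) → Term K G
  | [] => .base 1
  | a :: as => as.foldl .mul a

/-- A list of monomials `f · a_1^{z_1} ⋯ a_n^{z_n}`, each given by its coefficient `f` and the list
of the pairs `(a_j, z_j)`. -/
abbrev MonomialList (ι G : Type*) := List (G × List (ι × ℤ))

/-- The term `(f_1 ⊙ P_1) ⊕ … ⊕ (f_r ⊙ P_r)` where the `P_i` are the power products
`(a_{i,1} ^ z_{i,1}) ⊙ … ⊙ (a_{i,n_i} ^ z_{i,n_i})`. -/
def Term.ofMonomials [Zero G] [One G] (X : MonomialList (Term K G) G) : Term K G :=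
  Term.addList (X.map fun t => .mul (.base t.1) (Term.mulList (t.2.map fun p => .pow p.1 p.2)))

/-- The requirements of a reduced representation: nonzero coefficients, admissible powers
`a ^ z`, pairwise different `a`'s within a power product, and power products that differ pairwise
even up to the order of their factors. -/
structure IsReducedList {ι G : Type*} [Zero G] (ok : ι → ℤ → Prop) (X : MonomialList ι G) :
    Prop where
  coeff_ne_zero : ∀ t ∈ X, t.1 ≠ 0
  admissible : ∀ t ∈ X, ∀ p ∈ t.2, ok p.1 p.2
  nodup : ∀ t ∈ X, (t.2.map Prod.fst).Nodup
  distinct : X.Pairwise fun s t => ¬ s.2.Perm t.2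

end Shape

section Reduced

variable {K₀ : Type u} [Field K₀] {d v : ℕ}

/-- The powers `a ^ z` admitted in a reduced representation. -/
def AdmissiblePower (a : SPTerm K₀ d v) (z : ℤ) : Prop :=
  (IsSigma a ∧ 1 ≤ z) ∨
  ((∃ l f, a = .prod l f) ∧ IsPi a ∧ z ≠ 0) ∨
  ∃ r, IsNontrivialRootOfUnity r ∧ a = .rpow r ∧ 1 ≤ z ∧ z < orderOf r

/-- `A` is in reduced representation, with the monomials listed in `X`. -/
def IsReducedWith (A : SPTerm K₀ d v) (X : MonomialList (SPTerm K₀ d v) (GroundField K₀ d v)) :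
    Prop :=
  IsReducedList AdmissiblePower X ∧ A = Term.ofMonomials X

/-- `A` is in reduced representation. -/
def IsReduced (A : SPTerm K₀ d v) : Prop := IsSumProd A ∧ ∃ X, IsReducedWith A X

/-- The condition on `Sum(l, A)` and `Prod(l, A)` in the sum-product reduced form: `A` is reduced,
`l ≥ L(f_i)` for the coefficients `f_i` of `A`, and `l` is at least the lower bound of each sum and
product inside of `A`. -/
def IsReducedBody (l : ℕ) (A : SPTerm K₀ d v) : Prop :=
  IsSumProd A ∧ (∃ X, IsReducedWith A X ∧ ∀ t ∈ X, groundL K₀ d v t.1 ≤ l) ∧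
  ∀ l' B, (Term.sum l' B ∈ A.allAtoms ∨ Term.prod l' B ∈ A.allAtoms) → l' ≤ l

/-- `H` is in sum-product reduced form. -/
def IsSumProductReduced (H : SPTerm K₀ d v) : Prop :=
  IsReduced H ∧
  ∀ l A, (Term.sum l A ∈ H.allAtoms ∨ Term.prod l A ∈ H.allAtoms) → IsReducedBody l A

/-- A single sum or product `T`, written in the shape `1 ⊙ (T ^ 1)` of the reduced
representation. -/
def Term.single (T : SPTerm K₀ d v) : SPTerm K₀ d v := .mul (.base 1) (.pow T 1)

/-- `W ⊆ ΣΠ(𝔾)`. -/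
def IsSigmaPiSet (W : Set (SPTerm K₀ d v)) : Prop := ∀ T ∈ W, IsSigma T ∨ IsPi T

/-- `SumProd(W, 𝔾)`: the expressions in reduced representation whose sums and products are taken
from `W`. -/
def SumProdOver (W : Set (SPTerm K₀ d v)) : Set (SPTerm K₀ d v) :=
  {A | IsSumProd A ∧ ∃ X, IsReducedWith A X ∧ ∀ t ∈ X, ∀ p ∈ t.2, p.1 ∈ W}

/-- The multiplicand or summand of each product or sum in `W` is built by sums and products
from `W`. -/
def IsShiftStable (W : Set (SPTerm K₀ d v)) : Prop :=
  ∀ l A, (Term.sum l A ∈ W ∨ Term.prod l A ∈ W) → A.atoms ⊆ W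

/-- Elements of `SumProd(W, 𝔾)` with ultimately equal values are equal up to permutations of the
operands. -/
def IsCanonicalReduced (W : Set (SPTerm K₀ d v)) : Prop :=
  ∀ A ∈ SumProdOver W, ∀ B ∈ SumProdOver W,
    (∃ δ : ℕ, ∀ n ≥ δ, termValue A n = termValue B n) → A.OperandPerm B

/-- `W` is `σ`-reduced over `𝔾`. -/
structure IsSigmaReduced (W : Set (SPTerm K₀ d v)) : Prop where
  sigmaPi : IsSigmaPiSet W
  canonical : IsCanonicalReduced W
  shiftStable : IsShiftStable W
  reduced : ∀ T ∈ W, IsSumProductReduced (Term.single T)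

end Reduced

/-! ## Towers of ring extensions -/

/-- The type of a monomial: an `A`-monomial of order `ν`, a `P`-monomial or an `S`-monomial. -/
inductive MonomialKind
  | A (ν : ℕ)
  | P
  | S

/-- The exponents that are allowed in reduced representation. -/
def MonomialKind.exponents : MonomialKind → Set ℤ
  | .A ν => Set.Ico 0 ν
  | .P => Set.univ
  | .S => Set.Ici 0

/-- `t ^ m` for an integer `m` (for `m < 0` it is used for units `t` only). -/
def intPow {E : Type*} [CommRing E] (t : E) : ℤ → E
  | .ofNat n => t ^ n
  | .negSucc n => Ring.inverse t ^ (n + 1)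

/-- A commutative `G`-algebra `E` with a ring automorphism `σ`, elements `t_1, …, t_e` and the
assignment of a type to each `t_i`. -/
structure Tower (G : Type u) [Field G] (e : ℕ) where
  E : Type u
  [ring : CommRing E]
  [algebra : Algebra G E]
  σ : E ≃+* E
  t : Fin e → E
  kind : Fin e → MonomialKind

attribute [instance] Tower.ring Tower.algebra

namespace Tower

variable {G : Type u} [Field G] {e : ℕ} (𝓔 : Tower G e)

/-- The subring `G⟨t_1⟩…⟨t_i⟩` generated over `G` by the first `i` elements `t_j`, together with
the inverses of the `P`-monomials among them. -/
def stage (i : ℕ) : Subalgebra G 𝓔.E :=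
  Algebra.adjoin G {y | ∃ j : Fin e, (j : ℕ) < i ∧
    (y = 𝓔.t j ∨ (𝓔.kind j = .P ∧ y = Ring.inverse (𝓔.t j)))}

/-- The power product `t_1^{m_1} ⋯ t_e^{m_e}`. -/
def powerProduct (m : Fin e → ℤ) : 𝓔.E := ∏ j, intPow (𝓔.t j) (m j)

/-- `σ(t_i) / t_i` (for units `t_i`). -/
def quotient (i : Fin e) : 𝓔.E := 𝓔.σ (𝓔.t i) * Ring.inverse (𝓔.t i)

/-- `σ(t_i) - t_i`. -/
def difference (i : Fin e) : 𝓔.E := 𝓔.σ (𝓔.t i) - 𝓔.t i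

/-- `(E, σ)` with `E = G⟨t_1⟩…⟨t_e⟩` is an `APS`-extension of the difference ring `(G, σG)`. The
condition `free` says that the ring `A_i = A_{i-1}⟨t_i⟩` is free over `A_{i-1}` on the powers of
`t_i` with admissible exponents: it is `A_{i-1}[y]/(y^ν - 1)`, the ring of Laurent polynomials, or
the ring of polynomials. -/
structure IsAPS (σG : G ≃+* G) : Prop where
  injective : Function.Injective (algebraMap G 𝓔.E)
  shift_base : ∀ g : G, 𝓔.σ (algebraMap G 𝓔.E g) = algebraMap G 𝓔.E (σG g)
  stage_top : 𝓔.stage e = ⊤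
  free : ∀ i : Fin e, LinearIndependent (𝓔.stage i)
    (fun k : (𝓔.kind i).exponents => intPow (𝓔.t i) k)
  kindA : ∀ (i : Fin e) (ν : ℕ), 𝓔.kind i = .A ν →
    1 < ν ∧ 𝓔.t i ^ ν = 1 ∧
      ∃ α ∈ 𝓔.stage i, IsPrimitiveRoot α ν ∧ 𝓔.σ (𝓔.t i) = α * 𝓔.t i
  kindP : ∀ i : Fin e, 𝓔.kind i = .P →
    IsUnit (𝓔.t i) ∧
      ∃ α ∈ 𝓔.stage i, ∃ α' ∈ 𝓔.stage i, α * α' = 1 ∧ 𝓔.σ (𝓔.t i) = α * 𝓔.t i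
  kindS : ∀ i : Fin e, 𝓔.kind i = .S →
    ∃ β ∈ 𝓔.stage i, 𝓔.σ (𝓔.t i) = 𝓔.t i + β

/-- Basic: `σ(t_i)/t_i` is in the basic product group
`{h t_1^{m_1} ⋯ t_{i-1}^{m_{i-1}} | h ∈ G^*, m_j = 0 if t_j is an A- or S-monomial}` for each
`P`-monomial `t_i`, and is an element of `G^*` fixed by `σ` for each `A`-monomial `t_i`. -/
def IsBasic (σG : G ≃+* G) : Prop :=
  (∀ i : Fin e, 𝓔.kind i = .P → ∃ (h : G) (m : Fin e → ℤ), h ≠ 0 ∧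
    (∀ j, m j ≠ 0 → j < i ∧ 𝓔.kind j = .P) ∧
    𝓔.σ (𝓔.t i) = algebraMap G 𝓔.E h * 𝓔.powerProduct m * 𝓔.t i) ∧
  ∀ (i : Fin e) (ν : ℕ), 𝓔.kind i = .A ν → ∃ g : G, g ≠ 0 ∧ σG g = g ∧
    𝓔.σ (𝓔.t i) = algebraMap G 𝓔.E g * 𝓔.t i

/-- Simple: `σ(t_i)/t_i` is in the simple product group
`{h t_1^{m_1} ⋯ t_{i-1}^{m_{i-1}} | h ∈ G^*, m_j = 0 if t_j is an S-monomial}` for each `A`- and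
each `P`-monomial `t_i`. -/
def IsSimple : Prop :=
  ∀ i : Fin e, 𝓔.kind i ≠ .S → ∃ (h : G) (m : Fin e → ℤ), h ≠ 0 ∧
    (∀ j, m j ≠ 0 → j < i ∧ 𝓔.kind j ≠ .S) ∧
    𝓔.σ (𝓔.t i) = algebraMap G 𝓔.E h * 𝓔.powerProduct m * 𝓔.t i

/-- The constants of `(E, σ)` are those of `(G, σG)`. -/
def SameConstants (σG : G ≃+* G) : Prop :=
  {c : 𝓔.E | 𝓔.σ c = c} = algebraMap G 𝓔.E '' {g : G | σG g = g}

/-- An `RΠΣ`-extension. -/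
def IsRPiSigma (σG : G ≃+* G) : Prop := 𝓔.IsAPS σG ∧ 𝓔.SameConstants σG

end Tower

section Evaluation

variable {K₀ : Type u} [Field K₀] {d v e : ℕ}

/-- `ev`, `L`, `Z` are the evaluation function, the `o`-function and the `z`-function on `E` that
are obtained from those of `𝔾` by the iterative construction along the tower, where `l_i` is the
lower bound chosen for the sum or product that evaluates `t_i`. -/
structure IsInducedEvaluation (𝓔 : Tower (GroundField K₀ d v) e)
    (ev : 𝓔.E → ℕ → ConstField K₀ v) (L Z : 𝓔.E → ℕ) (l : Fin e → ℕ) : Prop where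
  ev_base : ∀ g n, ev (algebraMap (GroundField K₀ d v) 𝓔.E g) n = groundEv K₀ d v g n
  L_base : ∀ g, L (algebraMap (GroundField K₀ d v) 𝓔.E g) = groundL K₀ d v g
  Z_eq : ∀ (h : GroundField K₀ d v) (m : Fin e → ℤ), h ≠ 0 →
    (∀ j, m j ≠ 0 → 𝓔.kind j ≠ .S) →
    Z (algebraMap (GroundField K₀ d v) 𝓔.E h * 𝓔.powerProduct m) = groundZ K₀ d v h
  ev_poly : ∀ (i : Fin e) (c : (𝓔.kind i).exponents →₀ 𝓔.stage i) (n : ℕ),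
    ev (∑ k ∈ c.support, (c k : 𝓔.E) * intPow (𝓔.t i) k) n =
      ∑ k ∈ c.support, ev (c k : 𝓔.E) n * ev (𝓔.t i) n ^ (k : ℤ)
  L_poly : ∀ (i : Fin e) (c : (𝓔.kind i).exponents →₀ 𝓔.stage i),
    ∑ k ∈ c.support, (c k : 𝓔.E) * intPow (𝓔.t i) k ∉ 𝓔.stage i →
    L (∑ k ∈ c.support, (c k : 𝓔.E) * intPow (𝓔.t i) k) =
      max (l i - 1) (c.support.sup fun k => L (c k : 𝓔.E))
  kindA : ∀ (i : Fin e) (ν : ℕ), 𝓔.kind i = .A ν →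
    l i = 1 ∧ ∀ n, ev (𝓔.t i) n = ∏ k ∈ Finset.Icc (l i) n, ev (𝓔.σ.symm (𝓔.quotient i)) k
  kindP : ∀ i : Fin e, 𝓔.kind i = .P →
    max (L (𝓔.σ.symm (𝓔.quotient i))) (Z (𝓔.σ.symm (𝓔.quotient i))) ≤ l i ∧
    ∀ n, ev (𝓔.t i) n = ∏ k ∈ Finset.Icc (l i) n, ev (𝓔.σ.symm (𝓔.quotient i)) k
  kindS : ∀ i : Fin e, 𝓔.kind i = .S →
    L (𝓔.σ.symm (𝓔.difference i)) ≤ l i ∧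
    ∀ n, ev (𝓔.t i) n = ∑ k ∈ Finset.Icc (l i) n, ev (𝓔.σ.symm (𝓔.difference i)) k

/-- `F` arises from a reduced representation
`f = f_1 t_1^{m_{1,1}} ⋯ t_e^{m_{1,e}} + ⋯ + f_r t_1^{m_{r,1}} ⋯ t_e^{m_{r,e}}` of `f ∈ E` (factors
with exponent `0` are omitted; the order of the summands and factors is free) by replacing each
power of `t_j` by the power of `T_j`, `+` by `⊕` and `·` by `⊙`. -/
def IsTranslation (𝓔 : Tower (GroundField K₀ d v) e) (T : Fin e → SPTerm K₀ d v) (f : 𝓔.E)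
    (F : SPTerm K₀ d v) : Prop :=
  ∃ Y : MonomialList (Fin e) (GroundField K₀ d v),
    IsReducedList (fun j z => z ≠ 0 ∧ z ∈ (𝓔.kind j).exponents) Y ∧
    f = (Y.map fun s => algebraMap (GroundField K₀ d v) 𝓔.E s.1 *
      (s.2.map fun p => intPow (𝓔.t p.1) p.2).prod).sum ∧
    F = Term.ofMonomials (Y.map fun s => (s.1, s.2.map fun p => (T p.1, p.2)))

/-- `T_i = expr(t_i)` for all `i`: the canonical induced sum-product expressions are `RPow(α)` with
`α = σ(t_i)/t_i ∈ R` for an `A`-monomial, `Prod(l_i, F)` with `F` the translation of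
`σ⁻¹(σ(t_i)/t_i)` for a `P`-monomial, and `Sum(l_i, F)` with `F` the translation of
`σ⁻¹(σ(t_i) - t_i)` for an `S`-monomial. -/
def IsExprOf (𝓔 : Tower (GroundField K₀ d v) e) (l : Fin e → ℕ) (T : Fin e → SPTerm K₀ d v) :
    Prop :=
  ∀ i : Fin e,
    match 𝓔.kind i with
    | .A _ => ∃ r : ConstField K₀ v, IsNontrivialRootOfUnity r ∧ T i = .rpow r ∧
        𝓔.σ (𝓔.t i) =
          algebraMap (GroundField K₀ d v) 𝓔.E (algebraMap _ (GroundField K₀ d v) r) * 𝓔.t i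
    | .P => ∃ F, IsTranslation 𝓔 T (𝓔.σ.symm (𝓔.quotient i)) F ∧ T i = .prod (l i) F
    | .S => ∃ F, IsTranslation 𝓔 T (𝓔.σ.symm (𝓔.difference i)) F ∧ T i = .sum (l i) F

/-- The tower carries an evaluation function, constructed iteratively, with `expr(t_i) = T_i` for
all `i`. -/
def ModelsFamily (𝓔 : Tower (GroundField K₀ d v) e) (T : Fin e → SPTerm K₀ d v) : Prop :=
  ∃ (ev : 𝓔.E → ℕ → ConstField K₀ v) (L Z : 𝓔.E → ℕ) (l : Fin e → ℕ),
    IsInducedEvaluation 𝓔 ev L Z l ∧ IsExprOf 𝓔 l T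

end Evaluation

end SigmaReduction

end

noncomputable section

namespace SigmaReduction

universe u

/-! ## Evaluation in the ground field -/

section GroundEvaluation

variable {K₀ : Type u} [Field K₀] {d v : ℕ}

/-! Everything is compared inside the ring of germs at infinity of sequences over `ConstField K₀ v`.
The shift is an automorphism of this ring, and its fixed elements are the constant germs, because `a
(n + 1) = a n` for all large `n` makes `a` ultimately constant. A nonzero polynomial over the
constant field does not vanish at `(k, q_1^k, …, q_v^k)` for large `k`, so evaluation is a ring
homomorphism from the ground field to the germs. It is compatible with the shifts, and its image
contains all constant germs.

From a tower to a `σ`-reduced set: the induced evaluation yields a ring homomorphism `Φ` from the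
tower to the germs which sends `t_i` to the germ of `T_i` and commutes with the shifts
(`exists_evaluation_ringHom`, `evaluation_shift`). An `RΠΣ`-extension has no proper nonzero ideal
closed under the shift (`Tower.isStageSimple`), so `Φ` is injective
(`Tower.injective_of_isRPiSigma`). Hence two reduced expressions with ultimately equal values come
from the same element of the tower. The power products with admissible exponents form a basis over
the ground field, so the monomials of the two expressions agree up to order (`perm_of_elemOf_eq`).

From a `σ`-reduced set to a tower: take the subring of germs generated by the ground field, the
germs of the `T_i` and the inverses of the germs of products. Canonicity makes the power products
linearly independent (`powProdIndependent_germs`), which is the freeness of each adjunction. The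
recurrences of sums and products describe the shift, and no new constants arise, since constant
germs already come from the ground field (`exists_realizes`). The evaluation on this tower is
defined through coordinates with respect to the basis of power products (`Realizes.modelsFamily`).

One tower serves both parts. A multiplicand is a single monomial free of sums, so the quotients
`σ(t_i)/t_i` are power products in `A`- and `P`-monomials, and the tower is simple. If no
multiplicand has a factor `RPow(r)^z`, the quotients of the `P`-monomials involve `P`-monomials
only, and the tower is basic. -/

lemma eventually_polynomial_eval_ne_zero (hd : d ≤ 1) (hchar : d = 1 → CharZero K₀)
    (Q : Polynomial K₀) (hQ : Q ≠ 0) (hdeg : d = 0 → Q.natDegree = 0) :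
    ∃ δ : ℕ, ∀ k ≥ δ, Q.eval (k : K₀) ≠ 0 := by
  rcases Nat.le_one_iff_eq_zero_or_eq_one.mp hd with h | h
  · obtain ⟨c, rfl⟩ := Polynomial.natDegree_eq_zero.mp (hdeg h)
    refine ⟨0, fun k _ => ?_⟩
    simpa using hQ
  · have := hchar h
    have hfin : {k : ℕ | Q.IsRoot (k : K₀)}.Finite :=
      (Polynomial.finite_setOfPred_isRoot hQ).preimage (Nat.cast_injective.injOn)
    obtain ⟨b, hb⟩ := hfin.bddAbove
    refine ⟨b + 1, fun k hk h0 => ?_⟩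
    have := hb (show k ∈ {k : ℕ | Q.IsRoot (k : K₀)} from h0)
    omega

/-- The exponents of the `x_i` in a monomial of `K[x, x_1, …, x_v]`. -/
def rightExponents (w : Fin d ⊕ Fin v →₀ ℕ) : Fin v →₀ ℕ :=
  Finsupp.equivFunOnFinite.symm fun i => w (Sum.inr i)

/-- Separates the two effects of evaluation on a monomial: a scalar power of `k` and a displacement
of the `q`-exponents proportional to `k`. The displacement is what keeps different monomials apart
for large `k`. -/
lemma eval_integral_monomial (k : ℕ) (w : Fin d ⊕ Fin v →₀ ℕ) (c : MvPolynomial (Fin v) K₀) :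
    c * ∏ i, (Sum.elim (fun _ => (k : MvPolynomial (Fin v) K₀))
        (fun i => MvPolynomial.X i ^ k) i) ^ w i =
      MvPolynomial.C ((k : K₀) ^ (∑ j, w (Sum.inl j))) *
        (c * MvPolynomial.monomial (k • rightExponents w) 1) := by
  rw [Fintype.prod_sum_type]
  have h1 : ∏ j : Fin d, (k : MvPolynomial (Fin v) K₀) ^ w (Sum.inl j) =
      MvPolynomial.C ((k : K₀) ^ (∑ j, w (Sum.inl j))) := by
    rw [Finset.prod_pow_eq_pow_sum]; simp
  have h2 : ∏ i : Fin v, ((MvPolynomial.X i : MvPolynomial (Fin v) K₀) ^ k) ^ w (Sum.inr i) =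
      MvPolynomial.monomial (k • rightExponents w) 1 := by
    rw [MvPolynomial.monomial_eq, Finsupp.prod_fintype _ _ (by simp)]
    simp [rightExponents, pow_mul]
  simp only [Sum.elim_inl, Sum.elim_inr]
  rw [h1, h2]; ring

/-- Monomials with different exponents in the `x_i` are displaced by vectors that differ by at least
`k` in some coordinate, while the `q`-degrees of the coefficients are bounded. So for large `k` one
suitable `q`-coefficient of the value is `Q(k)`, with a fixed nonzero polynomial `Q` over `K₀`. -/
lemma eventually_integral_eval_ne_zero (hd : d ≤ 1) (hchar : d = 1 → CharZero K₀)
    (P : MvPolynomial (Fin d ⊕ Fin v) (MvPolynomial (Fin v) K₀)) (hP : P ≠ 0) :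
    ∃ δ : ℕ, ∀ k ≥ δ, MvPolynomial.eval (Sum.elim (fun _ => (k : MvPolynomial (Fin v) K₀))
        (fun i => MvPolynomial.X i ^ k)) P ≠ 0 := by
  classical
  obtain ⟨w₀, hw₀⟩ := MvPolynomial.ne_zero_iff.mp hP
  obtain ⟨u, hu⟩ := MvPolynomial.ne_zero_iff.mp hw₀
  set m := rightExponents w₀ with hm
  -- For large `k`, `Q(k)` is the coefficient of the monomial with exponent `u + k • m` in the value
  -- at `k`.
  set Q : Polynomial K₀ := ∑ w ∈ P.support with rightExponents w = m,
    Polynomial.C (MvPolynomial.coeff u (MvPolynomial.coeff w P)) *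
      Polynomial.X ^ (∑ j, w (Sum.inl j)) with hQdef
  -- At most one variable `x` is present, so its exponent together with those of the `x_i`
  -- determines the monomial. Hence nothing cancels in `Q` at the exponent given by `w₀`.
  have hinj : ∀ w, rightExponents w = m → (∑ j, w (Sum.inl j)) = ∑ j, w₀ (Sum.inl j) →
      w = w₀ := by
    intro w h1 h2
    ext (j | i)
    · rcases Nat.le_one_iff_eq_zero_or_eq_one.mp hd with h | h
      · subst h; exact j.elim0
      · subst h
        have := Subsingleton.elim j 0
        subst this
        simpa using h2
    · simpa [rightExponents, hm] using DFunLike.congr_fun h1 i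
  have hQ : Q ≠ 0 := by
    intro h0
    have : Q.coeff (∑ j, w₀ (Sum.inl j)) = MvPolynomial.coeff u (MvPolynomial.coeff w₀ P) := by
      rw [hQdef, Polynomial.finsetSum_coeff, Finset.sum_eq_single w₀]
      · simp
      · intro w hw hne
        rw [Finset.mem_filter] at hw
        rw [Polynomial.coeff_C_mul_X_pow, if_neg]
        exact fun h => hne (hinj w hw.2 h.symm)
      · intro h
        exfalso
        exact h (Finset.mem_filter.mpr ⟨MvPolynomial.mem_support_iff.mpr hw₀, rfl⟩)
    rw [h0] at this
    exact hu (by rw [← this]; simp)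
  obtain ⟨δ, hδ⟩ := eventually_polynomial_eval_ne_zero hd hchar Q hQ (by
    intro h
    subst h
    rw [hQdef]
    simp only [Finset.univ_eq_empty, Finset.sum_empty, pow_zero, mul_one]
    rw [← map_sum]
    exact Polynomial.natDegree_C _)
  -- A common bound for all `q`-exponents in the coefficients of `P`.
  set N := ∑ w ∈ P.support, (MvPolynomial.coeff w P).totalDegree with hN
  have hbound : ∀ w u', MvPolynomial.coeff u' (MvPolynomial.coeff w P) ≠ 0 → ∀ i, u' i ≤ N := by
    intro w u' h i
    have hw : w ∈ P.support := by
      rw [MvPolynomial.mem_support_iff]; rintro h0; rw [h0] at h; simp at h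
    calc u' i ≤ u'.sum fun _ e => e := by
          by_cases hi : i ∈ u'.support
          · exact Finset.single_le_sum (f := fun i => u' i) (fun _ _ => Nat.zero_le _) hi
          · rw [Finsupp.notMem_support_iff.mp hi]; exact Nat.zero_le _
      _ ≤ _ := MvPolynomial.le_totalDegree (MvPolynomial.mem_support_iff.mpr h)
      _ ≤ N := Finset.single_le_sum (f := fun w => (MvPolynomial.coeff w P).totalDegree)
          (fun _ _ => Nat.zero_le _) hw
  refine ⟨max δ (N + 1), fun k hk h0 => hδ k (le_trans (le_max_left _ _) hk) ?_⟩
  have hkN : N < k := lt_of_lt_of_le (Nat.lt_succ_self N) (le_trans (le_max_right _ _) hk)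
  have hc := congrArg (MvPolynomial.coeff (u + k • m)) h0
  rw [MvPolynomial.eval_eq'] at hc
  simp only [eval_integral_monomial] at hc
  rw [MvPolynomial.coeff_sum, MvPolynomial.coeff_zero] at hc
  rw [← hc, hQdef, Polynomial.eval_finsetSum, Finset.sum_filter]
  refine Finset.sum_congr rfl fun w hw => ?_
  rw [MvPolynomial.coeff_C_mul, MvPolynomial.coeff_mul_monomial', mul_one]
  split_ifs with h1 h2 h2
  · rw [h1, add_tsub_cancel_right]; simp [mul_comm]
  · exact absurd (by rw [h1]; exact le_add_self) h2
  -- Monomials with other `x_i`-exponents do not reach the exponent `u + k • m`: in some coordinate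
  -- the displacements differ by at least `k > N`.
  · suffices MvPolynomial.coeff (u + k • m - k • rightExponents w) (MvPolynomial.coeff w P) = 0 by
      rw [this, mul_zero]
    by_contra hne
    have hb := hbound w _ hne
    have hub := hbound w₀ u hu
    apply h1
    ext i
    have h3 := hb i
    have h4 := hub i
    have h5 := h2 i
    simp only [Finsupp.coe_tsub, Finsupp.coe_add, Finsupp.coe_smul, Pi.sub_apply, Pi.add_apply,
      Pi.smul_apply, smul_eq_mul] at h3 h5
    rcases lt_trichotomy (rightExponents w i) (m i) with h | h | h
    · have : k * rightExponents w i + k ≤ k * m i := by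
        rw [← Nat.mul_succ]; exact Nat.mul_le_mul_left _ h
      omega
    · exact h
    · have : k * m i + k ≤ k * rightExponents w i := by
        rw [← Nat.mul_succ]; exact Nat.mul_le_mul_left _ h
      omega
  · rw [mul_zero]

/-- Multiplying by a common denominator of the finitely many coefficients reduces to coefficients
that are polynomials in the `q_i`. -/
lemma eventually_eval_ne_zero (hd : d ≤ 1) (hchar : d = 1 → CharZero K₀)
    (p : GroundPoly K₀ d v) (hp : p ≠ 0) :
    ∃ δ : ℕ, ∀ k ≥ δ, MvPolynomial.eval (evalPoint K₀ d v k) p ≠ 0 := by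
  classical
  obtain ⟨b, hb⟩ := IsLocalization.exist_integer_multiples_of_finset
    (nonZeroDivisors (MvPolynomial (Fin v) K₀)) (p.support.image fun w => p.coeff w)
  choose! a ha using hb
  set P : MvPolynomial (Fin d ⊕ Fin v) (MvPolynomial (Fin v) K₀) :=
    ∑ w ∈ p.support, MvPolynomial.monomial w (a (p.coeff w)) with hPdef
  have hP : MvPolynomial.map (algebraMap _ (ConstField K₀ v)) P =
      MvPolynomial.C (algebraMap _ (ConstField K₀ v) (b : MvPolynomial (Fin v) K₀)) * p := by
    conv_rhs => rw [p.as_sum]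
    rw [hPdef, map_sum, Finset.mul_sum]
    refine Finset.sum_congr rfl fun w hw => ?_
    rw [MvPolynomial.map_monomial, MvPolynomial.C_mul_monomial,
      ha _ (Finset.mem_image_of_mem _ hw), Algebra.smul_def]
  have hb0 : algebraMap _ (ConstField K₀ v) (b : MvPolynomial (Fin v) K₀) ≠ 0 :=
    IsFractionRing.to_map_ne_zero_of_mem_nonZeroDivisors b.2
  have hP0 : P ≠ 0 := by
    rintro h
    rw [h, map_zero] at hP
    exact (mul_ne_zero (MvPolynomial.C_ne_zero.mpr hb0) hp) hP.symm
  obtain ⟨δ, hδ⟩ := eventually_integral_eval_ne_zero hd hchar P hP0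
  refine ⟨δ, fun k hk h0 => hδ k hk ?_⟩
  apply IsFractionRing.injective (MvPolynomial (Fin v) K₀) (ConstField K₀ v)
  have h1 := congrArg (MvPolynomial.eval (evalPoint K₀ d v k)) hP
  rw [map_mul, h0, mul_zero, MvPolynomial.eval_map] at h1
  have h2 := MvPolynomial.eval₂_comp_left (algebraMap (MvPolynomial (Fin v) K₀) (ConstField K₀ v))
    (RingHom.id _) (Sum.elim (fun _ : Fin d => (k : MvPolynomial (Fin v) K₀))
        (fun i => MvPolynomial.X i ^ k)) P
  rw [MvPolynomial.eval₂_id, RingHom.comp_id] at h2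
  rw [map_zero, h2, ← h1]
  congr 1
  ext (j | i) <;> simp [evalPoint, qElem]


/-! ### Values of reduced fractions. -/

variable (K₀ d v) in
/-- The denominator of the reduced representation of `f`. -/
abbrev denom (f : GroundField K₀ d v) : GroundPoly K₀ d v :=
  IsFractionRing.den (GroundPoly K₀ d v) f

variable (K₀ d v) in
/-- The numerator of the reduced representation of `f`. -/
abbrev numer (f : GroundField K₀ d v) : GroundPoly K₀ d v :=
  IsFractionRing.num (GroundPoly K₀ d v) f

lemma denom_ne_zero (f : GroundField K₀ d v) : denom K₀ d v f ≠ 0 :=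
  nonZeroDivisors.ne_zero (IsFractionRing.den (GroundPoly K₀ d v) f).2

lemma mul_denom_eq_numer_mul {f : GroundField K₀ d v} {a b : GroundPoly K₀ d v} (hb : b ≠ 0)
    (hf : f = algebraMap _ _ a / algebraMap _ _ b) :
    a * denom K₀ d v f = numer K₀ d v f * b := by
  have hd : algebraMap _ (GroundField K₀ d v) (denom K₀ d v f) ≠ 0 := by
    simp
  have hb' : algebraMap _ (GroundField K₀ d v) b ≠ 0 := by simpa using hb
  have h := IsFractionRing.mk'_num_den' (GroundPoly K₀ d v) f
  rw [hf] at h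
  apply IsFractionRing.injective (GroundPoly K₀ d v) (GroundField K₀ d v)
  rw [← hf, hf, div_eq_div_iff (by rwa [← hf]) hb'] at h
  rw [map_mul, map_mul, hf, h, ← hf]

/-- Coprimality of the reduced numerator and denominator. It allows values to be computed from any
fraction that represents `f` and whose denominator does not vanish at the point. -/
lemma denom_dvd {f : GroundField K₀ d v} {a b : GroundPoly K₀ d v} (hb : b ≠ 0)
    (hf : f = algebraMap _ _ a / algebraMap _ _ b) : denom K₀ d v f ∣ b := by
  have h := mul_denom_eq_numer_mul hb hf
  exact (IsFractionRing.num_den_reduced (GroundPoly K₀ d v) f).symm.dvd_of_dvd_mul_left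
    (Dvd.intro_left _ h)

lemma eval_denom_ne_zero {f : GroundField K₀ d v} {a b : GroundPoly K₀ d v} {k : ℕ}
    (hb : MvPolynomial.eval (evalPoint K₀ d v k) b ≠ 0)
    (hf : f = algebraMap _ _ a / algebraMap _ _ b) :
    MvPolynomial.eval (evalPoint K₀ d v k) (denom K₀ d v f) ≠ 0 := by
  have hb0 : b ≠ 0 := by rintro rfl; simp at hb
  obtain ⟨c, rfl⟩ := denom_dvd hb0 hf
  rw [map_mul] at hb
  exact left_ne_zero_of_mul hb

lemma groundEv_eq_div {f : GroundField K₀ d v} {a b : GroundPoly K₀ d v} {k : ℕ}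
    (hb : MvPolynomial.eval (evalPoint K₀ d v k) b ≠ 0)
    (hf : f = algebraMap _ _ a / algebraMap _ _ b) :
    groundEv K₀ d v f k = MvPolynomial.eval (evalPoint K₀ d v k) a /
      MvPolynomial.eval (evalPoint K₀ d v k) b := by
  have hb0 : b ≠ 0 := by rintro rfl; simp at hb
  have hd := eval_denom_ne_zero hb hf
  have h := congrArg (MvPolynomial.eval (evalPoint K₀ d v k)) (mul_denom_eq_numer_mul hb0 hf)
  rw [map_mul, map_mul] at h
  unfold groundEv
  simp only
  rw [if_neg hd, div_eq_div_iff hd hb, h]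

lemma eq_numer_div_denom (f : GroundField K₀ d v) :
    f = algebraMap _ _ (numer K₀ d v f) / algebraMap _ _ (denom K₀ d v f) :=
  (IsFractionRing.mk'_num_den' (GroundPoly K₀ d v) f).symm

/-- The defining set is nonempty, so the infimum is attained. For an empty set `sInf` would be the
default `0`, which carries no information. -/
lemma groundL_spec (hd : d ≤ 1) (hchar : d = 1 → CharZero K₀) (f : GroundField K₀ d v) :
    ∀ k ≥ groundL K₀ d v f, MvPolynomial.eval (evalPoint K₀ d v k) (denom K₀ d v f) ≠ 0 :=
  Nat.sInf_mem (s := {δ : ℕ | ∀ k ≥ δ, MvPolynomial.eval (evalPoint K₀ d v k)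
    (denom K₀ d v f) ≠ 0}) (eventually_eval_ne_zero hd hchar _ (denom_ne_zero f))

/-- The reduced denominator of `1/p` is a multiple of `p`, so its nonvanishing passes to `p`. -/
lemma eval_ne_zero_of_groundL_inv_le (hd : d ≤ 1) (hchar : d = 1 → CharZero K₀)
    {p : GroundPoly K₀ d v} (hp : p ≠ 0) {k : ℕ}
    (hk : groundL K₀ d v (algebraMap (GroundPoly K₀ d v) _ p)⁻¹ ≤ k) :
    MvPolynomial.eval (evalPoint K₀ d v k) p ≠ 0 := by
  have h1 := groundL_spec hd hchar _ k hk
  have hp' : algebraMap _ (GroundField K₀ d v) p ≠ 0 := by simpa using hp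
  have h2 := mul_denom_eq_numer_mul (f := (algebraMap (GroundPoly K₀ d v)
    (GroundField K₀ d v) p)⁻¹) (a := 1) (b := p) hp (by simp)
  rw [one_mul] at h2
  rw [h2, map_mul] at h1
  exact right_ne_zero_of_mul h1

lemma groundEv_ne_zero (hd : d ≤ 1) (hchar : d = 1 → CharZero K₀)
    {f : GroundField K₀ d v} (hf : f ≠ 0) {k : ℕ} (hk : groundZ K₀ d v f ≤ k) :
    groundEv K₀ d v f k ≠ 0 := by
  have hn : numer K₀ d v f ≠ 0 := fun h => hf ((IsFractionRing.num_eq_zero f).mp h)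
  have h1 := eval_ne_zero_of_groundL_inv_le hd hchar hn (le_trans (le_max_left _ _) hk)
  have h2 := eval_ne_zero_of_groundL_inv_le hd hchar (denom_ne_zero f)
    (le_trans (le_max_right _ _) hk)
  rw [groundEv_eq_div h2 (eq_numer_div_denom f)]
  exact div_ne_zero h1 h2

lemma groundEv_algebraMap (p : GroundPoly K₀ d v) (k : ℕ) :
    groundEv K₀ d v (algebraMap _ _ p) k = MvPolynomial.eval (evalPoint K₀ d v k) p := by
  rw [groundEv_eq_div (a := p) (b := 1) (by simp) (by simp)]
  simp

@[simp] lemma groundEv_zero (k : ℕ) : groundEv K₀ d v 0 k = 0 := by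
  simpa using groundEv_algebraMap (0 : GroundPoly K₀ d v) k

@[simp] lemma groundEv_one (k : ℕ) : groundEv K₀ d v 1 k = 1 := by
  simpa using groundEv_algebraMap (1 : GroundPoly K₀ d v) k

lemma groundEv_const (c : ConstField K₀ v) (k : ℕ) :
    groundEv K₀ d v (algebraMap _ _ c) k = c := by
  have : algebraMap (ConstField K₀ v) (GroundField K₀ d v) c =
      algebraMap _ _ (MvPolynomial.C c : GroundPoly K₀ d v) := by
    rw [IsScalarTower.algebraMap_apply (ConstField K₀ v) (GroundPoly K₀ d v)]
    rfl
  rw [this, groundEv_algebraMap, MvPolynomial.eval_C]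

/-- The reduced denominator of `0` is a unit. The value agrees with the empty supremum that
`familyL` assigns to the zero element. -/
lemma groundL_zero : groundL K₀ d v 0 = 0 := by
  unfold groundL
  rw [Nat.sInf_eq_zero]
  left
  intro k _
  have := IsFractionRing.isUnit_den_zero (A := GroundPoly K₀ d v) (K := GroundField K₀ d v)
  exact (this.map (MvPolynomial.eval (evalPoint K₀ d v k))).ne_zero

lemma groundEv_add {f g : GroundField K₀ d v} {k : ℕ}
    (hf : MvPolynomial.eval (evalPoint K₀ d v k) (denom K₀ d v f) ≠ 0)
    (hg : MvPolynomial.eval (evalPoint K₀ d v k) (denom K₀ d v g) ≠ 0) :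
    groundEv K₀ d v (f + g) k = groundEv K₀ d v f k + groundEv K₀ d v g k := by
  have hf' : algebraMap _ (GroundField K₀ d v) (denom K₀ d v f) ≠ 0 := by
    simp
  have hg' : algebraMap _ (GroundField K₀ d v) (denom K₀ d v g) ≠ 0 := by
    simp
  rw [groundEv_eq_div hf (eq_numer_div_denom f), groundEv_eq_div hg (eq_numer_div_denom g),
    groundEv_eq_div (f := f + g)
      (a := numer K₀ d v f * denom K₀ d v g + denom K₀ d v f * numer K₀ d v g)
      (b := denom K₀ d v f * denom K₀ d v g) (by rw [map_mul]; exact mul_ne_zero hf hg)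
      (by
        conv_lhs => rw [eq_numer_div_denom f, eq_numer_div_denom g]
        rw [div_add_div _ _ hf' hg']; simp only [map_mul, map_add]),
    div_add_div _ _ hf hg]
  simp only [map_mul, map_add]

lemma groundEv_mul {f g : GroundField K₀ d v} {k : ℕ}
    (hf : MvPolynomial.eval (evalPoint K₀ d v k) (denom K₀ d v f) ≠ 0)
    (hg : MvPolynomial.eval (evalPoint K₀ d v k) (denom K₀ d v g) ≠ 0) :
    groundEv K₀ d v (f * g) k = groundEv K₀ d v f k * groundEv K₀ d v g k := by
  rw [groundEv_eq_div hf (eq_numer_div_denom f), groundEv_eq_div hg (eq_numer_div_denom g),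
    groundEv_eq_div (f := f * g) (a := numer K₀ d v f * numer K₀ d v g)
      (b := denom K₀ d v f * denom K₀ d v g) (by rw [map_mul]; exact mul_ne_zero hf hg)
      (by
        conv_lhs => rw [eq_numer_div_denom f, eq_numer_div_denom g]
        rw [div_mul_div_comm]; simp only [map_mul]),
    div_mul_div_comm]
  simp only [map_mul]

/-! ### Compatibility of evaluation and shift. -/

lemma polyShift_apply (p : GroundPoly K₀ d v) :
    polyShift K₀ d v p = MvPolynomial.aeval (Sum.elim
      (fun j => (MvPolynomial.X (Sum.inl j) + 1 : GroundPoly K₀ d v))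
      (fun i => MvPolynomial.C (qElem K₀ v i) * MvPolynomial.X (Sum.inr i))) p := rfl

lemma eval_polyShift (p : GroundPoly K₀ d v) (k : ℕ) :
    MvPolynomial.eval (evalPoint K₀ d v k) (polyShift K₀ d v p) =
      MvPolynomial.eval (evalPoint K₀ d v (k + 1)) p := by
  rw [polyShift_apply]
  induction p using MvPolynomial.induction_on with
  | C a => rw [MvPolynomial.aeval_C, MvPolynomial.algebraMap_eq, MvPolynomial.eval_C,
      MvPolynomial.eval_C]
  | add p q hp hq => rw [map_add, map_add, map_add, hp, hq]
  | mul_X p i hp =>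
    rw [map_mul, map_mul, map_mul, hp, MvPolynomial.aeval_X, MvPolynomial.eval_X]
    congr 1
    rcases i with j | i
    · rw [Sum.elim_inl, map_add, MvPolynomial.eval_X, map_one]
      simp only [evalPoint, Sum.elim_inl, Nat.cast_add, Nat.cast_one]
    · rw [Sum.elim_inr, map_mul, MvPolynomial.eval_X, MvPolynomial.eval_C]
      simp only [evalPoint, Sum.elim_inr]
      rw [pow_succ, mul_comm]

lemma groundShift_algebraMap (p : GroundPoly K₀ d v) :
    groundShift K₀ d v (algebraMap _ _ p) = algebraMap _ _ (polyShift K₀ d v p) := by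
  unfold groundShift
  exact IsFractionRing.ringEquivOfRingEquiv_algebraMap _ p

lemma groundEv_shift {f : GroundField K₀ d v} {k : ℕ}
    (hf : MvPolynomial.eval (evalPoint K₀ d v (k + 1)) (denom K₀ d v f) ≠ 0) :
    groundEv K₀ d v (groundShift K₀ d v f) k = groundEv K₀ d v f (k + 1) := by
  rw [groundEv_eq_div hf (eq_numer_div_denom f),
    groundEv_eq_div (a := polyShift K₀ d v (numer K₀ d v f))
      (b := polyShift K₀ d v (denom K₀ d v f)) (by rwa [eval_polyShift])
      (by
        conv_lhs => rw [eq_numer_div_denom f]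
        rw [map_div₀, groundShift_algebraMap, groundShift_algebraMap]),
    eval_polyShift, eval_polyShift]

lemma groundShift_const (c : ConstField K₀ v) :
    groundShift K₀ d v (algebraMap _ _ c) = algebraMap _ _ c := by
  rw [IsScalarTower.algebraMap_apply (ConstField K₀ v) (GroundPoly K₀ d v),
    groundShift_algebraMap, AlgEquiv.commutes]

end GroundEvaluation

/-! ## Germs of sequences at infinity -/

section Germs

variable (K₀ : Type u) [Field K₀] (d v : ℕ)

/-- Sequences with values in `K`, up to finitely many terms. -/
abbrev SeqGerm : Type u := Filter.Germ (Filter.atTop : Filter ℕ) (ConstField K₀ v)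

variable {K₀ v} in
/-- The germ of a sequence. -/
def toGerm (a : ℕ → ConstField K₀ v) : SeqGerm K₀ v := (a : SeqGerm K₀ v)

variable {K₀ v} in
lemma toGerm_eq_iff {a b : ℕ → ConstField K₀ v} :
    toGerm a = toGerm b ↔ ∃ δ : ℕ, ∀ n ≥ δ, a n = b n := by
  unfold toGerm
  rw [Filter.Germ.coe_eq]
  exact Filter.eventually_atTop

variable {K₀ v} in
lemma exists_eq_toGerm (x : SeqGerm K₀ v) : ∃ a, x = toGerm a := by
  induction x using Filter.Germ.inductionOn with
  | _ a => exact ⟨a, rfl⟩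

/-- The shift of germs of sequences. -/
def germShift : SeqGerm K₀ v ≃+* SeqGerm K₀ v where
  toFun x := x.compTendsto (fun n => n + 1) (Filter.tendsto_add_atTop_nat 1)
  -- Truncated subtraction affects only the index `0`, which a germ ignores.
  invFun x := x.compTendsto (fun n => n - 1) (Filter.tendsto_sub_atTop_nat 1)
  left_inv x := by
    obtain ⟨a, rfl⟩ := exists_eq_toGerm x
    exact toGerm_eq_iff.mpr ⟨1, fun n hn => by simp [Nat.sub_add_cancel hn]⟩
  right_inv x := by
    obtain ⟨a, rfl⟩ := exists_eq_toGerm x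
    exact toGerm_eq_iff.mpr ⟨0, fun n _ => by simp⟩
  map_mul' x y := by
    obtain ⟨a, rfl⟩ := exists_eq_toGerm x
    obtain ⟨b, rfl⟩ := exists_eq_toGerm y
    rfl
  map_add' x y := by
    obtain ⟨a, rfl⟩ := exists_eq_toGerm x
    obtain ⟨b, rfl⟩ := exists_eq_toGerm y
    rfl

variable {K₀ v} in
lemma germShift_toGerm (a : ℕ → ConstField K₀ v) :
    germShift K₀ v (toGerm a) = toGerm fun n => a (n + 1) := rfl

variable {d v} in
/-- The germ of the values of an element of the ground field. -/
def groundGerm (hd : d ≤ 1) (hchar : d = 1 → CharZero K₀) : GroundField K₀ d v →+* SeqGerm K₀ v where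
  toFun f := toGerm (groundEv K₀ d v f)
  map_one' := toGerm_eq_iff.mpr ⟨0, fun n _ => by simp⟩
  map_zero' := toGerm_eq_iff.mpr ⟨0, fun n _ => by simp⟩
  map_mul' f g := toGerm_eq_iff.mpr ⟨max (groundL K₀ d v f) (groundL K₀ d v g), fun n hn =>
    groundEv_mul (groundL_spec hd hchar f n (le_trans (le_max_left _ _) hn))
      (groundL_spec hd hchar g n (le_trans (le_max_right _ _) hn))⟩
  map_add' f g := toGerm_eq_iff.mpr ⟨max (groundL K₀ d v f) (groundL K₀ d v g), fun n hn =>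
    groundEv_add (groundL_spec hd hchar f n (le_trans (le_max_left _ _) hn))
      (groundL_spec hd hchar g n (le_trans (le_max_right _ _) hn))⟩

variable {K₀ d v}

lemma groundGerm_apply (hd : d ≤ 1) (hchar : d = 1 → CharZero K₀) (f : GroundField K₀ d v) :
    groundGerm K₀ hd hchar f = toGerm (groundEv K₀ d v f) := rfl

lemma germShift_groundGerm (hd : d ≤ 1) (hchar : d = 1 → CharZero K₀) (f : GroundField K₀ d v) :
    germShift K₀ v (groundGerm K₀ hd hchar f) = groundGerm K₀ hd hchar (groundShift K₀ d v f) := by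
  rw [groundGerm_apply, germShift_toGerm, groundGerm_apply, toGerm_eq_iff]
  exact ⟨groundL K₀ d v f, fun n hn =>
    (groundEv_shift (groundL_spec hd hchar f (n + 1) (Nat.le_succ_of_le hn))).symm⟩

/-- Reason why no new constants can appear inside the ring of germs: invariance under the shift
propagates one value to all later indices. -/
lemma exists_const_of_germShift_eq {x : SeqGerm K₀ v} (hx : germShift K₀ v x = x) :
    ∃ c : ConstField K₀ v, x = toGerm fun _ => c := by
  obtain ⟨a, rfl⟩ := exists_eq_toGerm x
  rw [germShift_toGerm, toGerm_eq_iff] at hx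
  obtain ⟨δ, hδ⟩ := hx
  refine ⟨a δ, toGerm_eq_iff.mpr ⟨δ, fun n hn => ?_⟩⟩
  induction n, hn using Nat.le_induction with
  | base => rfl
  | succ n hn ih => rw [hδ n hn, ih]

end Germs

/-! ## Integer powers and power products -/

section IntPow

variable {R R' : Type*} [CommRing R] [CommRing R']

/-- The exponents for which the laws of powers hold. -/
def MonomialKind.domain : MonomialKind → Set ℤ
  | .S => Set.Ici 0
  | _ => Set.univ

/-- Reduction of an exponent to an admissible one. -/
def MonomialKind.reduce : MonomialKind → ℤ → ℤ
  | .A ν, z => z % ν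
  | _, z => z

/-- The algebraic relations which a monomial of the given kind satisfies. -/
def MonomialKind.Holds : MonomialKind → R → Prop
  | .A ν, t => 1 < ν ∧ t ^ ν = 1
  | .P, t => IsUnit t
  | .S, _ => True

lemma MonomialKind.Holds.isUnit {κ : MonomialKind} {t : R} (h : κ.Holds t) (hκ : κ ≠ .S) :
    IsUnit t := by
  cases κ with
  | A ν => exact IsUnit.of_pow_eq_one h.2 (by have := h.1; omega)
  | P => exact h
  | S => exact absurd rfl hκ

lemma MonomialKind.Holds.map {κ : MonomialKind} {t : R} (h : κ.Holds t) (f : R →+* R') :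
    κ.Holds (f t) := by
  cases κ with
  | A ν => exact ⟨h.1, by rw [← map_pow, h.2, map_one]⟩
  | P => exact IsUnit.map f h
  | S => trivial

lemma MonomialKind.domain_of_ne {κ : MonomialKind} (hκ : κ ≠ .S) (z : ℤ) : z ∈ κ.domain := by
  cases κ with
  | A ν => trivial
  | P => trivial
  | S => exact absurd rfl hκ

lemma MonomialKind.exponents_subset_domain (κ : MonomialKind) : κ.exponents ⊆ κ.domain := by
  cases κ with
  | A ν => exact fun _ _ => trivial
  | P => exact fun _ _ => trivial
  | S => exact fun _ h => h

lemma MonomialKind.zero_mem_domain (κ : MonomialKind) : (0 : ℤ) ∈ κ.domain := by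
  cases κ with
  | A ν => trivial
  | P => trivial
  | S => exact le_refl (0 : ℤ)

lemma MonomialKind.add_mem_domain {κ : MonomialKind} {a b : ℤ} (ha : a ∈ κ.domain)
    (hb : b ∈ κ.domain) : a + b ∈ κ.domain := by
  cases κ with
  | A ν => trivial
  | P => trivial
  | S => exact add_nonneg (Set.mem_Ici.mp ha) (Set.mem_Ici.mp hb)

lemma MonomialKind.Holds.zero_mem_exponents {κ : MonomialKind} {t : R} (h : κ.Holds t) :
    (0 : ℤ) ∈ κ.exponents := by
  cases κ with
  | A ν => exact ⟨le_refl _, by have := h.1; omega⟩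
  | P => trivial
  | S => exact le_refl (0 : ℤ)

lemma MonomialKind.Holds.one_mem_exponents {κ : MonomialKind} {t : R} (h : κ.Holds t) :
    (1 : ℤ) ∈ κ.exponents := by
  cases κ with
  | A ν => exact ⟨zero_le_one, by have := h.1; omega⟩
  | P => trivial
  | S => exact zero_le_one (α := ℤ)

lemma MonomialKind.Holds.reduce_mem {κ : MonomialKind} {t : R} (h : κ.Holds t) {z : ℤ}
    (hz : z ∈ κ.domain) : κ.reduce z ∈ κ.exponents := by
  cases κ with
  | A ν =>
    have h1 : (0 : ℤ) < ν := by have := h.1; omega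
    exact ⟨Int.emod_nonneg _ h1.ne', Int.emod_lt_of_pos _ h1⟩
  | P => trivial
  | S => exact hz

lemma MonomialKind.reduce_zero (κ : MonomialKind) : κ.reduce 0 = 0 := by
  cases κ <;> simp [MonomialKind.reduce]

@[simp] lemma intPow_zero (t : R) : intPow t 0 = 1 := pow_zero t

@[simp] lemma intPow_one (t : R) : intPow t 1 = t := pow_one t

lemma intPow_natCast (t : R) (n : ℕ) : intPow t (n : ℤ) = t ^ n := rfl

lemma intPow_units (x : Rˣ) (z : ℤ) : intPow (x : R) z = ((x ^ z : Rˣ) : R) := by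
  cases z with
  | ofNat n => simp [intPow]
  | negSucc n => simp [intPow, zpow_negSucc, ← inv_pow]

lemma intPow_field {F : Type*} [Field F] (x : F) (z : ℤ) : intPow x z = x ^ z := by
  cases z with
  | ofNat n => simp [intPow]
  | negSucc n => simp [intPow, zpow_negSucc]

lemma intPow_add {κ : MonomialKind} {t : R} (h : κ.Holds t) {a b : ℤ} (ha : a ∈ κ.domain)
    (hb : b ∈ κ.domain) : intPow t (a + b) = intPow t a * intPow t b := by
  by_cases hκ : κ = .S
  · subst hκ
    obtain ⟨a, rfl⟩ := Int.eq_ofNat_of_zero_le ha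
    obtain ⟨b, rfl⟩ := Int.eq_ofNat_of_zero_le hb
    rw [← Nat.cast_add, intPow_natCast, intPow_natCast, intPow_natCast, pow_add]
  · obtain ⟨x, rfl⟩ := h.isUnit hκ
    simp only [intPow_units, zpow_add, Units.val_mul]

lemma intPow_reduce {κ : MonomialKind} {t : R} (h : κ.Holds t) (z : ℤ) :
    intPow t (κ.reduce z) = intPow t z := by
  cases κ with
  | A ν =>
    obtain ⟨x, rfl⟩ := h.isUnit (by simp)
    have hx : x ^ ν = 1 := Units.ext (by simpa using h.2)
    conv_rhs => rw [← Int.emod_add_mul_ediv z ν]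
    rw [MonomialKind.reduce, intPow_units, intPow_units, zpow_add, zpow_mul, zpow_natCast, hx,
      one_zpow, mul_one]
  | P => rfl
  | S => rfl

lemma map_intPow {κ : MonomialKind} {t : R} (h : κ.Holds t) (f : R →+* R') {z : ℤ}
    (hz : z ∈ κ.domain) : f (intPow t z) = intPow (f t) z := by
  by_cases hκ : κ = .S
  · subst hκ
    obtain ⟨a, rfl⟩ := Int.eq_ofNat_of_zero_le hz
    rw [intPow_natCast, intPow_natCast, map_pow]
  · obtain ⟨x, rfl⟩ := h.isUnit hκ
    rw [intPow_units]
    have : f (x : R) = (Units.map (f : R →* R') x : R') := rfl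
    rw [this, intPow_units, ← map_zpow]
    rfl

lemma intPow_mul_neg {t : R} (h : IsUnit t) (z : ℤ) : intPow t z * intPow t (-z) = 1 := by
  obtain ⟨x, rfl⟩ := h
  rw [intPow_units, intPow_units, ← Units.val_mul, ← zpow_add, add_neg_cancel, zpow_zero,
    Units.val_one]

lemma mul_intPow {a t : R} (ha : IsUnit a) (ht : IsUnit t) (z : ℤ) :
    intPow (a * t) z = intPow a z * intPow t z := by
  obtain ⟨x, rfl⟩ := ha
  obtain ⟨y, rfl⟩ := ht
  rw [← Units.val_mul, intPow_units, intPow_units, intPow_units, mul_zpow, Units.val_mul]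

variable {e : ℕ}

/-- The power product `t_1^{m_1} ⋯ t_e^{m_e}`. -/
def powProd (t : Fin e → R) (m : Fin e → ℤ) : R := ∏ j, intPow (t j) (m j)

@[simp] lemma powProd_zero (t : Fin e → R) : powProd t 0 = 1 := by simp [powProd]

lemma powProd_add {kind : Fin e → MonomialKind} {t : Fin e → R} (H : ∀ j, (kind j).Holds (t j))
    {m m' : Fin e → ℤ} (hm : ∀ j, m j ∈ (kind j).domain) (hm' : ∀ j, m' j ∈ (kind j).domain) :
    powProd t (m + m') = powProd t m * powProd t m' := by
  unfold powProd
  rw [← Finset.prod_mul_distrib]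
  exact Finset.prod_congr rfl fun j _ => intPow_add (H j) (hm j) (hm' j)

lemma powProd_reduce {kind : Fin e → MonomialKind} {t : Fin e → R}
    (H : ∀ j, (kind j).Holds (t j)) (m : Fin e → ℤ) :
    powProd t (fun j => (kind j).reduce (m j)) = powProd t m :=
  Finset.prod_congr rfl fun j _ => intPow_reduce (H j) (m j)

lemma map_powProd {kind : Fin e → MonomialKind} {t : Fin e → R} (H : ∀ j, (kind j).Holds (t j))
    (f : R →+* R') {m : Fin e → ℤ} (hm : ∀ j, m j ∈ (kind j).domain) :
    f (powProd t m) = powProd (fun j => f (t j)) m := by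
  unfold powProd
  rw [map_prod]
  exact Finset.prod_congr rfl fun j _ => map_intPow (H j) f (hm j)

lemma powProd_single (t : Fin e → R) (i : Fin e) (z : ℤ) :
    powProd t (Pi.single i z) = intPow (t i) z := by
  unfold powProd
  rw [Finset.prod_eq_single i]
  · simp
  · intro j _ hj
    simp [Pi.single_eq_of_ne hj]
  · simp

lemma powProd_eq_update (t : Fin e → R) (m : Fin e → ℤ) (i : Fin e) :
    powProd t m = powProd t (Function.update m i 0) * intPow (t i) (m i) := by
  unfold powProd
  rw [← Finset.mul_prod_erase _ _ (Finset.mem_univ i), ← Finset.mul_prod_erase _ _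
    (Finset.mem_univ i), Function.update_self, intPow_zero, one_mul, mul_comm]
  congr 1
  refine Finset.prod_congr rfl fun j hj => ?_
  rw [Function.update_of_ne (Finset.ne_of_mem_erase hj)]

end IntPow

/-! ## Stages of a tower and the basis of power products -/

section Stage

variable {G : Type*} [Field G] {R : Type*} [CommRing R] [Algebra G R] {e : ℕ}

variable (G) in
/-- The subalgebra generated by the first `i` monomials. -/
def stageOf (kind : Fin e → MonomialKind) (t : Fin e → R) (i : ℕ) : Subalgebra G R :=
  Algebra.adjoin G {y | ∃ j : Fin e, (j : ℕ) < i ∧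
    (y = t j ∨ (kind j = .P ∧ y = Ring.inverse (t j)))}

/-- Exponent vectors of power products in the first `i` monomials. -/
def IsExponent (kind : Fin e → MonomialKind) (i : ℕ) (m : Fin e → ℤ) : Prop :=
  ∀ j, m j ∈ (kind j).exponents ∧ (m j ≠ 0 → (j : ℕ) < i)

variable {kind : Fin e → MonomialKind} {t : Fin e → R}

lemma IsExponent.domain {i : ℕ} {m : Fin e → ℤ} (h : IsExponent kind i m) (j : Fin e) :
    m j ∈ (kind j).domain := (kind j).exponents_subset_domain (h j).1

lemma stageOf_mono {i i' : ℕ} (h : i ≤ i') : stageOf G kind t i ≤ stageOf G kind t i' :=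
  Algebra.adjoin_mono fun _ ⟨j, hj, hy⟩ => ⟨j, lt_of_lt_of_le hj h, hy⟩

lemma mem_stageOf {i : ℕ} {j : Fin e} (h : (j : ℕ) < i) : t j ∈ stageOf G kind t i :=
  Algebra.subset_adjoin ⟨j, h, Or.inl rfl⟩

lemma intPow_mem_stageOf (H : ∀ j, (kind j).Holds (t j)) {i : ℕ} {j : Fin e} (h : (j : ℕ) < i)
    {z : ℤ} (hz : z ∈ (kind j).domain) : intPow (t j) z ∈ stageOf G kind t i := by
  rw [← intPow_reduce (H j)]
  have hz' := (H j).reduce_mem hz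
  generalize (kind j).reduce z = w at hz'
  cases w with
  | ofNat n => exact pow_mem (mem_stageOf h) n
  | negSucc n =>
    have hk : kind j = .P := by
      cases hk : kind j with
      | A ν => rw [hk] at hz'; exact absurd hz'.1 (by simp)
      | P => rfl
      | S => rw [hk] at hz'; exact absurd (Set.mem_Ici.mp hz') (by simp)
    exact pow_mem (Algebra.subset_adjoin ⟨j, h, Or.inr ⟨hk, rfl⟩⟩ :
      Ring.inverse (t j) ∈ stageOf G kind t i) (n + 1)

lemma powProd_mem_stageOf (H : ∀ j, (kind j).Holds (t j)) {i : ℕ} {m : Fin e → ℤ}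
    (hm : ∀ j, m j ∈ (kind j).domain) (hi : ∀ j, m j ≠ 0 → (j : ℕ) < i) :
    powProd t m ∈ stageOf G kind t i := by
  refine Subalgebra.prod_mem _ fun j _ => ?_
  by_cases h : m j = 0
  · rw [h, intPow_zero]; exact one_mem _
  · exact intPow_mem_stageOf H (hi j h) (hm j)

/-- Adding exponents may leave the admissible range of an `A`-monomial; reduction modulo its order
brings them back without changing the product. -/
lemma powProd_mul_mem_span (H : ∀ j, (kind j).Holds (t j)) {i : ℕ} {m m' : Fin e → ℤ}
    (hm : ∀ j, m j ∈ (kind j).domain) (hi : ∀ j, m j ≠ 0 → (j : ℕ) < i)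
    (hm' : ∀ j, m' j ∈ (kind j).domain) (hi' : ∀ j, m' j ≠ 0 → (j : ℕ) < i) :
    powProd t m * powProd t m' ∈ Submodule.span G (powProd t '' {m | IsExponent kind i m}) := by
  rw [← powProd_add H hm hm', ← powProd_reduce H]
  refine Submodule.subset_span ⟨_, fun j => ⟨(H j).reduce_mem
    (MonomialKind.add_mem_domain (hm j) (hm' j)), fun h => ?_⟩, rfl⟩
  by_contra hj
  apply h
  have h1 : m j = 0 := by by_contra h1; exact hj (hi j h1)
  have h2 : m' j = 0 := by by_contra h2; exact hj (hi' j h2)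
  simp [h1, h2, MonomialKind.reduce_zero]

/-- The generators are power products, the inverse of a `P`-monomial having exponent `-1`, and the
span is closed under multiplication by `powProd_mul_mem_span`. -/
lemma mem_span_of_mem_stageOf (H : ∀ j, (kind j).Holds (t j)) {i : ℕ} {f : R}
    (hf : f ∈ stageOf G kind t i) :
    f ∈ Submodule.span G (powProd t '' {m | IsExponent kind i m}) := by
  have h0 : powProd t 0 ∈ powProd t '' {m | IsExponent kind i m} :=
    ⟨0, fun j => ⟨(H j).zero_mem_exponents, fun h => absurd rfl h⟩, rfl⟩
  have hgen : ∀ (j : Fin e) (z : ℤ), (j : ℕ) < i → z ∈ (kind j).domain →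
      intPow (t j) z ∈ Submodule.span G (powProd t '' {m | IsExponent kind i m}) := by
    intro j z hj hz
    have := powProd_mul_mem_span (G := G) (i := i) H (m := Pi.single j z) (m' := 0)
      (fun k => by
        by_cases hk : k = j
        · subst hk; rwa [Pi.single_eq_same]
        · rw [Pi.single_eq_of_ne hk]; exact MonomialKind.zero_mem_domain _)
      (fun k hk => by
        by_cases hk' : k = j
        · subst hk'; exact hj
        · rw [Pi.single_eq_of_ne hk'] at hk; exact absurd rfl hk)
      (fun k => MonomialKind.zero_mem_domain _) (fun k hk => absurd rfl hk)
    rwa [powProd_single, powProd_zero, mul_one] at this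
  induction hf using Algebra.adjoin_induction with
  | mem x hx =>
    obtain ⟨j, hj, rfl | ⟨hk, rfl⟩⟩ := hx
    · simpa using hgen j 1 hj ((kind j).exponents_subset_domain (H j).one_mem_exponents)
    · have h := hgen j (-1) hj (MonomialKind.domain_of_ne (by simp [hk]) _)
      rwa [show intPow (t j) (-1) = Ring.inverse (t j) from pow_one _] at h
  | algebraMap r =>
    rw [Algebra.algebraMap_eq_smul_one, ← powProd_zero t]
    exact Submodule.smul_mem _ _ (Submodule.subset_span h0)
  | add x y _ _ hx hy => exact add_mem hx hy
  | mul x y hx' hy' hx hy =>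
    clear hx' hy'
    induction hx using Submodule.span_induction with
    | mem x hx =>
      induction hy using Submodule.span_induction with
      | mem y hy =>
        obtain ⟨m, hm, rfl⟩ := hx
        obtain ⟨m', hm', rfl⟩ := hy
        exact powProd_mul_mem_span H hm.domain (fun j => (hm j).2) hm'.domain (fun j => (hm' j).2)
      | zero => rw [mul_zero]; exact zero_mem _
      | add y y' _ _ h h' => rw [mul_add]; exact add_mem h h'
      | smul a y _ h => rw [mul_smul_comm]; exact Submodule.smul_mem _ _ h
    | zero => rw [zero_mul]; exact zero_mem _
    | add y y' _ _ h h' => rw [add_mul]; exact add_mem h h'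
    | smul a y _ h => rw [smul_mul_assoc]; exact Submodule.smul_mem _ _ h

lemma exists_sum_of_mem_stageOf (H : ∀ j, (kind j).Holds (t j)) {i : ℕ} {f : R}
    (hf : f ∈ stageOf G kind t i) : ∃ g : (Fin e → ℤ) →₀ G,
      (∀ m ∈ g.support, IsExponent kind i m) ∧ f = ∑ m ∈ g.support, g m • powProd t m := by
  obtain ⟨g, hg, rfl⟩ := (Finsupp.mem_span_image_iff_linearCombination G).mp
    (mem_span_of_mem_stageOf H hf)
  exact ⟨g, fun m hm => (Finsupp.mem_supported _ _).mp hg hm, Finsupp.linearCombination_apply _ _⟩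

lemma sum_powProd_mem_stageOf (H : ∀ j, (kind j).Holds (t j)) {ι : Type} {i : ℕ} {s : Finset ι}
    {m : ι → Fin e → ℤ} {g : ι → G} (hm : ∀ a ∈ s, IsExponent kind i (m a)) :
    ∑ a ∈ s, g a • powProd t (m a) ∈ stageOf G kind t i :=
  sum_mem fun a ha => Subalgebra.smul_mem _
    (powProd_mem_stageOf H (hm a ha).domain fun j => (hm a ha j).2) _

/-- Collecting a sum of power products by the exponent of `t_i`. -/
lemma sum_powProd_eq_fiberwise {ι : Type} (s : Finset ι) (m : ι → Fin e → ℤ) (g : ι → G)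
    (i : Fin e) :
    ∑ a ∈ s, g a • powProd t (m a) = ∑ k ∈ s.image fun a => m a i,
      (∑ a ∈ s with m a i = k, g a • powProd t (Function.update (m a) i 0)) * intPow (t i) k := by
  rw [← Finset.sum_fiberwise_of_maps_to (fun a ha => Finset.mem_image_of_mem (fun a => m a i) ha)]
  refine Finset.sum_congr rfl fun k _ => ?_
  rw [Finset.sum_mul]
  refine Finset.sum_congr rfl fun a ha => ?_
  rw [powProd_eq_update t (m a) i, (Finset.mem_filter.mp ha).2, smul_mul_assoc]

lemma IsExponent.update_zero (H : ∀ j, (kind j).Holds (t j)) {i : Fin e} {m : Fin e → ℤ}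
    (h : IsExponent kind (i + 1) m) : IsExponent kind i (Function.update m i 0) := by
  intro j
  by_cases hj : j = i
  · subst hj
    rw [Function.update_self]
    exact ⟨(H j).zero_mem_exponents, fun h => absurd rfl h⟩
  · rw [Function.update_of_ne hj]
    refine ⟨(h j).1, fun h0 => ?_⟩
    have := (h j).2 h0
    have : (j : ℕ) ≠ i := fun h => hj (Fin.ext h)
    omega

lemma IsExponent.update {i : Fin e} {m : Fin e → ℤ} {k : ℤ} (hk : k ∈ (kind i).exponents)
    (h : IsExponent kind i m) : IsExponent kind (i + 1) (Function.update m i k) := by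
  intro j
  by_cases hj : j = i
  · subst hj
    rw [Function.update_self]
    exact ⟨hk, fun _ => Nat.lt_succ_self _⟩
  · rw [Function.update_of_ne hj]
    exact ⟨(h j).1, fun h0 => Nat.lt_succ_of_lt ((h j).2 h0)⟩

lemma IsExponent.apply_self {i : Fin e} {m : Fin e → ℤ} (h : IsExponent kind i m) : m i = 0 := by
  by_contra h0
  exact lt_irrefl _ ((h i).2 h0)

lemma injOn_update_zero {ι : Type} {s : Finset ι} {m : ι → Fin e → ℤ} (hinj : Set.InjOn m s)
    (i : Fin e) (k : ℤ) :
    Set.InjOn (fun a => Function.update (m a) i 0) ↑(s.filter fun a => m a i = k) := by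
  intro a ha b hb hab
  simp only [Finset.coe_filter, Set.mem_ofPred_eq] at ha hb
  refine hinj ha.1 hb.1 ?_
  funext j
  by_cases hj : j = i
  · subst hj; rw [ha.2, hb.2]
  · simpa [Function.update_of_ne hj] using congrFun hab j

/-- Trades families on the subtypes of exponents and stage elements for sums over finite sets of
integers with side conditions, in which exponents can be regrouped freely. -/
lemma linearIndependent_stage_iff (i : Fin e) :
    LinearIndependent (stageOf G kind t i) (fun k : (kind i).exponents => intPow (t i) k) ↔
    ∀ (S : Finset ℤ) (c : ℤ → R), (∀ k ∈ S, k ∈ (kind i).exponents) →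
      (∀ k ∈ S, c k ∈ stageOf G kind t i) → ∑ k ∈ S, c k * intPow (t i) k = 0 →
      ∀ k ∈ S, c k = 0 := by
  classical
  rw [linearIndependent_iff']
  constructor
  · intro h S c hS hc h0 k hk
    let c' : (kind i).exponents → stageOf G kind t i :=
      fun k => if hk : (k : ℤ) ∈ S then ⟨c k, hc k hk⟩ else 0
    have := h (S.subtype (· ∈ (kind i).exponents)) c' (by
      rw [← h0, ← Finset.sum_subtype_of_mem (fun k => c k * intPow (t i) k) hS]
      refine Finset.sum_congr rfl fun k hk => ?_
      rw [Finset.mem_subtype] at hk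
      simp only [c', dif_pos hk]
      rfl) ⟨k, hS k hk⟩ (by simpa using hk)
    simp only [c', dif_pos hk] at this
    exact congrArg Subtype.val this
  · intro h s c h0 k hk
    let c' : ℤ → R := fun k => if hk : k ∈ (kind i).exponents then c ⟨k, hk⟩ else 0
    have := h (s.map (Function.Embedding.subtype _)) c' (by
        intro k hk
        obtain ⟨k', _, rfl⟩ := Finset.mem_map.mp hk
        exact k'.2)
      (by
        intro k hk
        obtain ⟨k', _, rfl⟩ := Finset.mem_map.mp hk
        simp only [c', Function.Embedding.subtype_apply, Subtype.coe_prop, dite_true]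
        exact (c k').2)
      (by
        rw [← h0, Finset.sum_map]
        refine Finset.sum_congr rfl fun k _ => ?_
        simp only [c', Function.Embedding.subtype_apply, Subtype.coe_prop, dite_true]
        rfl) k (Finset.mem_map_of_mem _ hk)
    simp only [c', Subtype.coe_prop, dite_true] at this
    exact Subtype.ext this

/-- Power products with different exponents are linearly independent over the ground field. -/
def PowProdIndependent (G : Type*) [Field G] {R : Type*} [CommRing R] [Algebra G R]
    (kind : Fin e → MonomialKind) (t : Fin e → R) (i : ℕ) : Prop :=
  ∀ ⦃ι : Type⦄ (s : Finset ι) (m : ι → Fin e → ℤ) (g : ι → G),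
    (∀ a ∈ s, IsExponent kind i (m a)) → Set.InjOn m s →
    ∑ a ∈ s, g a • powProd t (m a) = 0 → ∀ a ∈ s, g a = 0

/-- Induction along the tower: when a relation is collected by the exponent of the last monomial,
freeness kills every coefficient, and each coefficient is a relation at the preceding stage. -/
lemma powProdIndependent_of_free [Nontrivial R] (H : ∀ j, (kind j).Holds (t j))
    (hfree : ∀ i : Fin e,
      LinearIndependent (stageOf G kind t i) (fun k : (kind i).exponents => intPow (t i) k)) :
    ∀ i ≤ e, PowProdIndependent G kind t i := by
  intro i
  induction i with
  | zero =>
    intro _ ι s m g hm hinj h0 a ha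
    -- At the bottom only the exponent vector `0` is available, so `s` has a single element.
    have hz : ∀ b ∈ s, m b = 0 := fun b hb => by
      funext j
      by_contra h
      exact absurd ((hm b hb j).2 h) (by simp)
    have hs : s = {a} := by
      ext b
      rw [Finset.mem_singleton]
      refine ⟨fun hb => hinj hb ha (by rw [hz b hb, hz a ha]), ?_⟩
      rintro rfl; exact ha
    rw [hs, Finset.sum_singleton, hz a ha, powProd_zero, ← Algebra.algebraMap_eq_smul_one] at h0
    exact (FaithfulSMul.algebraMap_eq_zero_iff G R).mp h0
  | succ n ih =>
    intro hn ι s m g hm hinj h0 a ha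
    let i : Fin e := ⟨n, hn⟩
    rw [sum_powProd_eq_fiberwise s m g i] at h0
    have hm' : ∀ k, ∀ b ∈ s.filter fun b => m b i = k,
        IsExponent kind n (Function.update (m b) i 0) := fun k b hb =>
      IsExponent.update_zero (i := i) H (hm b (Finset.mem_filter.mp hb).1)
    have h1 := (linearIndependent_stage_iff i).mp (hfree i) _ _ (by
        intro k hk
        obtain ⟨b, hb, rfl⟩ := Finset.mem_image.mp hk
        exact (hm b hb i).1)
      (fun k _ => sum_powProd_mem_stageOf H (hm' k)) h0 (m a i) (Finset.mem_image_of_mem _ ha)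
    exact ih (Nat.le_of_succ_le hn) _ _ _ (hm' _) (injOn_update_zero hinj i _) h1 a
      (Finset.mem_filter.mpr ⟨ha, rfl⟩)

/-- Exponent vectors of the terms of `∑ k, c_k t_i ^ k`, where the exponents of `c_k` are given. -/
lemma sigma_isExponent {i : Fin e} {S : Finset ℤ} {g : ℤ → (Fin e → ℤ) →₀ G}
    (hS : ∀ k ∈ S, k ∈ (kind i).exponents)
    (hg : ∀ k ∈ S, ∀ m ∈ (g k).support, IsExponent kind i m) :
    ∀ a ∈ S.sigma fun k => (g k).support, IsExponent kind (i + 1) (Function.update a.2 i a.1) := by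
  intro a ha
  obtain ⟨h1, h2⟩ := Finset.mem_sigma.mp ha
  exact (hg _ h1 _ h2).update (hS _ h1)

lemma sigma_injOn {i : Fin e} {S : Finset ℤ} {g : ℤ → (Fin e → ℤ) →₀ G}
    (hg : ∀ k ∈ S, ∀ m ∈ (g k).support, IsExponent kind i m) :
    Set.InjOn (fun a : Σ _ : ℤ, Fin e → ℤ => Function.update a.2 i a.1)
      ↑(S.sigma fun k => (g k).support) := by
  rintro ⟨k, m⟩ ha ⟨k', m'⟩ hb hab
  obtain ⟨h1, h2⟩ := Finset.mem_sigma.mp (Finset.mem_coe.mp ha)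
  obtain ⟨h3, h4⟩ := Finset.mem_sigma.mp (Finset.mem_coe.mp hb)
  have e1 : k = k' := by simpa using congrFun hab i
  have h2' : m i = 0 := (hg k h1 m h2).apply_self
  have h4' : m' i = 0 := (hg k' h3 m' h4).apply_self
  have e2 : m = m' := by
    funext j
    by_cases hj : j = i
    · rw [hj, h2', h4']
    · simpa [Function.update_of_ne hj] using congrFun hab j
  rw [e1, e2]

lemma sum_sigma_powProd {i : Fin e} {S : Finset ℤ} {g : ℤ → (Fin e → ℤ) →₀ G}
    (hg : ∀ k ∈ S, ∀ m ∈ (g k).support, IsExponent kind i m) :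
    ∑ k ∈ S, (∑ m ∈ (g k).support, g k m • powProd t m) * intPow (t i) k =
      ∑ a ∈ S.sigma fun k => (g k).support,
        g a.1 a.2 • powProd t (Function.update a.2 i a.1) := by
  rw [Finset.sum_sigma]
  refine Finset.sum_congr rfl fun k hk => ?_
  rw [Finset.sum_mul]
  refine Finset.sum_congr rfl fun m hm => ?_
  rw [powProd_eq_update t (Function.update m i k) i, Function.update_self, Function.update_idem,
    smul_mul_assoc, ← (hg k hk m hm).apply_self, Function.update_eq_self]

/-- Converse of `powProdIndependent_of_free`: expanding the coefficients turns a relation between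
powers of `t_i` into one between power products with pairwise different exponents. -/
lemma free_of_powProdIndependent (H : ∀ j, (kind j).Holds (t j))
    (hind : PowProdIndependent G kind t e) (i : Fin e) :
    LinearIndependent (stageOf G kind t i) (fun k : (kind i).exponents => intPow (t i) k) := by
  classical
  rw [linearIndependent_stage_iff]
  intro S c hS hc h0 k hk
  choose! g hg hcg using fun k hk => exists_sum_of_mem_stageOf H (hc k hk)
  have h1 := hind (S.sigma fun k => (g k).support) (fun a => Function.update a.2 i a.1)
    (fun a => g a.1 a.2) (fun a ha j => ⟨(sigma_isExponent hS hg a ha j).1, fun _ => j.2⟩)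
    (sigma_injOn hg) (by
      rw [← h0, ← sum_sigma_powProd hg]
      refine Finset.sum_congr rfl fun k hk => ?_
      conv_rhs => rw [hcg k hk])
  rw [hcg k hk]
  refine Finset.sum_eq_zero fun m hm => ?_
  rw [h1 ⟨k, m⟩ (Finset.mem_sigma.mpr ⟨hk, hm⟩), zero_smul]

end Stage

/-! ## Exponent vectors of lists of powers -/

section ExponentLists

variable {e : ℕ}

/-- The exponent vector of a list of powers. -/
def exponentOf : List (Fin e × ℤ) → Fin e → ℤ
  | [] => 0
  | p :: l => Pi.single p.1 p.2 + exponentOf l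

lemma exponentOf_eq_zero {l : List (Fin e × ℤ)} {j : Fin e} (h : j ∉ l.map Prod.fst) :
    exponentOf l j = 0 := by
  induction l with
  | nil => rfl
  | cons p l ih =>
    simp only [List.map_cons, List.mem_cons, not_or] at h
    rw [exponentOf, Pi.add_apply, ih h.2, Pi.single_eq_of_ne h.1, add_zero]

lemma exponentOf_eq_of_mem {l : List (Fin e × ℤ)} (hl : (l.map Prod.fst).Nodup) {p : Fin e × ℤ}
    (hp : p ∈ l) : exponentOf l p.1 = p.2 := by
  induction l with
  | nil => simp at hp
  | cons p' l ih =>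
    rw [List.map_cons, List.nodup_cons] at hl
    rw [exponentOf, Pi.add_apply]
    rcases List.mem_cons.mp hp with rfl | hp
    · rw [exponentOf_eq_zero hl.1, Pi.single_eq_same, add_zero]
    · have : p.1 ≠ p'.1 := fun h => hl.1 (h ▸ List.mem_map_of_mem hp)
      rw [ih hl.2 hp, Pi.single_eq_of_ne this, zero_add]

lemma exists_mem_of_exponentOf_ne_zero {l : List (Fin e × ℤ)} (hl : (l.map Prod.fst).Nodup)
    {j : Fin e} (h : exponentOf l j ≠ 0) : (j, exponentOf l j) ∈ l := by
  by_contra hj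
  apply h
  apply exponentOf_eq_zero
  intro hm
  obtain ⟨p, hp, rfl⟩ := List.mem_map.mp hm
  exact hj (by rw [exponentOf_eq_of_mem hl hp]; exact hp)

/-- The list of the powers with nonzero exponent. -/
def powerList (m : Fin e → ℤ) : List (Fin e × ℤ) :=
  ((List.finRange e).filter fun j => m j ≠ 0).map fun j => (j, m j)

lemma powerList_nodup (m : Fin e → ℤ) : ((powerList m).map Prod.fst).Nodup := by
  rw [powerList, List.map_map]
  have : (Prod.fst ∘ fun j : Fin e => (j, m j)) = id := rfl
  rw [this, List.map_id]
  exact (List.nodup_finRange e).filter _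

lemma mem_powerList {m : Fin e → ℤ} {p : Fin e × ℤ} :
    p ∈ powerList m ↔ m p.1 = p.2 ∧ p.2 ≠ 0 := by
  obtain ⟨j, z⟩ := p
  simp only [powerList, List.mem_map, List.mem_filter, List.mem_finRange, true_and,
    decide_eq_true_eq, Prod.mk.injEq]
  constructor
  · rintro ⟨j', h, rfl, rfl⟩; exact ⟨rfl, h⟩
  · rintro ⟨rfl, h⟩; exact ⟨j, h, rfl, rfl⟩

lemma exponentOf_powerList (m : Fin e → ℤ) : exponentOf (powerList m) = m := by
  funext j
  by_cases h : m j = 0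
  · rw [h]
    apply exponentOf_eq_zero
    intro hj
    obtain ⟨p, hp, rfl⟩ := List.mem_map.mp hj
    have := mem_powerList.mp hp
    exact this.2 (this.1 ▸ h)
  · exact exponentOf_eq_of_mem (powerList_nodup m) (p := (j, m j)) (mem_powerList.mpr ⟨rfl, h⟩)

/-- Pairwise different bases and nonzero exponents make a list recoverable, up to order, from its
exponent vector; `powerList` serves as normal form. -/
lemma perm_powerList {l : List (Fin e × ℤ)} (hl : (l.map Prod.fst).Nodup)
    (h0 : ∀ p ∈ l, p.2 ≠ 0) : l.Perm (powerList (exponentOf l)) := by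
  rw [List.perm_ext_iff_of_nodup (List.Nodup.of_map _ hl)
    (List.Nodup.of_map _ (powerList_nodup _))]
  intro p
  rw [mem_powerList]
  constructor
  · exact fun hp => ⟨exponentOf_eq_of_mem hl hp, h0 p hp⟩
  · rintro ⟨h1, h2⟩
    have := exists_mem_of_exponentOf_ne_zero hl (j := p.1) (by rwa [h1])
    rwa [h1] at this

lemma prod_map_intPow {R : Type*} [CommRing R] {kind : Fin e → MonomialKind} {t : Fin e → R}
    (H : ∀ j, (kind j).Holds (t j)) {l : List (Fin e × ℤ)}
    (hl : ∀ p ∈ l, p.2 ∈ (kind p.1).exponents) :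
    (l.map fun p => intPow (t p.1) p.2).prod = powProd t (exponentOf l) ∧
      ∀ j, exponentOf l j ∈ (kind j).domain := by
  induction l with
  | nil => exact ⟨by simp [exponentOf], fun j => MonomialKind.zero_mem_domain _⟩
  | cons p l ih =>
    obtain ⟨h1, h2⟩ := ih fun q hq => hl q (List.mem_cons_of_mem _ hq)
    have h3 : ∀ j, (Pi.single p.1 p.2 : Fin e → ℤ) j ∈ (kind j).domain := fun j => by
      by_cases hj : j = p.1
      · subst hj
        rw [Pi.single_eq_same]
        exact MonomialKind.exponents_subset_domain _ (hl p List.mem_cons_self)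
      · rw [Pi.single_eq_of_ne hj]; exact MonomialKind.zero_mem_domain _
    refine ⟨?_, fun j => MonomialKind.add_mem_domain (h3 j) (h2 j)⟩
    rw [List.map_cons, List.prod_cons, h1, exponentOf, powProd_add H h3 h2, powProd_single]

/-- The powers which are admissible in the given kinds of monomials. -/
def KindAdmissible (kind : Fin e → MonomialKind) (j : Fin e) (z : ℤ) : Prop :=
  z ≠ 0 ∧ z ∈ (kind j).exponents

/-- Replacing indices by symbols in a list of monomials. -/
def mapMonomials {G ι κ : Type*} (T : ι → κ) (Y : MonomialList ι G) : MonomialList κ G :=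
  Y.map fun s => (s.1, s.2.map fun p => (T p.1, p.2))

lemma exists_eq_mapMonomials {G ι κ : Type*} {T : ι → κ} {X : MonomialList κ G}
    (hX : ∀ t ∈ X, ∀ p ∈ t.2, p.1 ∈ Set.range T) : ∃ Y, X = mapMonomials T Y := by
  have h1 : ∀ l : List (κ × ℤ), (∀ p ∈ l, p.1 ∈ Set.range T) →
      ∃ l' : List (ι × ℤ), l = l'.map fun p => (T p.1, p.2) := by
    intro l
    induction l with
    | nil => exact fun _ => ⟨[], rfl⟩
    | cons p l ih =>
      intro h
      obtain ⟨j, hj⟩ := h p List.mem_cons_self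
      obtain ⟨l', hl'⟩ := ih fun q hq => h q (List.mem_cons_of_mem _ hq)
      exact ⟨(j, p.2) :: l', by rw [List.map_cons, ← hl', hj]⟩
  induction X with
  | nil => exact ⟨[], rfl⟩
  | cons t X ih =>
    obtain ⟨Y, hY⟩ := ih fun t ht => hX t (List.mem_cons_of_mem _ ht)
    obtain ⟨l', hl'⟩ := h1 t.2 (hX t List.mem_cons_self)
    exact ⟨(t.1, l') :: Y, by rw [hY]; simp only [mapMonomials, List.map_cons, ← hl']⟩

variable {G : Type*} [Zero G] {kind : Fin e → MonomialKind}

lemma IsReducedList.isExponent {Y : MonomialList (Fin e) G}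
    (hY : IsReducedList (KindAdmissible kind) Y)
    (h0 : ∀ j, (0 : ℤ) ∈ (kind j).exponents) {s : G × List (Fin e × ℤ)} (hs : s ∈ Y) {i : ℕ}
    (hi : ∀ p ∈ s.2, (p.1 : ℕ) < i) : IsExponent kind i (exponentOf s.2) := by
  intro j
  by_cases h : exponentOf s.2 j = 0
  · rw [h]; exact ⟨h0 j, fun h => absurd rfl h⟩
  · have := exists_mem_of_exponentOf_ne_zero (hY.nodup s hs) h
    exact ⟨(hY.admissible s hs _ this).2, fun _ => hi _ this⟩

/-- Monomials with the same exponent vector would have the same normal form, hence be permutations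
of each other, which `distinct` excludes. -/
lemma IsReducedList.pairwise_exponentOf {Y : MonomialList (Fin e) G}
    (hY : IsReducedList (KindAdmissible kind) Y) :
    (Y.map fun s => exponentOf s.2).Nodup := by
  rw [List.nodup_iff_pairwise_ne, List.pairwise_map]
  refine hY.distinct.imp_of_mem fun {s s'} hs hs' h h' => h ?_
  have h1 := perm_powerList (hY.nodup s hs) fun p hp => (hY.admissible s hs p hp).1
  have h2 := perm_powerList (hY.nodup s' hs') fun p hp => (hY.admissible s' hs' p hp).1
  rw [h'] at h1
  exact h1.trans h2.symm

/-- A list of monomials with prescribed coefficients. -/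
def monomialList (g : (Fin e → ℤ) →₀ G) : MonomialList (Fin e) G :=
  g.support.toList.map fun m => (g m, powerList m)

lemma isReducedList_monomialList {g : (Fin e → ℤ) →₀ G}
    (hg : ∀ m ∈ g.support, IsExponent kind e m) :
    IsReducedList (KindAdmissible kind) (monomialList g) where
  coeff_ne_zero s hs := by
    obtain ⟨m, hm, rfl⟩ := List.mem_map.mp hs
    exact Finsupp.mem_support_iff.mp (Finset.mem_toList.mp hm)
  admissible s hs p hp := by
    obtain ⟨m, hm, rfl⟩ := List.mem_map.mp hs
    obtain ⟨h1, h2⟩ := mem_powerList.mp hp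
    exact ⟨h2, h1 ▸ (hg m (Finset.mem_toList.mp hm) p.1).1⟩
  nodup s hs := by
    obtain ⟨m, hm, rfl⟩ := List.mem_map.mp hs
    exact powerList_nodup m
  distinct := by
    rw [monomialList, List.pairwise_map]
    refine (List.nodup_iff_pairwise_ne.mp g.support.nodup_toList).imp fun {m m'} hne hp => hne ?_
    rw [← exponentOf_powerList m, ← exponentOf_powerList m']
    funext j
    by_cases h : exponentOf (powerList m) j = 0
    · rw [h, eq_comm]
      apply exponentOf_eq_zero
      intro hj
      rw [← (hp.map Prod.fst).mem_iff] at hj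
      obtain ⟨p, hp', rfl⟩ := List.mem_map.mp hj
      rw [exponentOf_eq_of_mem (powerList_nodup m) hp'] at h
      exact (mem_powerList.mp hp').2 h
    · have := exists_mem_of_exponentOf_ne_zero (powerList_nodup m) h
      exact (exponentOf_eq_of_mem (powerList_nodup m') (hp.mem_iff.mp this)).symm

/-- Injectivity of `T` keeps the bases pairwise different and prevents power products from merging
under the substitution. -/
lemma isReducedList_mapMonomials {ι κ : Type*} {T : ι → κ} (hT : Function.Injective T)
    {ok : κ → ℤ → Prop} {ok' : ι → ℤ → Prop} (hok : ∀ j z, ok' j z ↔ ok (T j) z)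
    {Y : MonomialList ι G} : IsReducedList ok (mapMonomials T Y) ↔ IsReducedList ok' Y := by
  have hinj : Function.Injective fun p : ι × ℤ => (T p.1, p.2) := fun p q h => by
    obtain ⟨h1, h2⟩ := Prod.mk.inj h
    exact Prod.ext (hT h1) h2
  have hfst : ∀ l : List (ι × ℤ),
      (l.map fun p : ι × ℤ => (T p.1, p.2)).map Prod.fst = (l.map Prod.fst).map T := by
    intro l; simp
  constructor
  · intro h
    refine ⟨fun s hs => h.coeff_ne_zero _ (List.mem_map_of_mem hs), fun s hs p hp =>
      (hok _ _).mpr (h.admissible _ (List.mem_map_of_mem hs) _ (List.mem_map_of_mem hp)),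
      fun s hs => ?_, ?_⟩
    · have := h.nodup _ (List.mem_map_of_mem hs)
      rw [hfst] at this
      exact List.Nodup.of_map _ this
    · have := h.distinct
      rw [mapMonomials, List.pairwise_map] at this
      exact this.imp fun h1 h2 => h1 (h2.map _)
  · intro h
    refine ⟨fun s hs => ?_, fun s hs p hp => ?_, fun s hs => ?_, ?_⟩
    · obtain ⟨s, hs', rfl⟩ := List.mem_map.mp hs
      exact h.coeff_ne_zero s hs'
    · obtain ⟨s, hs', rfl⟩ := List.mem_map.mp hs
      obtain ⟨p, hp', rfl⟩ := List.mem_map.mp hp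
      exact (hok _ _).mp (h.admissible s hs' p hp')
    · obtain ⟨s, hs', rfl⟩ := List.mem_map.mp hs
      rw [hfst]
      exact (h.nodup s hs').map hT
    · rw [mapMonomials, List.pairwise_map]
      exact h.distinct.imp fun h1 h2 => h1 ((List.map_perm_map_iff hinj).mp h2)

end ExponentLists

/-! ## Permutations of operands -/

section OperandPerm

variable {K G : Type u}

lemma Term.OperandPerm.foldl_add_init {a b : Term K G} (h : a.OperandPerm b) (l : List (Term K G)) :
    (l.foldl .add a).OperandPerm (l.foldl .add b) := by
  induction l generalizing a b with
  | nil => exact h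
  | cons x l ih => exact ih (.add_congr _ _ _ _ h (.refl _))

lemma Term.OperandPerm.foldl_mul_init {a b : Term K G} (h : a.OperandPerm b) (l : List (Term K G)) :
    (l.foldl .mul a).OperandPerm (l.foldl .mul b) := by
  induction l generalizing a b with
  | nil => exact h
  | cons x l ih => exact ih (.mul_congr _ _ _ _ h (.refl _))

lemma Term.OperandPerm.foldl_add_perm {l l' : List (Term K G)} (h : l.Perm l') (a : Term K G) :
    (l.foldl .add a).OperandPerm (l'.foldl .add a) := by
  induction h generalizing a with
  | nil => exact .refl _
  | cons x _ ih => exact ih _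
  | swap x y l =>
    exact foldl_add_init (.trans _ _ _ (.add_assoc _ _ _) (.trans _ _ _
      (.add_congr _ _ _ _ (.refl _) (.add_comm _ _)) (.symm _ _ (.add_assoc _ _ _)))) l
  | trans _ _ h1 h2 => exact .trans _ _ _ (h1 a) (h2 a)

lemma Term.OperandPerm.foldl_mul_perm {l l' : List (Term K G)} (h : l.Perm l') (a : Term K G) :
    (l.foldl .mul a).OperandPerm (l'.foldl .mul a) := by
  induction h generalizing a with
  | nil => exact .refl _
  | cons x _ ih => exact ih _
  | swap x y l =>
    exact foldl_mul_init (.trans _ _ _ (.mul_assoc _ _ _) (.trans _ _ _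
      (.mul_congr _ _ _ _ (.refl _) (.mul_comm _ _)) (.symm _ _ (.mul_assoc _ _ _)))) l
  | trans _ _ h1 h2 => exact .trans _ _ _ (h1 a) (h2 a)

lemma Term.OperandPerm.addList_perm [Zero G] {l l' : List (Term K G)} (h : l.Perm l') :
    (Term.addList l).OperandPerm (Term.addList l') := by
  induction h with
  | nil => exact .refl _
  | cons x h _ => exact foldl_add_perm h x
  | swap x y l => exact foldl_add_init (.add_comm _ _) l
  | trans _ _ h1 h2 => exact .trans _ _ _ h1 h2

lemma Term.OperandPerm.mulList_perm [One G] {l l' : List (Term K G)} (h : l.Perm l') :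
    (Term.mulList l).OperandPerm (Term.mulList l') := by
  induction h with
  | nil => exact .refl _
  | cons x h _ => exact foldl_mul_perm h x
  | swap x y l => exact foldl_mul_init (.mul_comm _ _) l
  | trans _ _ h1 h2 => exact .trans _ _ _ h1 h2

lemma Term.OperandPerm.addList_congr [Zero G] {ι : Type*} (l : List ι) {f g : ι → Term K G}
    (h : ∀ a ∈ l, (f a).OperandPerm (g a)) :
    (Term.addList (l.map f)).OperandPerm (Term.addList (l.map g)) := by
  have hfold : ∀ (l : List ι) (a b : Term K G), (∀ a ∈ l, (f a).OperandPerm (g a)) →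
      a.OperandPerm b → ((l.map f).foldl .add a).OperandPerm ((l.map g).foldl .add b) := by
    intro l
    induction l with
    | nil => exact fun _ _ _ h => h
    | cons x l ih =>
      intro a b hl hab
      exact ih _ _ (fun y hy => hl y (List.mem_cons_of_mem _ hy))
        (.add_congr _ _ _ _ hab (hl x List.mem_cons_self))
  cases l with
  | nil => exact .refl _
  | cons x l =>
    exact hfold l _ _ (fun y hy => h y (List.mem_cons_of_mem _ hy)) (h x List.mem_cons_self)

/-- The number of additions and multiplications outside of sums, products and powers. -/
def Term.operandCount : Term K G → ℕ
  | .add a b => a.operandCount + b.operandCount + 1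
  | .mul a b => a.operandCount + b.operandCount + 1
  | .pow a _ => a.operandCount
  | _ => 0

/-- A crude invariant that suffices to separate the term `0` from every nonempty reduced
representation. -/
lemma Term.OperandPerm.operandCount_eq {a b : Term K G} (h : a.OperandPerm b) :
    a.operandCount = b.operandCount := by
  induction h with
  | refl => rfl
  | symm _ _ _ ih => exact ih.symm
  | trans _ _ _ _ _ h1 h2 => exact h1.trans h2
  | pow_congr _ _ _ _ ih => exact ih
  | _ => simp only [Term.operandCount]; omega

lemma Term.le_operandCount_foldl_add (a : Term K G) (l : List (Term K G)) :
    a.operandCount ≤ (l.foldl .add a).operandCount := by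
  induction l generalizing a with
  | nil => exact le_refl _
  | cons x l ih => exact le_trans (by simp only [Term.operandCount]; omega) (ih (.add a x))

/-- Even a single monomial carries the multiplication by its coefficient. -/
lemma Term.operandCount_ofMonomials_pos [Zero G] [One G] {X : MonomialList (Term K G) G}
    (hX : X ≠ []) : 0 < (Term.ofMonomials X).operandCount := by
  cases X with
  | nil => exact absurd rfl hX
  | cons t X =>
    refine lt_of_lt_of_le ?_ (Term.le_operandCount_foldl_add _ _)
    simp only [Term.operandCount]; omega

end OperandPerm

/-! ## Terms in reduced representation -/

section TermLemmas

variable {K₀ : Type u} [Field K₀] {d v e : ℕ}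

/-- The kind of monomial that models a sum or product. -/
def kindOf : SPTerm K₀ d v → MonomialKind
  | .rpow r => .A (orderOf r)
  | .prod _ _ => .P
  | _ => .S

lemma kindOf_eq_S_iff {a : SPTerm K₀ d v} (ha : IsSigma a ∨ IsPi a) :
    kindOf a = .S ↔ ∃ l f, a = .sum l f := by
  rcases ha with ⟨l, f, _, rfl⟩ | ⟨r, _, rfl⟩ | ⟨l, f, p, _, _, _, rfl⟩ <;> simp [kindOf]

lemma kindOf_eq_P_iff {a : SPTerm K₀ d v} : kindOf a = .P ↔ ∃ l f, a = .prod l f := by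
  cases a <;> simp [kindOf]

lemma IsNontrivialRootOfUnity.one_lt_orderOf {K : Type u} [Field K] {r : K}
    (h : IsNontrivialRootOfUnity r) : 1 < orderOf r := by
  have h1 := h.2.orderOf_pos
  have h2 : orderOf r ≠ 1 := fun h' => h.1 (orderOf_eq_one_iff.mp h')
  omega

lemma IsNontrivialRootOfUnity.ne_zero {K : Type u} [Field K] {r : K}
    (h : IsNontrivialRootOfUnity r) : r ≠ 0 := by
  rintro rfl
  have := h.2.orderOf_pos
  have h2 := pow_orderOf_eq_one (0 : K)
  rw [zero_pow this.ne'] at h2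
  exact zero_ne_one h2

/-- Matches the powers admitted in terms with the exponents of monomials of the corresponding kind,
so that reducedness can be checked on lists of indices. -/
lemma admissiblePower_iff {a : SPTerm K₀ d v} (ha : IsSigma a ∨ IsPi a) (z : ℤ) :
    AdmissiblePower a z ↔ z ≠ 0 ∧ z ∈ (kindOf a).exponents := by
  rcases ha with h | h
  · have h' := h
    obtain ⟨l, f, _, rfl⟩ := h'
    constructor
    · rintro (⟨_, hz⟩ | ⟨⟨_, _, h'⟩, _⟩ | ⟨r, _, h', _⟩)
      · exact ⟨by omega, Set.mem_Ici.mpr (by omega)⟩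
      · cases h'
      · cases h'
    · rintro ⟨h1, h2⟩
      have := Set.mem_Ici.mp h2
      exact Or.inl ⟨h, by omega⟩
  · have h' := h
    rcases h' with ⟨r, hr, rfl⟩ | ⟨l, f, p, _, _, _, rfl⟩
    · constructor
      · rintro (⟨⟨_, _, _, h'⟩, _⟩ | ⟨⟨_, _, h'⟩, _⟩ | ⟨r', _, h', h1, h2⟩)
        · cases h'
        · cases h'
        · cases h'
          exact ⟨by omega, ⟨by omega, h2⟩⟩
      · rintro ⟨h1, h2, h3⟩
        exact Or.inr (Or.inr ⟨r, hr, rfl, by omega, h3⟩)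
    · constructor
      · rintro (⟨⟨_, _, _, h'⟩, _⟩ | ⟨_, _, h'⟩ | ⟨r', _, h', _⟩)
        · cases h'
        · exact ⟨h', trivial⟩
        · cases h'
      · rintro ⟨h1, _⟩
        exact Or.inr (Or.inl ⟨⟨_, _, rfl⟩, h, h1⟩)

lemma AdmissiblePower.isSigma_or_isPi {a : SPTerm K₀ d v} {z : ℤ} (h : AdmissiblePower a z) :
    IsSigma a ∨ IsPi a := by
  rcases h with ⟨h, _⟩ | ⟨_, h, _⟩ | ⟨r, hr, rfl, _⟩
  · exact Or.inl h
  · exact Or.inr h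
  · exact Or.inr (Or.inl ⟨r, hr, rfl⟩)

lemma mem_atoms_self {a : SPTerm K₀ d v} (ha : IsSigma a ∨ IsPi a) : a ∈ a.atoms := by
  rcases ha with ⟨l, f, _, rfl⟩ | ⟨r, _, rfl⟩ | ⟨l, f, p, _, _, _, rfl⟩ <;> simp [Term.atoms]

lemma atoms_subset_allAtoms {K G : Type u} (a : Term K G) : a.atoms ⊆ a.allAtoms := by
  induction a with
  | base g => exact subset_refl _
  | rpow r => exact subset_refl _
  | pow a z ih => exact ih
  | add a b iha ihb => exact Set.union_subset_union iha ihb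
  | mul a b iha ihb => exact Set.union_subset_union iha ihb
  | sum l a _ => simp [Term.atoms, Term.allAtoms]
  | prod l a _ => simp [Term.atoms, Term.allAtoms]

lemma atoms_foldl_add {K G : Type u} (a : Term K G) (l : List (Term K G)) {b : Term K G}
    (hb : b ∈ a :: l) : b.atoms ⊆ (l.foldl .add a).atoms := by
  induction l generalizing a b with
  | nil => rw [List.mem_singleton.mp hb]; exact subset_refl _
  | cons x l ih =>
    rw [List.foldl_cons]
    rcases List.mem_cons.mp hb with rfl | hb
    · exact Set.Subset.trans (Set.subset_union_left (t := x.atoms)) (ih (.add b x) List.mem_cons_self)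
    · rcases List.mem_cons.mp hb with rfl | hb
      · exact Set.Subset.trans (Set.subset_union_right (s := a.atoms)) (ih (.add a b) List.mem_cons_self)
      · exact ih _ (List.mem_cons_of_mem _ hb)

lemma atoms_foldl_mul {K G : Type u} (a : Term K G) (l : List (Term K G)) {b : Term K G}
    (hb : b ∈ a :: l) : b.atoms ⊆ (l.foldl .mul a).atoms := by
  induction l generalizing a b with
  | nil => rw [List.mem_singleton.mp hb]; exact subset_refl _
  | cons x l ih =>
    rw [List.foldl_cons]
    rcases List.mem_cons.mp hb with rfl | hb
    · exact Set.Subset.trans (Set.subset_union_left (t := x.atoms)) (ih (.mul b x) List.mem_cons_self)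
    · rcases List.mem_cons.mp hb with rfl | hb
      · exact Set.Subset.trans (Set.subset_union_right (s := a.atoms)) (ih (.mul a b) List.mem_cons_self)
      · exact ih _ (List.mem_cons_of_mem _ hb)

lemma atoms_subset_ofMonomials {K G : Type u} [Zero G] [One G]
    {X : MonomialList (Term K G) G} {t : G × List (Term K G × ℤ)} (ht : t ∈ X)
    {p : Term K G × ℤ} (hp : p ∈ t.2) : p.1.atoms ⊆ (Term.ofMonomials X).atoms := by
  have h1 : p.1.atoms ⊆ (Term.mulList (t.2.map fun p => Term.pow p.1 p.2)).atoms := by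
    obtain ⟨g, l⟩ := t
    cases l with
    | nil => simp at hp
    | cons q l =>
      exact atoms_foldl_mul (Term.pow q.1 q.2) (l.map fun p : Term K G × ℤ => Term.pow p.1 p.2)
        (b := Term.pow p.1 p.2) (List.mem_map_of_mem (f := fun p : Term K G × ℤ =>
          Term.pow p.1 p.2) hp)
  have h2 : (Term.mulList (t.2.map fun p => Term.pow p.1 p.2)).atoms ⊆
      (Term.ofMonomials X).atoms := by
    cases X with
    | nil => simp at ht
    | cons s X =>
      exact Set.subset_union_right.trans (atoms_foldl_add _ _ (List.mem_map_of_mem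
        (f := fun t : G × List (Term K G × ℤ) => Term.mul (Term.base t.1)
          (Term.mulList (t.2.map fun p => Term.pow p.1 p.2))) ht))
  exact h1.trans h2

/-- Keeps sums out of multiplicands, so that every factor of a multiplicand is modelled by a unit.
-/
lemma IsProdStar.sum_notMem_atoms {p : SPTerm K₀ d v} (hp : IsProdStar p) (l : ℕ)
    (B : SPTerm K₀ d v) : Term.sum l B ∉ p.atoms := by
  induction hp with
  | one => simp [Term.atoms]
  | rpow r _ => simp [Term.atoms]
  | prod => simp [Term.atoms]
  | mul p q _ _ h1 h2 => simp only [Term.atoms, Set.mem_union, not_or]; exact ⟨h1, h2⟩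
  | pow p z _ _ h => exact h

/-- The condition `l ≥ Z(f)` removes all zeros and poles of `f` from the range of the product; an
empty product is `1`. Thus products are invertible at every index. -/
lemma IsProdStar.termValue_ne_zero (hd : d ≤ 1) (hchar : d = 1 → CharZero K₀)
    {p : SPTerm K₀ d v} (hp : IsProdStar p) (n : ℕ) : termValue p n ≠ 0 := by
  induction hp generalizing n with
  | one => simp [termValue]
  | rpow r hr => exact Finset.prod_ne_zero_iff.mpr fun _ _ => hr.ne_zero
  | prod l f p _ hf hl ih =>
    exact Finset.prod_ne_zero_iff.mpr fun i hi =>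
      mul_ne_zero (groundEv_ne_zero hd hchar hf (hl.trans (Finset.mem_Icc.mp hi).1)) (ih i)
  | mul p q _ _ h1 h2 => exact mul_ne_zero (h1 n) (h2 n)
  | pow p z _ _ h => exact zpow_ne_zero _ (h n)

lemma IsPi.isProdStar {a : SPTerm K₀ d v} (ha : IsPi a) : IsProdStar a := by
  rcases ha with ⟨r, hr, rfl⟩ | ⟨l, f, p, hp, hf, hl, rfl⟩
  · exact .rpow r hr
  · exact .prod l f p hp hf hl

lemma AdmissiblePower.isSumProd {a : SPTerm K₀ d v} {z : ℤ} (h : AdmissiblePower a z) :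
    IsSumProd (.pow a z) := by
  rcases h with ⟨⟨l, f, hf, rfl⟩, hz⟩ | ⟨_, h, hz⟩ | ⟨r, hr, rfl, hz, _⟩
  · exact .pow _ _ (.sum l f hf) hz
  · exact .prodStar _ (.pow _ _ h.isProdStar hz)
  · exact .prodStar _ (.pow _ _ (.rpow r hr) (by omega))

lemma isSumProd_ofMonomials {X : MonomialList (SPTerm K₀ d v) (GroundField K₀ d v)}
    (hX : ∀ t ∈ X, ∀ p ∈ t.2, AdmissiblePower p.1 p.2) : IsSumProd (Term.ofMonomials X) := by
  have hmul : ∀ (l : List (SPTerm K₀ d v)) (a : SPTerm K₀ d v), IsSumProd a →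
      (∀ b ∈ l, IsSumProd b) → IsSumProd (l.foldl .mul a) := by
    intro l
    induction l with
    | nil => exact fun a ha _ => ha
    | cons x l ih =>
      exact fun a ha hl => ih _ (.mul _ _ ha (hl x List.mem_cons_self))
        (fun b hb => hl b (List.mem_cons_of_mem _ hb))
  have hadd : ∀ (l : List (SPTerm K₀ d v)) (a : SPTerm K₀ d v), IsSumProd a →
      (∀ b ∈ l, IsSumProd b) → IsSumProd (l.foldl .add a) := by
    intro l
    induction l with
    | nil => exact fun a ha _ => ha
    | cons x l ih =>
      exact fun a ha hl => ih _ (.add _ _ ha (hl x List.mem_cons_self))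
        (fun b hb => hl b (List.mem_cons_of_mem _ hb))
  have hmon : ∀ t ∈ X, IsSumProd (Term.mul (Term.base t.1)
      (Term.mulList (t.2.map fun p => Term.pow p.1 p.2))) := by
    intro t ht
    refine .mul _ _ (.base _) ?_
    have ht' := hX t ht
    generalize t.2 = l at ht'
    cases l with
    | nil => exact .base _
    | cons p l =>
      refine hmul _ _ (ht' p List.mem_cons_self).isSumProd fun b hb => ?_
      obtain ⟨q, hq, rfl⟩ := List.mem_map.mp hb
      exact (ht' q (List.mem_cons_of_mem _ hq)).isSumProd
  cases X with
  | nil => exact .base _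
  | cons t X =>
    refine hadd _ _ (hmon t List.mem_cons_self) fun b hb => ?_
    obtain ⟨s, hs, rfl⟩ := List.mem_map.mp hb
    exact hmon s (List.mem_cons_of_mem _ hs)

lemma termValue_mulList (l : List (SPTerm K₀ d v)) (n : ℕ) :
    termValue (Term.mulList l) n = (l.map fun a => termValue a n).prod := by
  have h : ∀ (l : List (SPTerm K₀ d v)) (a : SPTerm K₀ d v), termValue (l.foldl .mul a) n =
      termValue a n * (l.map fun a => termValue a n).prod := by
    intro l
    induction l with
    | nil => simp
    | cons x l ih =>
      intro a
      rw [List.foldl_cons, ih, List.map_cons, List.prod_cons, ← mul_assoc]; rfl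
  cases l with
  | nil => simp [Term.mulList, termValue]
  | cons a l => rw [Term.mulList, h, List.map_cons, List.prod_cons]

lemma termValue_addList (l : List (SPTerm K₀ d v)) (n : ℕ) :
    termValue (Term.addList l) n = (l.map fun a => termValue a n).sum := by
  have h : ∀ (l : List (SPTerm K₀ d v)) (a : SPTerm K₀ d v), termValue (l.foldl .add a) n =
      termValue a n + (l.map fun a => termValue a n).sum := by
    intro l
    induction l with
    | nil => simp
    | cons x l ih =>
      intro a
      rw [List.foldl_cons, ih, List.map_cons, List.sum_cons, ← add_assoc]; rfl
  cases l with
  | nil => simp [Term.addList, termValue]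
  | cons a l => rw [Term.addList, h, List.map_cons, List.sum_cons]

/-- The relations hold for whole sequences and pass from there, by ring homomorphisms, both to
single values and to germs. -/
lemma termValue_holds (hd : d ≤ 1) (hchar : d = 1 → CharZero K₀) {a : SPTerm K₀ d v}
    (ha : IsSigma a ∨ IsPi a) : (kindOf a).Holds (termValue a) := by
  rcases ha with ⟨l, f, _, rfl⟩ | ⟨r, hr, rfl⟩ | h
  · trivial
  · refine ⟨hr.one_lt_orderOf, ?_⟩
    funext n
    simp only [termValue, Finset.prod_const, Pi.pow_apply, Pi.one_apply]
    rw [← pow_mul, mul_comm, pow_mul, pow_orderOf_eq_one, one_pow]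
  · obtain ⟨l, f, p, hp, hf, hl, rfl⟩ := h
    rw [kindOf, MonomialKind.Holds, Pi.isUnit_iff]
    exact fun n => ((IsProdStar.prod l f p hp hf hl).termValue_ne_zero hd hchar n).isUnit

lemma termValue_holds_apply (hd : d ≤ 1) (hchar : d = 1 → CharZero K₀) {a : SPTerm K₀ d v}
    (ha : IsSigma a ∨ IsPi a) (n : ℕ) : (kindOf a).Holds (termValue a n) :=
  (termValue_holds hd hchar ha).map (Pi.evalRingHom _ n)

lemma termValue_holds_germ (hd : d ≤ 1) (hchar : d = 1 → CharZero K₀) {a : SPTerm K₀ d v}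
    (ha : IsSigma a ∨ IsPi a) : (kindOf a).Holds (toGerm (termValue a)) :=
  (termValue_holds hd hchar ha).map (Filter.Germ.coeRingHom _)

lemma toGerm_powProd (hd : d ≤ 1) (hchar : d = 1 → CharZero K₀) {T : Fin e → SPTerm K₀ d v}
    (hT : ∀ i, IsSigma (T i) ∨ IsPi (T i)) {m : Fin e → ℤ}
    (hm : ∀ j, m j ∈ (kindOf (T j)).domain) :
    toGerm (fun n => powProd (fun j => termValue (T j) n) m) =
      powProd (fun j => toGerm (termValue (T j))) m := by
  have h1 := map_powProd (fun j => termValue_holds hd hchar (hT j))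
    (Filter.Germ.coeRingHom (Filter.atTop : Filter ℕ)) hm
  have h2 : (fun n => powProd (fun j => termValue (T j) n) m) =
      powProd (fun j => termValue (T j)) m := by
    funext n
    exact (map_powProd (fun j => termValue_holds hd hchar (hT j))
      (Pi.evalRingHom (fun _ : ℕ => ConstField K₀ v) n) hm).symm
  rw [h2]
  exact h1

lemma termValue_ofMonomials (hd : d ≤ 1) (hchar : d = 1 → CharZero K₀)
    {T : Fin e → SPTerm K₀ d v} (hT : ∀ i, IsSigma (T i) ∨ IsPi (T i))
    {Y : MonomialList (Fin e) (GroundField K₀ d v)}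
    (hY : ∀ s ∈ Y, ∀ p ∈ s.2, p.2 ∈ (kindOf (T p.1)).exponents) (n : ℕ) :
    termValue (Term.ofMonomials (mapMonomials T Y)) n =
      (Y.map fun s => groundEv K₀ d v s.1 n *
        powProd (fun j => termValue (T j) n) (exponentOf s.2)).sum := by
  rw [Term.ofMonomials, termValue_addList, mapMonomials, List.map_map, List.map_map]
  congr 1
  refine List.map_congr_left fun s hs => ?_
  simp only [Function.comp_apply, termValue, termValue_mulList, List.map_map]
  congr 1
  rw [← (prod_map_intPow (fun j => termValue_holds_apply hd hchar (hT j) n) (hY s hs)).1]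
  congr 1
  refine List.map_congr_left fun p _ => ?_
  simp only [Function.comp_apply, termValue, intPow_field]

/-- Lists of monomials with the same coefficients and exponents define equal terms up to
permutations of the operands. -/
lemma operandPerm_ofMonomials {K G : Type u} [Zero G] [One G] {T : Fin e → Term K G}
    {kind : Fin e → MonomialKind} {Y Y' : MonomialList (Fin e) G}
    (hY : IsReducedList (KindAdmissible kind) Y) (hY' : IsReducedList (KindAdmissible kind) Y')
    (h : (Y.map fun s => (s.1, exponentOf s.2)).Perm (Y'.map fun s => (s.1, exponentOf s.2))) :
    (Term.ofMonomials (mapMonomials T Y)).OperandPerm (Term.ofMonomials (mapMonomials T Y')) := by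
  -- The monomial with given coefficient and exponent vector, its factors in the order of `Fin e`.
  let c : G × (Fin e → ℤ) → Term K G := fun x => .mul (.base x.1)
    (Term.mulList ((powerList x.2).map fun p => Term.pow (T p.1) p.2))
  have hc : ∀ Y : MonomialList (Fin e) G, IsReducedList (KindAdmissible kind) Y →
      (Term.ofMonomials (mapMonomials T Y)).OperandPerm
        (Term.addList ((Y.map fun s => (s.1, exponentOf s.2)).map c)) := by
    intro Y hY
    rw [Term.ofMonomials, mapMonomials, List.map_map, List.map_map]
    refine Term.OperandPerm.addList_congr _ fun s hs => ?_
    refine .mul_congr _ _ _ _ (.refl _) (Term.OperandPerm.mulList_perm ?_)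
    simp only [List.map_map]
    exact (perm_powerList (hY.nodup s hs) fun p hp => (hY.admissible s hs p hp).1).map _
  exact .trans _ _ _ (hc Y hY) (.trans _ _ _ (Term.OperandPerm.addList_perm (h.map c))
    (.symm _ _ (hc Y' hY')))

end TermLemmas

/-! ## Elements given by lists of monomials -/

section ElemOf

variable {G : Type*} [Field G] {R : Type*} [CommRing R] [Algebra G R] {e : ℕ}

/-- The element with the given list of monomials. -/
def elemOf (t : Fin e → R) (Y : MonomialList (Fin e) G) : R :=
  (Y.map fun s => algebraMap G R s.1 * (s.2.map fun p => intPow (t p.1) p.2).prod).sum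

/-- The coefficients of the monomials in a list. -/
def coefOf (Y : MonomialList (Fin e) G) : (Fin e → ℤ) →₀ G :=
  (Y.map fun s => Finsupp.single (exponentOf s.2) s.1).sum

variable {kind : Fin e → MonomialKind} {t : Fin e → R}

lemma coefOf_eq_zero {Y : MonomialList (Fin e) G} {m : Fin e → ℤ}
    (hm : m ∉ Y.map fun s => exponentOf s.2) : coefOf Y m = 0 := by
  induction Y with
  | nil => rfl
  | cons s Y ih =>
    rw [List.map_cons, List.mem_cons, not_or] at hm
    have := ih hm.2
    unfold coefOf at this ⊢
    rw [List.map_cons, List.sum_cons, Finsupp.add_apply, this, Finsupp.single_eq_of_ne hm.1,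
      add_zero]

lemma coefOf_apply {Y : MonomialList (Fin e) G} (hY : (Y.map fun s => exponentOf s.2).Nodup)
    {s : G × List (Fin e × ℤ)} (hs : s ∈ Y) : coefOf Y (exponentOf s.2) = s.1 := by
  induction Y with
  | nil => simp at hs
  | cons s' Y ih =>
    rw [List.map_cons, List.nodup_cons] at hY
    have hcons : coefOf (s' :: Y) = Finsupp.single (exponentOf s'.2) s'.1 + coefOf Y := rfl
    rw [hcons, Finsupp.add_apply]
    rcases List.mem_cons.mp hs with rfl | hs
    · rw [coefOf_eq_zero hY.1, Finsupp.single_eq_same, add_zero]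
    · have : exponentOf s.2 ≠ exponentOf s'.2 := fun h => hY.1 (h ▸ List.mem_map_of_mem
        (f := fun s : G × List (Fin e × ℤ) => exponentOf s.2) hs)
      rw [ih hY.2 hs, Finsupp.single_eq_of_ne this, zero_add]

lemma elemOf_eq_linearCombination (H : ∀ j, (kind j).Holds (t j)) {Y : MonomialList (Fin e) G}
    (hY : ∀ s ∈ Y, ∀ p ∈ s.2, p.2 ∈ (kind p.1).exponents) :
    elemOf t Y = Finsupp.linearCombination G (powProd t) (coefOf Y) := by
  unfold elemOf coefOf
  rw [map_list_sum, List.map_map]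
  congr 1
  refine List.map_congr_left fun s hs => ?_
  rw [Function.comp_apply, Finsupp.linearCombination_single, Algebra.smul_def,
    (prod_map_intPow H (hY s hs)).1]

lemma elemOf_eq_sum (H : ∀ j, (kind j).Holds (t j)) {Y : MonomialList (Fin e) G}
    (hY : ∀ s ∈ Y, ∀ p ∈ s.2, p.2 ∈ (kind p.1).exponents) :
    elemOf t Y = ∑ a : Fin Y.length, Y[a].1 • powProd t (exponentOf Y[a].2) := by
  refine Eq.trans ?_ (Fin.sum_univ_fun_getElem Y fun s => s.1 • powProd t (exponentOf s.2)).symm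
  unfold elemOf
  congr 1
  refine List.map_congr_left fun s hs => ?_
  rw [Algebra.smul_def, (prod_map_intPow H (hY s hs)).1]

lemma IsReducedList.injective_exponentOf {Y : MonomialList (Fin e) G}
    (hY : IsReducedList (KindAdmissible kind) Y) :
    Function.Injective fun a : Fin Y.length => exponentOf Y[a].2 := by
  have h := List.nodup_iff_injective_get.mp hY.pairwise_exponentOf
  intro a b hab
  have := @h (Fin.cast (by simp) a) (Fin.cast (by simp) b) (by simpa using hab)
  simpa [Fin.ext_iff] using this

lemma elemOf_mem_stageOf (H : ∀ j, (kind j).Holds (t j)) {Y : MonomialList (Fin e) G} {i : ℕ}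
    (hY : ∀ s ∈ Y, ∀ p ∈ s.2, p.2 ∈ (kind p.1).exponents)
    (hi : ∀ s ∈ Y, ∀ p ∈ s.2, (p.1 : ℕ) < i) : elemOf t Y ∈ stageOf G kind t i := by
  refine Subalgebra.list_sum_mem _ fun x hx => ?_
  obtain ⟨s, hs, rfl⟩ := List.mem_map.mp hx
  refine mul_mem (Subalgebra.algebraMap_mem _ _) (Subalgebra.list_prod_mem _ fun y hy => ?_)
  obtain ⟨p, hp, rfl⟩ := List.mem_map.mp hy
  exact intPow_mem_stageOf H (hi s hs p hp) (MonomialKind.exponents_subset_domain _ (hY s hs p hp))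

lemma PowProdIndependent.linearCombination_injOn (hind : PowProdIndependent G kind t e)
    {g : (Fin e → ℤ) →₀ G} (hg : ∀ m ∈ g.support, IsExponent kind e m)
    (h0 : Finsupp.linearCombination G (powProd t) g = 0) : g = 0 := by
  rw [Finsupp.linearCombination_apply] at h0
  have := hind g.support id g hg Function.injective_id.injOn h0
  ext m
  by_contra h
  exact h (this m (Finsupp.mem_support_iff.mpr h))

/-- Reduced lists that define the same element have the same coefficients and exponents. -/
lemma perm_of_elemOf_eq (H : ∀ j, (kind j).Holds (t j)) (hind : PowProdIndependent G kind t e)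
    {Y Y' : MonomialList (Fin e) G} (hY : IsReducedList (KindAdmissible kind) Y)
    (hY' : IsReducedList (KindAdmissible kind) Y') (h : elemOf t Y = elemOf t Y') :
    (Y.map fun s => (s.1, exponentOf s.2)).Perm (Y'.map fun s => (s.1, exponentOf s.2)) := by
  have hexp : ∀ Y : MonomialList (Fin e) G, IsReducedList (KindAdmissible kind) Y → ∀ m,
      coefOf Y m ≠ 0 → IsExponent kind e m := by
    intro Y hY m hm
    have : m ∈ Y.map fun s => exponentOf s.2 := by
      by_contra h; exact hm (coefOf_eq_zero h)
    obtain ⟨s, hs, rfl⟩ := List.mem_map.mp this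
    exact hY.isExponent (fun j => (H j).zero_mem_exponents) hs fun p _ => p.1.2
  -- The difference of the two coefficient functions is a relation between admissible power
  -- products, hence trivial.
  have hcoef : coefOf Y = coefOf Y' := by
    rw [elemOf_eq_linearCombination H fun s hs p hp => (hY.admissible s hs p hp).2,
      elemOf_eq_linearCombination H fun s hs p hp => (hY'.admissible s hs p hp).2,
      ← sub_eq_zero, ← map_sub] at h
    rw [← sub_eq_zero]
    refine hind.linearCombination_injOn (fun m hm => ?_) h
    by_cases h1 : coefOf Y m = 0
    · by_cases h2 : coefOf Y' m = 0
      · rw [Finsupp.mem_support_iff, Finsupp.sub_apply, h1, h2, sub_zero] at hm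
        exact absurd rfl hm
      · exact hexp Y' hY' m h2
    · exact hexp Y hY m h1
  have hnodup : ∀ Y : MonomialList (Fin e) G, IsReducedList (KindAdmissible kind) Y →
      (Y.map fun s => (s.1, exponentOf s.2)).Nodup := fun Y hY =>
    List.Nodup.of_map Prod.snd (by
      rw [List.map_map]; exact hY.pairwise_exponentOf)
  have hmem : ∀ Y Y' : MonomialList (Fin e) G, IsReducedList (KindAdmissible kind) Y →
      IsReducedList (KindAdmissible kind) Y' → coefOf Y = coefOf Y' →
      ∀ x, x ∈ (Y.map fun s => (s.1, exponentOf s.2)) →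
        x ∈ (Y'.map fun s => (s.1, exponentOf s.2)) := by
    intro Y Y' hY hY' h x hx
    obtain ⟨s, hs, rfl⟩ := List.mem_map.mp hx
    have h1 := coefOf_apply hY.pairwise_exponentOf hs
    have h2 : exponentOf s.2 ∈ Y'.map fun s => exponentOf s.2 := by
      by_contra h3
      rw [h, coefOf_eq_zero h3] at h1
      exact hY.coeff_ne_zero s hs h1.symm
    obtain ⟨s', hs', he⟩ := List.mem_map.mp h2
    have h4 := coefOf_apply hY'.pairwise_exponentOf hs'
    refine List.mem_map.mpr ⟨s', hs', Prod.ext ?_ he⟩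
    dsimp only at he ⊢
    rw [← h4, ← h1, h, he]
  rw [List.perm_ext_iff_of_nodup (hnodup Y hY) (hnodup Y' hY')]
  exact fun x => ⟨hmem Y Y' hY hY' hcoef x, hmem Y' Y hY' hY hcoef.symm x⟩

lemma powProd_congr {x y : Fin e → R} {m : Fin e → ℤ} (h : ∀ j, m j ≠ 0 → x j = y j) :
    powProd x m = powProd y m := by
  refine Finset.prod_congr rfl fun j _ => ?_
  by_cases hj : m j = 0
  · rw [hj, intPow_zero, intPow_zero]
  · rw [h j hj]

/-- Agreement on the inverses of `P`-monomials is automatic, since ring homomorphisms respect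
inverses of units. -/
lemma ringHom_eqOn_stageOf {R' : Type*} [CommRing R'] (H : ∀ j, (kind j).Holds (t j))
    {f f' : R →+* R'} {i : ℕ} (hG : ∀ g, f (algebraMap G R g) = f' (algebraMap G R g))
    (ht : ∀ j : Fin e, (j : ℕ) < i → f (t j) = f' (t j)) :
    ∀ x ∈ stageOf G kind t i, f x = f' x := by
  intro x hx
  induction hx using Algebra.adjoin_induction with
  | mem x hx =>
    obtain ⟨j, hj, rfl | ⟨hk, rfl⟩⟩ := hx
    · exact ht j hj
    · have hinv : Ring.inverse (t j) = intPow (t j) (-1) := (pow_one _).symm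
      have hd := MonomialKind.domain_of_ne (κ := kind j) (by simp [hk]) (-1)
      rw [hinv, map_intPow (H j) f hd, map_intPow (H j) f' hd, ht j hj]
  | algebraMap r => exact hG r
  | add x y _ _ hx hy => rw [map_add, map_add, hx, hy]
  | mul x y _ _ hx hy => rw [map_mul, map_mul, hx, hy]

end ElemOf

/-! ## Recurrences for germs of sums and products -/

section GermRecurrence

variable {K₀ : Type u} [Field K₀] {d v e : ℕ}

lemma toGerm_add (a b : ℕ → ConstField K₀ v) :
    toGerm (fun n => a n + b n) = toGerm a + toGerm b := rfl

lemma toGerm_mul (a b : ℕ → ConstField K₀ v) :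
    toGerm (fun n => a n * b n) = toGerm a * toGerm b := rfl

lemma toGerm_sum {ι : Type*} (s : Finset ι) (a : ι → ℕ → ConstField K₀ v) :
    toGerm (fun n => ∑ i ∈ s, a i n) = ∑ i ∈ s, toGerm (a i) := by
  have := map_sum (Filter.Germ.coeRingHom (Filter.atTop : Filter ℕ)) a s
  rw [← Finset.sum_fn]
  exact this

/-- The summand that enters at `n + 1` is the shift of `A` at `n`. This is why the summand
corresponds to `σ⁻¹(σ(t) - t)`, and likewise the multiplicand to `σ⁻¹(σ(t)/t)`. -/
lemma germShift_sum_term (l : ℕ) (A : SPTerm K₀ d v) :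
    germShift K₀ v (toGerm (termValue (.sum l A))) =
      toGerm (termValue (.sum l A)) + germShift K₀ v (toGerm (termValue A)) := by
  rw [germShift_toGerm, germShift_toGerm, ← toGerm_add, toGerm_eq_iff]
  exact ⟨l, fun n hn => Finset.sum_Icc_succ_top (Nat.le_succ_of_le hn) _⟩

lemma germShift_prod_term (l : ℕ) (A : SPTerm K₀ d v) :
    germShift K₀ v (toGerm (termValue (.prod l A))) =
      germShift K₀ v (toGerm (termValue A)) * toGerm (termValue (.prod l A)) := by
  rw [germShift_toGerm, germShift_toGerm, ← toGerm_mul, toGerm_eq_iff]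
  exact ⟨l, fun n hn => (Finset.prod_Icc_succ_top (Nat.le_succ_of_le hn) _).trans (mul_comm _ _)⟩

lemma germShift_rpow_term (r : ConstField K₀ v) :
    germShift K₀ v (toGerm (termValue (.rpow r : SPTerm K₀ d v))) =
      (toGerm fun _ => r) * toGerm (termValue (.rpow r : SPTerm K₀ d v)) := by
  rw [germShift_toGerm, ← toGerm_mul, toGerm_eq_iff]
  exact ⟨1, fun n hn => (Finset.prod_Icc_succ_top (Nat.le_succ_of_le hn) _).trans (mul_comm _ _)⟩

lemma groundGerm_const (hd : d ≤ 1) (hchar : d = 1 → CharZero K₀) (r : ConstField K₀ v) :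
    groundGerm K₀ hd hchar (algebraMap _ _ r) = toGerm fun _ => r := by
  rw [groundGerm_apply, toGerm_eq_iff]
  exact ⟨0, fun n _ => groundEv_const r n⟩

end GermRecurrence

/-! ## Difference simplicity -/

namespace Tower

variable {G : Type u} [Field G] {e : ℕ} {𝓔 : Tower G e} {σG : G ≃+* G}

lemma IsAPS.holds (h : 𝓔.IsAPS σG) (j : Fin e) : (𝓔.kind j).Holds (𝓔.t j) := by
  cases hk : 𝓔.kind j with
  | A ν =>
    obtain ⟨h1, h2, _⟩ := h.kindA j ν hk
    exact ⟨h1, h2⟩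
  | P => exact (h.kindP j hk).1
  | S => trivial

/-- Treats `A`- and `P`-monomials alike: the inverse `α ^ (ν - 1)` of a root of unity lies in the
same stage. -/
lemma IsAPS.exists_factor (h : 𝓔.IsAPS σG) {i : Fin e} (hi : 𝓔.kind i ≠ .S) :
    ∃ α ∈ 𝓔.stage i, ∃ α' ∈ 𝓔.stage i, α * α' = 1 ∧ 𝓔.σ (𝓔.t i) = α * 𝓔.t i := by
  cases hk : 𝓔.kind i with
  | A ν =>
    obtain ⟨h1, _, α, hα, hprim, hσ⟩ := h.kindA i ν hk
    refine ⟨α, hα, α ^ (ν - 1), pow_mem hα _, ?_, hσ⟩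
    rw [← pow_succ', Nat.sub_add_cancel h1.le, hprim.pow_eq_one]
  | P => exact (h.kindP i hk).2
  | S => exact absurd hk hi

lemma IsAPS.shift_mem_stage (h : 𝓔.IsAPS σG) {n : ℕ} {x : 𝓔.E} (hx : x ∈ 𝓔.stage n) :
    𝓔.σ x ∈ 𝓔.stage n := by
  have hgen : ∀ j : Fin e, (j : ℕ) < n → 𝓔.σ (𝓔.t j) ∈ 𝓔.stage n := by
    intro j hj
    have hle : 𝓔.stage j ≤ 𝓔.stage n := stageOf_mono hj.le
    have htj : 𝓔.t j ∈ 𝓔.stage n := mem_stageOf hj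
    by_cases hk : 𝓔.kind j = .S
    · obtain ⟨β, hβ, hσ⟩ := h.kindS j hk
      rw [hσ]
      exact add_mem htj (hle hβ)
    · obtain ⟨α, hα, _, _, _, hσ⟩ := h.exists_factor hk
      rw [hσ]
      exact mul_mem (hle hα) htj
  induction hx using Algebra.adjoin_induction with
  | mem x hx =>
    obtain ⟨j, hj, rfl | ⟨hk, rfl⟩⟩ := hx
    · exact hgen j hj
    · have hle : 𝓔.stage j ≤ 𝓔.stage n := stageOf_mono hj.le
      obtain ⟨hu, α, hα, α', hα', h1, hσ⟩ := h.kindP j hk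
      have hinv : Ring.inverse (𝓔.t j) ∈ 𝓔.stage n :=
        Algebra.subset_adjoin ⟨j, hj, Or.inr ⟨hk, rfl⟩⟩
      have : 𝓔.σ (Ring.inverse (𝓔.t j)) = α' * Ring.inverse (𝓔.t j) := by
        have h2 : 𝓔.σ (Ring.inverse (𝓔.t j)) * (α * 𝓔.t j) = 1 := by
          rw [← hσ, ← map_mul, Ring.inverse_mul_cancel _ hu, map_one]
        have h3 := Ring.mul_inverse_cancel _ hu
        calc 𝓔.σ (Ring.inverse (𝓔.t j))
            = 𝓔.σ (Ring.inverse (𝓔.t j)) * ((α * α') * (𝓔.t j * Ring.inverse (𝓔.t j))) := by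
              rw [h1, h3, mul_one, mul_one]
          _ = 𝓔.σ (Ring.inverse (𝓔.t j)) * (α * 𝓔.t j) * (α' * Ring.inverse (𝓔.t j)) := by ring
          _ = _ := by rw [h2, one_mul]
      rw [this]
      exact mul_mem (hle hα') hinv
  | algebraMap r => rw [h.shift_base]; exact Subalgebra.algebraMap_mem _ _
  | add x y _ _ hx hy => rw [map_add]; exact add_mem hx hy
  | mul x y _ _ hx hy => rw [map_mul]; exact mul_mem hx hy

/-- Ideals of a stage of the tower which are closed under the shift. -/
structure IsShiftIdeal (𝓔 : Tower G e) (n : ℕ) (J : AddSubgroup 𝓔.E) : Prop where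
  le : ∀ x ∈ J, x ∈ 𝓔.stage n
  mul_mem : ∀ a ∈ 𝓔.stage n, ∀ x ∈ J, a * x ∈ J
  shift_mem : ∀ x ∈ J, 𝓔.σ x ∈ J

/-- The stage of the tower has no proper nonzero ideals which are closed under the shift. -/
def IsStageSimple (𝓔 : Tower G e) (n : ℕ) : Prop :=
  ∀ J, 𝓔.IsShiftIdeal n J → (∃ x ∈ J, x ≠ 0) → 1 ∈ J

lemma isStageSimple_zero : 𝓔.IsStageSimple 0 := by
  rintro J hJ ⟨x, hx, hx0⟩
  have h1 : x ∈ (⊥ : Subalgebra G 𝓔.E) := by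
    have h2 := hJ.le x hx
    have h3 : 𝓔.stage 0 = ⊥ := by
      unfold stage
      rw [← Algebra.adjoin_empty]
      congr 1
      ext y
      simp
    rwa [h3] at h2
  obtain ⟨g, rfl⟩ := Algebra.mem_bot.mp h1
  have hg : g ≠ 0 := by rintro rfl; simp at hx0
  have := hJ.mul_mem (algebraMap G 𝓔.E g⁻¹) (Subalgebra.algebraMap_mem _ _) _ hx
  rwa [← map_mul, inv_mul_cancel₀ hg, map_one] at this

lemma IsAPS.exists_expansion (h : 𝓔.IsAPS σG) {i : Fin e} {x : 𝓔.E}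
    (hx : x ∈ 𝓔.stage (i + 1)) : ∃ (S : Finset ℤ) (c : ℤ → 𝓔.E),
      (∀ k ∈ S, k ∈ (𝓔.kind i).exponents) ∧ (∀ k, c k ∈ 𝓔.stage i) ∧
      x = ∑ k ∈ S, c k * intPow (𝓔.t i) k := by
  classical
  obtain ⟨g, hg, rfl⟩ := exists_sum_of_mem_stageOf h.holds hx
  refine ⟨_, _, fun k hk => ?_, fun k => ?_, sum_powProd_eq_fiberwise g.support id g i⟩
  · obtain ⟨m, hm, rfl⟩ := Finset.mem_image.mp hk
    exact (hg m hm i).1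
  · exact sum_powProd_mem_stageOf h.holds fun m hm =>
      (hg m (Finset.mem_filter.mp hm).1).update_zero h.holds

/-- The step for `A`- and `P`-monomials. -/
lemma isStageSimple_succ_of_unit (h : 𝓔.IsAPS σG) (hc : 𝓔.SameConstants σG)
    {i : Fin e} (hi : 𝓔.kind i ≠ .S) (ih : 𝓔.IsStageSimple i) : 𝓔.IsStageSimple (i + 1) := by
  classical
  rintro J hJ ⟨x₀, hx₀, hx₀0⟩
  obtain ⟨α, hα, α', hα', hαα', hσ⟩ := h.exists_factor hi
  have hu : IsUnit (𝓔.t i) := (h.holds i).isUnit hi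
  have hle : 𝓔.stage i ≤ 𝓔.stage (i + 1) := stageOf_mono (Nat.le_succ _)
  let a : 𝓔.Eˣ := ⟨α, α', hαα', by rw [mul_comm]; exact hαα'⟩
  have ha : ∀ z : ℤ, ((a ^ z : 𝓔.Eˣ) : 𝓔.E) ∈ 𝓔.stage i := by
    intro z
    cases z with
    | ofNat n => rw [Int.ofNat_eq_natCast, zpow_natCast, Units.val_pow_eq_pow_val]; exact pow_mem hα n
    | negSucc n =>
      rw [zpow_negSucc, ← inv_pow, Units.val_pow_eq_pow_val]
      exact pow_mem hα' (n + 1)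
  have hσt : ∀ z : ℤ, 𝓔.σ (intPow (𝓔.t i) z) = ((a ^ z : 𝓔.Eˣ) : 𝓔.E) * intPow (𝓔.t i) z := by
    intro z
    have h1 := map_intPow (h.holds i) (𝓔.σ : 𝓔.E →+* 𝓔.E) (MonomialKind.domain_of_ne hi z)
    rw [RingEquiv.coe_toRingHom] at h1
    rw [h1, hσ, mul_intPow a.isUnit hu z, ← intPow_units]
  let rep (S : Finset ℤ) (c : ℤ → 𝓔.E) (x : 𝓔.E) : Prop :=
    (∀ k ∈ S, k ∈ (𝓔.kind i).exponents) ∧ (∀ k, c k ∈ 𝓔.stage i) ∧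
      x = ∑ k ∈ S, c k * intPow (𝓔.t i) k
  -- Among the nonzero elements of `J`, one is chosen that needs the fewest powers of `t_i`.
  have hex : ∃ N : ℕ, ∃ S c x, S.card = N ∧ x ∈ J ∧ x ≠ 0 ∧ rep S c x := by
    obtain ⟨S, c, h1, h2, h3⟩ := h.exists_expansion (hJ.le x₀ hx₀)
    exact ⟨_, S, c, x₀, rfl, hx₀, hx₀0, h1, h2, h3⟩
  have hmin : ∀ S c x, S.card < Nat.find hex → x ∈ J → rep S c x → x = 0 := by
    intro S c x hS hx hrep
    by_contra hx0
    exact Nat.find_min hex hS ⟨S, c, x, rfl, hx, hx0, hrep⟩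
  obtain ⟨S, c, x, hcard, hx, hx0, hS, hcst, hxeq⟩ := Nat.find_spec hex
  have hSne : S.Nonempty := by
    rw [Finset.nonempty_iff_ne_empty]
    rintro rfl
    exact hx0 (by rw [hxeq, Finset.sum_empty])
  obtain ⟨k₀, hk₀⟩ := hSne
  have herase : (S.erase k₀).card < Nat.find hex := by
    rw [← hcard]; exact Finset.card_erase_lt_of_mem hk₀
  have hSerase : ∀ k ∈ S.erase k₀, k ∈ (𝓔.kind i).exponents := fun k hk =>
    hS k (Finset.mem_of_mem_erase hk)
  -- The coefficients at `k₀` of the elements of `J` with exponents in `S`. They form a shift ideal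
  -- of the preceding stage, to which the induction hypothesis applies.
  let C : AddSubgroup 𝓔.E :=
    { carrier := {b | ∃ c y, y ∈ J ∧ rep S c y ∧ c k₀ = b}
      zero_mem' := ⟨0, 0, zero_mem _, ⟨hS, fun _ => zero_mem _, by simp⟩, rfl⟩
      add_mem' := by
        rintro _ _ ⟨c, y, hy, ⟨_, h2, h3⟩, rfl⟩ ⟨c', y', hy', ⟨_, h2', h3'⟩, rfl⟩
        refine ⟨c + c', y + y', add_mem hy hy', ⟨hS, fun k => add_mem (h2 k) (h2' k), ?_⟩, rfl⟩
        rw [h3, h3', ← Finset.sum_add_distrib]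
        exact Finset.sum_congr rfl fun k _ => (add_mul _ _ _).symm
      neg_mem' := by
        rintro _ ⟨c, y, hy, ⟨_, h2, h3⟩, rfl⟩
        refine ⟨-c, -y, neg_mem hy, ⟨hS, fun k => neg_mem (h2 k), ?_⟩, rfl⟩
        rw [h3, ← Finset.sum_neg_distrib]
        exact Finset.sum_congr rfl fun k _ => (neg_mul _ _).symm }
  -- Since `σ(t_i^k) = α^k t_i^k`, the factor `α^(-k₀)` makes the new coefficient at `k₀` exactly
  -- the shift of the old one.
  have hnorm : ∀ c y, y ∈ J → rep S c y →
      rep S (fun k => 𝓔.σ (c k) * ((a ^ (k - k₀) : 𝓔.Eˣ) : 𝓔.E))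
        (((a ^ (-k₀) : 𝓔.Eˣ) : 𝓔.E) * 𝓔.σ y) := by
    rintro c y hy ⟨_, h2, h3⟩
    refine ⟨hS, fun k => mul_mem (h.shift_mem_stage (h2 k)) (ha _), ?_⟩
    rw [h3, map_sum, Finset.mul_sum]
    refine Finset.sum_congr rfl fun k _ => ?_
    dsimp only
    rw [map_mul, hσt, sub_eq_neg_add, zpow_add, Units.val_mul]
    ring
  have hC : 𝓔.IsShiftIdeal i C := by
    refine ⟨?_, ?_, ?_⟩
    · rintro _ ⟨c, y, _, ⟨_, h2, _⟩, rfl⟩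
      exact h2 k₀
    · rintro b hb _ ⟨c, y, hy, ⟨_, h2, h3⟩, rfl⟩
      refine ⟨fun k => b * c k, b * y, hJ.mul_mem b (hle hb) y hy,
        ⟨hS, fun k => mul_mem hb (h2 k), ?_⟩, rfl⟩
      rw [h3, Finset.mul_sum]
      exact Finset.sum_congr rfl fun k _ => (mul_assoc _ _ _).symm
    · rintro _ ⟨c, y, hy, hrep, rfl⟩
      refine ⟨_, _, hJ.mul_mem _ (hle (ha (-k₀))) _ (hJ.shift_mem y hy), hnorm c y hy hrep, ?_⟩
      simp
  have hC0 : ∃ b ∈ C, b ≠ 0 := by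
    refine ⟨c k₀, ⟨c, x, hx, ⟨hS, hcst, hxeq⟩, rfl⟩, fun h0 => hx0 ?_⟩
    refine hmin _ c x herase hx ⟨hSerase, hcst, ?_⟩
    rw [hxeq, ← Finset.add_sum_erase _ _ hk₀, h0, zero_mul, zero_add]
  obtain ⟨c, y, hy, hrep, hc1⟩ := ih C hC hC0
  -- The coefficient of `y` at `k₀` is `1` and cancels here. The difference lies in `J` and needs
  -- fewer powers of `t_i`, so it vanishes by minimality.
  have hdiff : ((a ^ (-k₀) : 𝓔.Eˣ) : 𝓔.E) * 𝓔.σ y - y = 0 := by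
    refine hmin (S.erase k₀) (fun k => 𝓔.σ (c k) * ((a ^ (k - k₀) : 𝓔.Eˣ) : 𝓔.E) - c k) _ herase
      (sub_mem (hJ.mul_mem _ (hle (ha (-k₀))) _ (hJ.shift_mem y hy)) hy) ⟨hSerase, fun k =>
        sub_mem ((hnorm c y hy hrep).2.1 k) (hrep.2.1 k), ?_⟩
    have h1 : ((a ^ (-k₀) : 𝓔.Eˣ) : 𝓔.E) * 𝓔.σ y - y = ∑ k ∈ S,
        (𝓔.σ (c k) * ((a ^ (k - k₀) : 𝓔.Eˣ) : 𝓔.E) - c k) * intPow (𝓔.t i) k := by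
      rw [(hnorm c y hy hrep).2.2]
      conv_lhs => rw [hrep.2.2]
      rw [← Finset.sum_sub_distrib]
      exact Finset.sum_congr rfl fun k _ => (sub_mul _ _ _).symm
    rw [h1, ← Finset.add_sum_erase _ _ hk₀, hc1]
    simp
  have hnt : Nontrivial 𝓔.E := nontrivial_of_ne x 0 hx0
  have hy0 : y ≠ 0 := by
    intro h0
    have := (linearIndependent_stage_iff i).mp (h.free i) S c hS (fun k _ => hrep.2.1 k)
      (by rw [← hrep.2.2, h0]) k₀ hk₀
    rw [hc1] at this
    exact one_ne_zero this
  -- Now `σ(y) = α^k₀ y`, so `t_i^(-k₀) y` is a constant and lies in the ground field. Being nonzero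
  -- and in `J`, it yields `1 ∈ J`.
  have hconst : 𝓔.σ (intPow (𝓔.t i) (-k₀) * y) = intPow (𝓔.t i) (-k₀) * y := by
    rw [map_mul, hσt, mul_right_comm, sub_eq_zero.mp hdiff, mul_comm]
  have hmem : intPow (𝓔.t i) (-k₀) * y ∈ {c : 𝓔.E | 𝓔.σ c = c} := hconst
  rw [hc] at hmem
  obtain ⟨κ, _, hκ⟩ := hmem
  have hκ0 : κ ≠ 0 := by
    rintro rfl
    apply hy0
    rw [map_zero] at hκ
    calc y = (intPow (𝓔.t i) k₀ * intPow (𝓔.t i) (-k₀)) * y := by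
          rw [intPow_mul_neg hu, one_mul]
      _ = 0 := by rw [mul_assoc, ← hκ, mul_zero]
  have h1 := hJ.mul_mem _ (intPow_mem_stageOf h.holds (Nat.lt_succ_self i)
    (MonomialKind.domain_of_ne hi (-k₀))) y hy
  rw [← hκ] at h1
  have h2 := hJ.mul_mem (algebraMap G 𝓔.E κ⁻¹) (Subalgebra.algebraMap_mem _ _) _ h1
  rwa [← map_mul, inv_mul_cancel₀ hκ0, map_one] at h2

/-- Polynomials in `t_i` of degree less than `n` over the preceding stage. -/
def polyLT (𝓔 : Tower G e) (i : Fin e) (n : ℕ) : Submodule (𝓔.stage i) 𝓔.E :=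
  Submodule.span (𝓔.stage i) ((fun k => 𝓔.t i ^ k) '' {k | k < n})

lemma polyLT_mono {i : Fin e} {n n' : ℕ} (h : n ≤ n') : 𝓔.polyLT i n ≤ 𝓔.polyLT i n' :=
  Submodule.span_mono (Set.image_mono fun _ hk => lt_of_lt_of_le hk h)

lemma pow_mem_polyLT {i : Fin e} {k n : ℕ} (h : k < n) : 𝓔.t i ^ k ∈ 𝓔.polyLT i n :=
  Submodule.subset_span ⟨k, h, rfl⟩

lemma mul_mem_polyLT {i : Fin e} {n : ℕ} {b x : 𝓔.E} (hb : b ∈ 𝓔.stage i)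
    (hx : x ∈ 𝓔.polyLT i n) : b * x ∈ 𝓔.polyLT i n :=
  Submodule.smul_mem (𝓔.polyLT i n) (⟨b, hb⟩ : 𝓔.stage i) hx

lemma t_mul_mem_polyLT {i : Fin e} {n : ℕ} {x : 𝓔.E} (hx : x ∈ 𝓔.polyLT i n) :
    𝓔.t i * x ∈ 𝓔.polyLT i (n + 1) := by
  induction hx using Submodule.span_induction with
  | mem x hx =>
    obtain ⟨k, hk, rfl⟩ := hx
    rw [← pow_succ']
    exact pow_mem_polyLT (Nat.succ_lt_succ hk)
  | zero => rw [mul_zero]; exact zero_mem _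
  | add x y _ _ hx hy => rw [mul_add]; exact add_mem hx hy
  | smul a x _ hx => rw [mul_smul_comm]; exact Submodule.smul_mem _ _ hx

lemma mem_polyLT_succ {i : Fin e} {n : ℕ} {x : 𝓔.E} :
    x ∈ 𝓔.polyLT i (n + 1) ↔ ∃ b ∈ 𝓔.stage i, ∃ y ∈ 𝓔.polyLT i n, x = b * 𝓔.t i ^ n + y := by
  have : {k | k < n + 1} = insert n {k | k < n} := by
    ext k; simp only [Set.mem_ofPred_eq, Set.mem_insert_iff]; omega
  rw [polyLT, this, Set.image_insert_eq, Submodule.mem_span_insert]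
  constructor
  · rintro ⟨b, y, hy, rfl⟩
    exact ⟨b, b.2, y, hy, rfl⟩
  · rintro ⟨b, hb, y, hy, rfl⟩
    exact ⟨⟨b, hb⟩, y, hy, rfl⟩

lemma add_pow_sub_mem_polyLT {i : Fin e} {β : 𝓔.E} (hβ : β ∈ 𝓔.stage i) (n : ℕ) :
    (𝓔.t i + β) ^ n - 𝓔.t i ^ n ∈ 𝓔.polyLT i n := by
  induction n with
  | zero => simp
  | succ n ih =>
    have : (𝓔.t i + β) ^ (n + 1) - 𝓔.t i ^ (n + 1) =
        𝓔.t i * ((𝓔.t i + β) ^ n - 𝓔.t i ^ n) + (β * ((𝓔.t i + β) ^ n - 𝓔.t i ^ n) +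
          β * 𝓔.t i ^ n) := by ring
    rw [this]
    exact add_mem (t_mul_mem_polyLT ih) (add_mem (polyLT_mono (Nat.le_succ n)
      (mul_mem_polyLT hβ ih)) (mul_mem_polyLT hβ (pow_mem_polyLT (Nat.lt_succ_self n))))

lemma IsAPS.shift_mem_polyLT (h : 𝓔.IsAPS σG) {i : Fin e} (hi : 𝓔.kind i = .S) {n : ℕ} {x : 𝓔.E}
    (hx : x ∈ 𝓔.polyLT i n) : 𝓔.σ x ∈ 𝓔.polyLT i n := by
  obtain ⟨β, hβ, hσ⟩ := h.kindS i hi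
  induction hx using Submodule.span_induction with
  | mem x hx =>
    obtain ⟨k, hk, rfl⟩ := hx
    rw [map_pow, hσ, ← sub_add_cancel ((𝓔.t i + β) ^ k) (𝓔.t i ^ k)]
    exact add_mem (polyLT_mono (le_of_lt hk) (add_pow_sub_mem_polyLT hβ k)) (pow_mem_polyLT hk)
  | zero => rw [map_zero]; exact zero_mem _
  | add x y _ _ hx hy => rw [map_add]; exact add_mem hx hy
  | smul a x _ hx =>
    rw [Subalgebra.smul_def, smul_eq_mul, map_mul]
    exact mul_mem_polyLT (h.shift_mem_stage a.2) hx

/-- The step for `S`-monomials. -/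
lemma isStageSimple_succ_of_sum (h : 𝓔.IsAPS σG) (hc : 𝓔.SameConstants σG)
    {i : Fin e} (hi : 𝓔.kind i = .S) (ih : 𝓔.IsStageSimple i) : 𝓔.IsStageSimple (i + 1) := by
  classical
  rintro J hJ ⟨x₀, hx₀, hx₀0⟩
  obtain ⟨β, hβ, hσ⟩ := h.kindS i hi
  have hle : 𝓔.stage i ≤ 𝓔.stage (i + 1) := stageOf_mono (Nat.le_succ _)
  -- Here the minimal choice concerns the degree in `t_i`.
  have hex : ∃ n : ℕ, ∃ x ∈ J, x ≠ 0 ∧ x ∈ 𝓔.polyLT i n := by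
    obtain ⟨S, c, h1, h2, h3⟩ := h.exists_expansion (hJ.le x₀ hx₀)
    refine ⟨S.sup Int.toNat + 1, x₀, hx₀, hx₀0, ?_⟩
    rw [h3]
    refine sum_mem fun k hk => mul_mem_polyLT (h2 k) ?_
    have hk0 : 0 ≤ k := by have := h1 k hk; rw [hi] at this; exact this
    obtain ⟨n, rfl⟩ := Int.eq_ofNat_of_zero_le hk0
    rw [intPow_natCast]
    exact pow_mem_polyLT (Nat.lt_succ_of_le (Finset.le_sup (f := Int.toNat) hk))
  have hmin : ∀ n < Nat.find hex, ∀ x ∈ J, x ∈ 𝓔.polyLT i n → x = 0 := by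
    intro n hn x hx hxn
    by_contra hx0
    exact Nat.find_min hex hn ⟨x, hx, hx0, hxn⟩
  obtain ⟨x, hx, hx0, hxn⟩ := Nat.find_spec hex
  cases hn : Nat.find hex with
  | zero =>
    rw [hn] at hxn
    exact absurd (by simpa [polyLT] using hxn) hx0
  | succ n =>
    rw [hn] at hxn hmin
    -- The possible coefficients of `t_i^n` in elements of `J` of degree at most `n`. The shift
    -- keeps the degree bound and shifts this coefficient, because `σ(t_i) = t_i + β`.
    let C : AddSubgroup 𝓔.E :=
      { carrier := {b | b ∈ 𝓔.stage i ∧ ∃ y ∈ 𝓔.polyLT i n, b * 𝓔.t i ^ n + y ∈ J}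
        zero_mem' := ⟨zero_mem _, 0, zero_mem _, by simp⟩
        add_mem' := by
          rintro b b' ⟨hb, y, hy, hJy⟩ ⟨hb', y', hy', hJy'⟩
          refine ⟨add_mem hb hb', y + y', add_mem hy hy', ?_⟩
          have := add_mem hJy hJy'
          convert this using 1
          ring
        neg_mem' := by
          rintro b ⟨hb, y, hy, hJy⟩
          refine ⟨neg_mem hb, -y, neg_mem hy, ?_⟩
          have := neg_mem hJy
          convert this using 1
          ring }
    have hC : 𝓔.IsShiftIdeal i C := by
      refine ⟨fun b hb => hb.1, ?_, ?_⟩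
      · rintro a ha b ⟨hb, y, hy, hJy⟩
        refine ⟨mul_mem ha hb, a * y, mul_mem_polyLT ha hy, ?_⟩
        have := hJ.mul_mem a (hle ha) _ hJy
        convert this using 1
        ring
      · rintro b ⟨hb, y, hy, hJy⟩
        have hσb := h.shift_mem_stage hb
        refine ⟨hσb, 𝓔.σ b * ((𝓔.t i + β) ^ n - 𝓔.t i ^ n) + 𝓔.σ y,
          add_mem (mul_mem_polyLT hσb (add_pow_sub_mem_polyLT hβ n)) (h.shift_mem_polyLT hi hy), ?_⟩
        have := hJ.shift_mem _ hJy
        rw [map_add, map_mul, map_pow, hσ] at this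
        convert this using 1
        ring
    obtain ⟨b, hb, y, hy, hxe⟩ := mem_polyLT_succ.mp hxn
    have hC0 : ∃ b ∈ C, b ≠ 0 := by
      refine ⟨b, ⟨hb, y, hy, hxe ▸ hx⟩, fun h0 => hx0 ?_⟩
      refine hmin n (Nat.lt_succ_self n) x hx ?_
      rwa [hxe, h0, zero_mul, zero_add]
    obtain ⟨_, y, hy, hJy⟩ := ih C hC hC0
    rw [one_mul] at hJy
    -- The element `t_i^n + y` of `J` is monic, so its difference with its shift has degree below
    -- `n` and vanishes by minimality. It is therefore a constant.
    have hdiff : 𝓔.σ (𝓔.t i ^ n + y) - (𝓔.t i ^ n + y) = 0 := by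
      refine hmin n (Nat.lt_succ_self n) _ (sub_mem (hJ.shift_mem _ hJy) hJy) ?_
      have : 𝓔.σ (𝓔.t i ^ n + y) - (𝓔.t i ^ n + y) =
          ((𝓔.t i + β) ^ n - 𝓔.t i ^ n) + (𝓔.σ y - y) := by
        rw [map_add, map_pow, hσ]; ring
      rw [this]
      exact add_mem (add_pow_sub_mem_polyLT hβ n) (sub_mem (h.shift_mem_polyLT hi hy) hy)
    have hmem : 𝓔.t i ^ n + y ∈ {c : 𝓔.E | 𝓔.σ c = c} := sub_eq_zero.mp hdiff
    rw [hc] at hmem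
    obtain ⟨κ, _, hκ⟩ := hmem
    -- A constant from the ground field that is monic of positive degree would express `t_i^n` by
    -- lower powers, against freeness. So `n = 0` and the element is `1`.
    rcases Nat.eq_zero_or_pos n with rfl | hpos
    · have hy0 : y = 0 := by simpa [polyLT] using hy
      rwa [hy0, pow_zero, add_zero] at hJy
    · exfalso
      have hnt : Nontrivial 𝓔.E := nontrivial_of_ne x 0 hx0
      have htn : 𝓔.t i ^ n ∈ 𝓔.polyLT i n := by
        have h1 : 𝓔.t i ^ n = algebraMap G 𝓔.E κ * 𝓔.t i ^ 0 - y := by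
          rw [hκ, pow_zero, mul_one, add_sub_cancel_right]
        rw [h1]
        exact sub_mem (mul_mem_polyLT (Subalgebra.algebraMap_mem _ _) (pow_mem_polyLT hpos)) hy
      have hmemexp : ∀ k : ℕ, (k : ℤ) ∈ (𝓔.kind i).exponents := fun k => by
        rw [hi]; exact Int.natCast_nonneg k
      have hnot := (h.free i).notMem_span_image
        (s := {k | ∃ k' : ℕ, k' < n ∧ (k : ℤ) = k'}) (x := ⟨n, hmemexp n⟩) (by
          rintro ⟨k', hk', he⟩
          have he' : (n : ℤ) = k' := he
          omega)
      refine hnot (Submodule.span_mono ?_ htn)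
      rintro _ ⟨k, hk, rfl⟩
      exact ⟨⟨k, hmemexp k⟩, ⟨k, hk, rfl⟩, rfl⟩

lemma isStageSimple (h : 𝓔.IsAPS σG) (hc : 𝓔.SameConstants σG) :
    ∀ n ≤ e, 𝓔.IsStageSimple n := by
  intro n
  induction n with
  | zero => exact fun _ => isStageSimple_zero
  | succ n ih =>
    intro hn
    let i : Fin e := ⟨n, hn⟩
    by_cases hi : 𝓔.kind i = .S
    · exact isStageSimple_succ_of_sum (i := i) h hc hi (ih (Nat.le_of_succ_le hn))
    · exact isStageSimple_succ_of_unit (i := i) h hc hi (ih (Nat.le_of_succ_le hn))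

/-- A ring homomorphism that is compatible with automorphisms on both sides is injective. -/
lemma injective_of_isRPiSigma (h : 𝓔.IsAPS σG) (hc : 𝓔.SameConstants σG) {R : Type*} [CommRing R]
    [Nontrivial R] (τ : R ≃+* R) (Φ : 𝓔.E →+* R) (hΦ : ∀ x, Φ (𝓔.σ x) = τ (Φ x)) :
    Function.Injective Φ := by
  rw [injective_iff_map_eq_zero]
  intro x hx
  by_contra hx0
  -- The kernel is a shift ideal; if it were nonzero it would contain `1`, which is impossible as
  -- the target is nontrivial.
  have h1 := isStageSimple h hc e le_rfl Φ.toAddMonoidHom.ker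
    ⟨fun x _ => by rw [h.stage_top]; trivial,
      fun a _ x hx => by
        rw [AddMonoidHom.mem_ker] at hx ⊢
        change Φ (a * x) = 0
        rw [map_mul, show Φ x = 0 from hx, mul_zero],
      fun x hx => by
        rw [AddMonoidHom.mem_ker] at hx ⊢
        change Φ (𝓔.σ x) = 0
        rw [hΦ, show Φ x = 0 from hx, map_zero]⟩ ⟨x, hx, hx0⟩
  have h2 : Φ 1 = 0 := h1
  rw [map_one] at h2
  exact one_ne_zero h2

end Tower

/-! ## Evaluation of a tower with given sums and products -/

section Models

variable {K₀ : Type u} [Field K₀] {d v e : ℕ} {𝓔 : Tower (GroundField K₀ d v) e}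
  {ev : 𝓔.E → ℕ → ConstField K₀ v} {L Z : 𝓔.E → ℕ} {l : Fin e → ℕ}

lemma IsInducedEvaluation.ev_zero (hev : IsInducedEvaluation 𝓔 ev L Z l) (n : ℕ) :
    ev 0 n = 0 := by
  rw [← map_zero (algebraMap (GroundField K₀ d v) 𝓔.E), hev.ev_base, groundEv_zero]

/-- Frees `ev_poly` from subtypes and from exact supports: vanishing coefficients are allowed,
because they evaluate to `0`. -/
lemma IsInducedEvaluation.ev_finset_sum (hev : IsInducedEvaluation 𝓔 ev L Z l) (i : Fin e)
    (S : Finset ℤ) (c : ℤ → 𝓔.E) (hS : ∀ k ∈ S, k ∈ (𝓔.kind i).exponents)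
    (hc : ∀ k ∈ S, c k ∈ 𝓔.stage i) (n : ℕ) :
    ev (∑ k ∈ S, c k * intPow (𝓔.t i) k) n = ∑ k ∈ S, ev (c k) n * intPow (ev (𝓔.t i) n) k := by
  classical
  let c' : (𝓔.kind i).exponents →₀ 𝓔.stage i := Finsupp.onFinset
    (S.subtype (· ∈ (𝓔.kind i).exponents))
    (fun k => if hk : (k : ℤ) ∈ S then ⟨c k, hc k hk⟩ else 0)
    (fun k hk => by
      rw [Finset.mem_subtype]
      by_contra h
      exact hk (dif_neg h))
  have hval : ∀ k : (𝓔.kind i).exponents, (k : ℤ) ∈ S → (c' k : 𝓔.E) = c k := fun k hk => by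
    rw [Finsupp.onFinset_apply, dif_pos hk]
  have hsub : c'.support ⊆ S.subtype (· ∈ (𝓔.kind i).exponents) := Finsupp.support_onFinset_subset
  have hzero : ∀ k ∉ c'.support, (c' k : 𝓔.E) = 0 := fun k hk => by
    rw [Finsupp.notMem_support_iff.mp hk]; rfl
  have h := hev.ev_poly i c' n
  rw [Finset.sum_subset hsub (fun k _ hk => by rw [hzero k hk, zero_mul]),
    Finset.sum_subset hsub (fun k _ hk => by rw [hzero k hk, hev.ev_zero, zero_mul])] at h
  rw [← Finset.sum_subtype_of_mem (fun k => c k * intPow (𝓔.t i) k) hS,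
    ← Finset.sum_subtype_of_mem (fun k => ev (c k) n * intPow (ev (𝓔.t i) n) k) hS]
  have e1 : ∑ k ∈ S.subtype (· ∈ (𝓔.kind i).exponents), c k * intPow (𝓔.t i) k =
      ∑ k ∈ S.subtype (· ∈ (𝓔.kind i).exponents), (c' k : 𝓔.E) * intPow (𝓔.t i) k :=
    Finset.sum_congr rfl fun k hk => by rw [hval k (Finset.mem_subtype.mp hk)]
  rw [e1, h]
  exact Finset.sum_congr rfl fun k hk => by
    rw [hval k (Finset.mem_subtype.mp hk), intPow_field]

/-- The evaluation of a sum of power products. -/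
lemma IsInducedEvaluation.ev_sum_powProd (hev : IsInducedEvaluation 𝓔 ev L Z l)
    (H : ∀ j, (𝓔.kind j).Holds (𝓔.t j)) (n : ℕ) : ∀ i ≤ e, ∀ {ι : Type} (s : Finset ι)
    (m : ι → Fin e → ℤ) (g : ι → GroundField K₀ d v), (∀ a ∈ s, IsExponent 𝓔.kind i (m a)) →
    Set.InjOn m s → ev (∑ a ∈ s, g a • powProd 𝓔.t (m a)) n =
      ∑ a ∈ s, groundEv K₀ d v (g a) n * powProd (fun j => ev (𝓔.t j) n) (m a) := by
  intro i
  induction i with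
  | zero =>
    intro _ ι s m g hm hinj
    have hz : ∀ b ∈ s, m b = 0 := fun b hb => by
      funext j
      by_contra h
      exact absurd ((hm b hb j).2 h) (by simp)
    rcases s.eq_empty_or_nonempty with rfl | ⟨a, ha⟩
    · rw [Finset.sum_empty, Finset.sum_empty, hev.ev_zero]
    · have hs : s = {a} := by
        ext b
        rw [Finset.mem_singleton]
        refine ⟨fun hb => hinj hb ha (by rw [hz b hb, hz a ha]), ?_⟩
        rintro rfl; exact ha
      rw [hs, Finset.sum_singleton, Finset.sum_singleton, hz a ha, powProd_zero, powProd_zero,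
        mul_one, ← Algebra.algebraMap_eq_smul_one, hev.ev_base]
  | succ p ih =>
    intro hp ι s m g hm hinj
    let i : Fin e := ⟨p, hp⟩
    have hm' : ∀ k, ∀ b ∈ s.filter fun b => m b i = k,
        IsExponent 𝓔.kind p (Function.update (m b) i 0) := fun k b hb =>
      IsExponent.update_zero (i := i) H (hm b (Finset.mem_filter.mp hb).1)
    -- Once the sum is collected by the exponent of `t_i`, the defining rule of `ev` applies, and
    -- the coefficients belong to the preceding stage.
    rw [sum_powProd_eq_fiberwise s m g i, hev.ev_finset_sum i _ _
      (by
        intro k hk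
        obtain ⟨b, hb, rfl⟩ := Finset.mem_image.mp hk
        exact (hm b hb i).1)
      (fun k _ => sum_powProd_mem_stageOf H (hm' k)),
      ← Finset.sum_fiberwise_of_maps_to
        (fun a ha => Finset.mem_image_of_mem (fun a => m a i) ha)]
    refine Finset.sum_congr rfl fun k _ => ?_
    rw [ih (Nat.le_of_succ_le hp) _ _ _ (hm' k) (injOn_update_zero hinj i k), Finset.sum_mul]
    refine Finset.sum_congr rfl fun a ha => ?_
    rw [powProd_eq_update _ (m a) i, (Finset.mem_filter.mp ha).2, mul_assoc]

lemma IsInducedEvaluation.ev_elemOf (hev : IsInducedEvaluation 𝓔 ev L Z l)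
    (H : ∀ j, (𝓔.kind j).Holds (𝓔.t j)) {Y : MonomialList (Fin e) (GroundField K₀ d v)}
    (hY : IsReducedList (KindAdmissible 𝓔.kind) Y) (n : ℕ) :
    ev (elemOf 𝓔.t Y) n = (Y.map fun s => groundEv K₀ d v s.1 n *
      powProd (fun j => ev (𝓔.t j) n) (exponentOf s.2)).sum := by
  rw [elemOf_eq_sum H fun s hs p hp => (hY.admissible s hs p hp).2,
    hev.ev_sum_powProd H n e le_rfl Finset.univ (fun a : Fin Y.length => exponentOf Y[a].2)
      (fun a => Y[a].1)
      (fun a _ => hY.isExponent (fun j => (H j).zero_mem_exponents) (List.getElem_mem _)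
        fun p _ => p.1.2) hY.injective_exponentOf.injOn]
  exact Fin.sum_univ_fun_getElem Y fun s => groundEv K₀ d v s.1 n *
      powProd (fun j => ev (𝓔.t j) n) (exponentOf s.2)

/-! ### Comparison of the monomials with the given terms. -/

variable {T : Fin e → SPTerm K₀ d v}

/-- The only case with content is an `A`-monomial: the image of `r` is the primitive `ν`th root of
unity `σ(t)/t`, so `ν` is the order of `r`. -/
lemma IsExprOf.kind_eq (hexpr : IsExprOf 𝓔 l T) (hAPS : 𝓔.IsAPS (groundShift K₀ d v))
    (j : Fin e) : 𝓔.kind j = kindOf (T j) := by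
  have h := hexpr j
  cases hk : 𝓔.kind j with
  | A ν =>
    rw [hk] at h
    obtain ⟨r, hr, hT, hσ⟩ := h
    obtain ⟨h1, h2, α, _, hprim, hσ'⟩ := hAPS.kindA j ν hk
    have hu : IsUnit (𝓔.t j) := IsUnit.of_pow_eq_one h2 (by omega)
    have hα := hu.mul_right_cancel (hσ.symm.trans hσ')
    have hinj : Function.Injective
        ((algebraMap (GroundField K₀ d v) 𝓔.E).comp (algebraMap (ConstField K₀ v) _)) :=
      hAPS.injective.comp (algebraMap (ConstField K₀ v) (GroundField K₀ d v)).injective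
    rw [← hα] at hprim
    have := IsPrimitiveRoot.of_map_of_injective (f := (algebraMap (GroundField K₀ d v) 𝓔.E).comp
      (algebraMap (ConstField K₀ v) _)) (ζ := r) hprim hinj
    rw [hT, kindOf, this.eq_orderOf]
  | P =>
    rw [hk] at h
    obtain ⟨F, _, hT⟩ := h
    rw [hT, kindOf]
  | S =>
    rw [hk] at h
    obtain ⟨F, _, hT⟩ := h
    rw [hT]
    rfl

/-- The indices in a list of monomials over `T` are bounded by the indices of its atoms. -/
lemma lt_of_atoms_subset (hinj : Function.Injective T) (hT : ∀ i, IsSigma (T i) ∨ IsPi (T i))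
    {Y : MonomialList (Fin e) (GroundField K₀ d v)} {i : Fin e}
    (h : (Term.ofMonomials (mapMonomials T Y)).atoms ⊆ {B | ∃ j < i, B = T j}) :
    ∀ s ∈ Y, ∀ p ∈ s.2, p.1 < i := by
  intro s hs p hp
  have h1 : (T p.1).atoms ⊆ (Term.ofMonomials (mapMonomials T Y)).atoms :=
    atoms_subset_ofMonomials (X := mapMonomials T Y)
      (t := (s.1, s.2.map fun p => (T p.1, p.2))) (List.mem_map_of_mem
        (f := fun s : GroundField K₀ d v × List (Fin e × ℤ) =>
          (s.1, s.2.map fun p => (T p.1, p.2))) hs)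
      (p := (T p.1, p.2)) (List.mem_map_of_mem (f := fun p : Fin e × ℤ => (T p.1, p.2)) hp)
  obtain ⟨j, hj, he⟩ := h (h1 (mem_atoms_self (hT p.1)))
  rwa [hinj he]

/-- Different sums and products in sum-product reduced form, each of which is built from the
preceding ones. -/
structure IsOrderedFamily (T : Fin e → SPTerm K₀ d v) : Prop where
  injective : Function.Injective T
  sigmaPi : ∀ i, IsSigma (T i) ∨ IsPi (T i)
  reduced : ∀ i, IsSumProductReduced (Term.single (T i))
  ordered : ∀ (i : Fin e) (l : ℕ) (A : SPTerm K₀ d v),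
    (T i = .sum l A ∨ T i = .prod l A) → A.atoms ⊆ {B | ∃ j < i, B = T j}

lemma IsOrderedFamily.lt_of_mem (hF : IsOrderedFamily T) {i : Fin e} {l : ℕ}
    {Y : MonomialList (Fin e) (GroundField K₀ d v)}
    (h : T i = .sum l (Term.ofMonomials (mapMonomials T Y)) ∨
      T i = .prod l (Term.ofMonomials (mapMonomials T Y))) :
    ∀ s ∈ Y, ∀ p ∈ s.2, p.1 < i :=
  lt_of_atoms_subset hF.injective hF.sigmaPi (hF.ordered i l _ h)

/-- Agreement is required only at `n` and only for the monomials that occur in `Y`, so that the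
lemma can be applied inside the induction along the tower. -/
lemma IsInducedEvaluation.ev_elemOf_eq_termValue (hev : IsInducedEvaluation 𝓔 ev L Z l)
    (hd : d ≤ 1) (hchar : d = 1 → CharZero K₀) (hF : IsOrderedFamily T)
    (hkind : ∀ j, 𝓔.kind j = kindOf (T j)) (H : ∀ j, (𝓔.kind j).Holds (𝓔.t j))
    {Y : MonomialList (Fin e) (GroundField K₀ d v)}
    (hY : IsReducedList (KindAdmissible 𝓔.kind) Y) (n : ℕ)
    (h : ∀ s ∈ Y, ∀ p ∈ s.2, ev (𝓔.t p.1) n = termValue (T p.1) n) :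
    ev (elemOf 𝓔.t Y) n = termValue (Term.ofMonomials (mapMonomials T Y)) n := by
  rw [hev.ev_elemOf H hY, termValue_ofMonomials hd hchar hF.sigmaPi fun s hs p hp => by
    rw [← hkind]; exact (hY.admissible s hs p hp).2]
  congr 1
  refine List.map_congr_left fun s hs => ?_
  congr 1
  exact powProd_congr fun j hj =>
    h s hs _ (exists_mem_of_exponentOf_ne_zero (hY.nodup s hs) hj)

lemma IsExprOf.exists_rpow (hexpr : IsExprOf 𝓔 l T) {i : Fin e} {ν : ℕ} (hk : 𝓔.kind i = .A ν) :
    ∃ r : ConstField K₀ v, IsNontrivialRootOfUnity r ∧ T i = .rpow r ∧ 𝓔.σ (𝓔.t i) =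
      algebraMap (GroundField K₀ d v) 𝓔.E (algebraMap _ (GroundField K₀ d v) r) * 𝓔.t i := by
  have h := hexpr i
  rwa [hk] at h

lemma IsExprOf.exists_prod (hexpr : IsExprOf 𝓔 l T) {i : Fin e} (hk : 𝓔.kind i = .P) :
    ∃ Y, IsReducedList (KindAdmissible 𝓔.kind) Y ∧
      𝓔.σ.symm (𝓔.quotient i) = elemOf 𝓔.t Y ∧
      T i = .prod (l i) (Term.ofMonomials (mapMonomials T Y)) := by
  have h := hexpr i
  rw [hk] at h
  obtain ⟨F, ⟨Y, hY, h1, rfl⟩, h2⟩ := h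
  exact ⟨Y, hY, h1, h2⟩

lemma IsExprOf.exists_sum (hexpr : IsExprOf 𝓔 l T) {i : Fin e} (hk : 𝓔.kind i = .S) :
    ∃ Y, IsReducedList (KindAdmissible 𝓔.kind) Y ∧
      𝓔.σ.symm (𝓔.difference i) = elemOf 𝓔.t Y ∧
      T i = .sum (l i) (Term.ofMonomials (mapMonomials T Y)) := by
  have h := hexpr i
  rw [hk] at h
  obtain ⟨F, ⟨Y, hY, h1, rfl⟩, h2⟩ := h
  exact ⟨Y, hY, h1, h2⟩

/-- The monomials evaluate to the given sums and products. -/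
lemma IsExprOf.ev_t_eq_termValue (hexpr : IsExprOf 𝓔 l T) (hd : d ≤ 1)
    (hchar : d = 1 → CharZero K₀) (hF : IsOrderedFamily T)
    (hev : IsInducedEvaluation 𝓔 ev L Z l) (hAPS : 𝓔.IsAPS (groundShift K₀ d v)) (i : Fin e) :
    ∀ n, ev (𝓔.t i) n = termValue (T i) n := by
  have hkind := hexpr.kind_eq hAPS
  have H := hAPS.holds
  -- Summands and multiplicands involve earlier monomials only.
  induction i using WellFoundedLT.induction with
  | _ i ih =>
    intro n
    cases hk : 𝓔.kind i with
    | A ν =>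
      obtain ⟨r, hr, hTi, hσ⟩ := hexpr.exists_rpow hk
      obtain ⟨h1, h2⟩ := hev.kindA i ν hk
      have hq : 𝓔.σ.symm (𝓔.quotient i) = algebraMap (GroundField K₀ d v) 𝓔.E
          (algebraMap _ (GroundField K₀ d v) r) := by
        rw [RingEquiv.symm_apply_eq, hAPS.shift_base, groundShift_const, Tower.quotient, hσ,
          mul_assoc, Ring.mul_inverse_cancel _ ((H i).isUnit (by simp [hk])), mul_one]
      rw [h2 n, hTi, h1, hq]
      exact Finset.prod_congr rfl fun k _ => by rw [hev.ev_base, groundEv_const]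
    | P =>
      obtain ⟨Y, hY, h1, h2⟩ := hexpr.exists_prod hk
      rw [(hev.kindP i hk).2 n, h1]
      conv_rhs => rw [h2]
      refine Finset.prod_congr rfl fun k _ => ?_
      exact hev.ev_elemOf_eq_termValue hd hchar hF hkind H hY k fun s hs p hp =>
        ih p.1 (hF.lt_of_mem (Or.inr h2) s hs p hp) k
    | S =>
      obtain ⟨Y, hY, h1, h2⟩ := hexpr.exists_sum hk
      rw [(hev.kindS i hk).2 n, h1]
      conv_rhs => rw [h2]
      refine Finset.sum_congr rfl fun k _ => ?_
      exact hev.ev_elemOf_eq_termValue hd hchar hF hkind H hY k fun s hs p hp =>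
        ih p.1 (hF.lt_of_mem (Or.inl h2) s hs p hp) k

lemma toGerm_ev_sum_powProd (hexpr : IsExprOf 𝓔 l T) (hd : d ≤ 1)
    (hchar : d = 1 → CharZero K₀) (hF : IsOrderedFamily T)
    (hev : IsInducedEvaluation 𝓔 ev L Z l) (hAPS : 𝓔.IsAPS (groundShift K₀ d v))
    {ι : Type} (s : Finset ι) (m : ι → Fin e → ℤ) (g : ι → GroundField K₀ d v)
    (hm : ∀ a ∈ s, IsExponent 𝓔.kind e (m a)) (hinj : Set.InjOn m s) :
    toGerm (ev (∑ a ∈ s, g a • powProd 𝓔.t (m a))) =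
      ∑ a ∈ s, groundGerm K₀ hd hchar (g a) *
        powProd (fun j => toGerm (termValue (T j))) (m a) := by
  have h1 : ev (∑ a ∈ s, g a • powProd 𝓔.t (m a)) = fun n =>
      ∑ a ∈ s, groundEv K₀ d v (g a) n * powProd (fun j => termValue (T j) n) (m a) := by
    funext n
    rw [hev.ev_sum_powProd hAPS.holds n e le_rfl s m g hm hinj]
    simp only [hexpr.ev_t_eq_termValue hd hchar hF hev hAPS]
  rw [h1, toGerm_sum]
  refine Finset.sum_congr rfl fun a ha => ?_
  rw [toGerm_mul, toGerm_powProd hd hchar hF.sigmaPi fun j => ?_, groundGerm_apply]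
  rw [← hexpr.kind_eq hAPS]
  exact (hm a ha).domain j

lemma toGerm_ev_linearCombination (hexpr : IsExprOf 𝓔 l T) (hd : d ≤ 1)
    (hchar : d = 1 → CharZero K₀) (hF : IsOrderedFamily T)
    (hev : IsInducedEvaluation 𝓔 ev L Z l) (hAPS : 𝓔.IsAPS (groundShift K₀ d v))
    (s : Finset (Fin e → ℤ)) (g : (Fin e → ℤ) → GroundField K₀ d v)
    (hm : ∀ m ∈ s, IsExponent 𝓔.kind e m) :
    toGerm (ev (∑ m ∈ s, g m • powProd 𝓔.t m)) =
      ∑ m ∈ s, groundGerm K₀ hd hchar (g m) *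
        powProd (fun j => toGerm (termValue (T j))) m :=
  toGerm_ev_sum_powProd hexpr hd hchar hF hev hAPS s id g hm Function.injective_id.injOn

/-- Extends the evaluation to exponents outside the admissible range, as they arise in a product of
two basis elements; reduction modulo the orders changes neither side. -/
lemma toGerm_ev_smul_powProd (hexpr : IsExprOf 𝓔 l T) (hd : d ≤ 1)
    (hchar : d = 1 → CharZero K₀) (hF : IsOrderedFamily T)
    (hev : IsInducedEvaluation 𝓔 ev L Z l) (hAPS : 𝓔.IsAPS (groundShift K₀ d v))
    (g : GroundField K₀ d v) {m : Fin e → ℤ} (hm : ∀ j, m j ∈ (𝓔.kind j).domain) :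
    toGerm (ev (g • powProd 𝓔.t m)) = groundGerm K₀ hd hchar g *
      powProd (fun j => toGerm (termValue (T j))) m := by
  have H := hAPS.holds
  have H' : ∀ j, (𝓔.kind j).Holds (toGerm (termValue (T j))) := fun j => by
    rw [hexpr.kind_eq hAPS]; exact termValue_holds_germ hd hchar (hF.sigmaPi j)
  rw [← powProd_reduce H, ← powProd_reduce H']
  have := toGerm_ev_linearCombination hexpr hd hchar hF hev hAPS
    {fun j => (𝓔.kind j).reduce (m j)} (fun _ => g) (fun m' hm' => by
      rw [Finset.mem_singleton.mp hm']
      exact fun j => ⟨(H j).reduce_mem (hm j), fun _ => j.2⟩)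
  rwa [Finset.sum_singleton, Finset.sum_singleton] at this

/-- The evaluation as a homomorphism into the ring of germs of sequences. -/
lemma exists_evaluation_ringHom (hexpr : IsExprOf 𝓔 l T) (hd : d ≤ 1)
    (hchar : d = 1 → CharZero K₀) (hF : IsOrderedFamily T)
    (hev : IsInducedEvaluation 𝓔 ev L Z l) (hAPS : 𝓔.IsAPS (groundShift K₀ d v)) :
    ∃ Φ : 𝓔.E →+* SeqGerm K₀ v, ∀ x, Φ x = toGerm (ev x) := by
  classical
  have H := hAPS.holds
  have hrep : ∀ x : 𝓔.E, ∃ g : (Fin e → ℤ) →₀ GroundField K₀ d v,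
      (∀ m ∈ g.support, IsExponent 𝓔.kind e m) ∧ x = ∑ m ∈ g.support, g m • powProd 𝓔.t m :=
    fun x => exists_sum_of_mem_stageOf H (by
      change x ∈ 𝓔.stage e
      rw [hAPS.stage_top]; trivial)
  -- Values at poles are set to `0`, so additivity is claimed for germs only. Both elements are
  -- expanded over a common support.
  have hadd : ∀ x y, toGerm (ev (x + y)) = toGerm (ev x) + toGerm (ev y) := by
    intro x y
    obtain ⟨g, hg, rfl⟩ := hrep x
    obtain ⟨g', hg', rfl⟩ := hrep y
    have e1 : ∑ m ∈ g.support, g m • powProd 𝓔.t m =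
        ∑ m ∈ g.support ∪ g'.support, g m • powProd 𝓔.t m :=
      Finset.sum_subset Finset.subset_union_left fun m _ hm => by
        rw [Finsupp.notMem_support_iff.mp hm, zero_smul]
    have e2 : ∑ m ∈ g'.support, g' m • powProd 𝓔.t m =
        ∑ m ∈ g.support ∪ g'.support, g' m • powProd 𝓔.t m :=
      Finset.sum_subset Finset.subset_union_right fun m _ hm => by
        rw [Finsupp.notMem_support_iff.mp hm, zero_smul]
    have hm : ∀ m ∈ g.support ∪ g'.support, IsExponent 𝓔.kind e m := fun m hm =>
      (Finset.mem_union.mp hm).elim (hg m) (hg' m)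
    have e3 : ∑ m ∈ g.support ∪ g'.support, g m • powProd 𝓔.t m +
        ∑ m ∈ g.support ∪ g'.support, g' m • powProd 𝓔.t m =
        ∑ m ∈ g.support ∪ g'.support, (g m + g' m) • powProd 𝓔.t m := by
      rw [← Finset.sum_add_distrib]
      exact Finset.sum_congr rfl fun m _ => (add_smul _ _ _).symm
    rw [e1, e2, e3, toGerm_ev_linearCombination hexpr hd hchar hF hev hAPS _ _ hm,
      toGerm_ev_linearCombination hexpr hd hchar hF hev hAPS _ _ hm,
      toGerm_ev_linearCombination hexpr hd hchar hF hev hAPS _ _ hm, ← Finset.sum_add_distrib]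
    exact Finset.sum_congr rfl fun m _ => by rw [map_add, add_mul]
  let Ψ : 𝓔.E →+ SeqGerm K₀ v := AddMonoidHom.mk' (fun x => toGerm (ev x)) hadd
  have hΨ : ∀ (g : GroundField K₀ d v) (m : Fin e → ℤ), (∀ j, m j ∈ (𝓔.kind j).domain) →
      Ψ (g • powProd 𝓔.t m) = groundGerm K₀ hd hchar g *
        powProd (fun j => toGerm (termValue (T j))) m := fun g m hm =>
    toGerm_ev_smul_powProd hexpr hd hchar hF hev hAPS g hm
  have H' : ∀ j, (𝓔.kind j).Holds (toGerm (termValue (T j))) := fun j => by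
    rw [hexpr.kind_eq hAPS]; exact termValue_holds_germ hd hchar (hF.sigmaPi j)
  refine ⟨⟨⟨⟨Ψ, ?_⟩, ?_⟩, Ψ.map_zero, Ψ.map_add⟩, fun x => rfl⟩
  · have := hΨ 1 0 fun j => MonomialKind.zero_mem_domain _
    rwa [powProd_zero, powProd_zero, one_smul, (groundGerm K₀ hd hchar).map_one, mul_one] at this
  -- By biadditivity it suffices to multiply two terms of the expansions, where exponents add.
  · intro x y
    obtain ⟨g, hg, rfl⟩ := hrep x
    obtain ⟨g', hg', rfl⟩ := hrep y
    change Ψ (_ * _) = Ψ _ * Ψ _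
    rw [Finset.sum_mul_sum, map_sum, map_sum, map_sum, Finset.sum_mul_sum]
    refine Finset.sum_congr rfl fun m hm => ?_
    rw [map_sum]
    refine Finset.sum_congr rfl fun m' hm' => ?_
    have h1 := (hg m hm).domain
    have h2 := (hg' m' hm').domain
    rw [smul_mul_smul_comm, ← powProd_add H h1 h2,
      hΨ _ (m + m') (fun j => MonomialKind.add_mem_domain (h1 j) (h2 j)), hΨ _ _ h1, hΨ _ _ h2,
      powProd_add H' h1 h2, map_mul]
    ring

lemma toGerm_ev_elemOf (hexpr : IsExprOf 𝓔 l T) (hd : d ≤ 1)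
    (hchar : d = 1 → CharZero K₀) (hF : IsOrderedFamily T)
    (hev : IsInducedEvaluation 𝓔 ev L Z l) (hAPS : 𝓔.IsAPS (groundShift K₀ d v))
    {Y : MonomialList (Fin e) (GroundField K₀ d v)}
    (hY : IsReducedList (KindAdmissible 𝓔.kind) Y) :
    toGerm (ev (elemOf 𝓔.t Y)) = toGerm (termValue (Term.ofMonomials (mapMonomials T Y))) := by
  congr 1
  funext n
  exact hev.ev_elemOf_eq_termValue hd hchar hF (hexpr.kind_eq hAPS) hAPS.holds hY n
    fun s _ p _ => hexpr.ev_t_eq_termValue hd hchar hF hev hAPS p.1 n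

/-- Shifting before or after evaluation gives two ring homomorphisms, which are compared on
generators. For `t_j` the recurrence of `T_j` requires the claim for its summand or multiplicand, an
element of stage `j`; hence the strong induction. -/
lemma evaluation_shift (hexpr : IsExprOf 𝓔 l T) (hd : d ≤ 1)
    (hchar : d = 1 → CharZero K₀) (hF : IsOrderedFamily T)
    (hev : IsInducedEvaluation 𝓔 ev L Z l) (hAPS : 𝓔.IsAPS (groundShift K₀ d v))
    (Φ : 𝓔.E →+* SeqGerm K₀ v) (hΦ : ∀ x, Φ x = toGerm (ev x)) :
    ∀ i, ∀ x ∈ 𝓔.stage i, Φ (𝓔.σ x) = germShift K₀ v (Φ x) := by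
  have H := hAPS.holds
  have hbase : ∀ g, Φ (algebraMap _ 𝓔.E g) = groundGerm K₀ hd hchar g := fun g => by
    rw [hΦ, groundGerm_apply]; congr 1; funext n; exact hev.ev_base g n
  have ht : ∀ j, Φ (𝓔.t j) = toGerm (termValue (T j)) := fun j => by
    rw [hΦ]; congr 1; funext n; exact hexpr.ev_t_eq_termValue hd hchar hF hev hAPS j n
  intro i
  induction i using Nat.strong_induction_on with
  | _ i ih =>
    refine ringHom_eqOn_stageOf H (f := Φ.comp (𝓔.σ : 𝓔.E →+* 𝓔.E))
      (f' := (germShift K₀ v : SeqGerm K₀ v →+* SeqGerm K₀ v).comp Φ) (fun g => ?_)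
      fun j hj => ?_
    · change Φ (𝓔.σ _) = germShift K₀ v (Φ _)
      rw [hAPS.shift_base, hbase, hbase, germShift_groundGerm]
    · change Φ (𝓔.σ _) = germShift K₀ v (Φ _)
      cases hk : 𝓔.kind j with
      | A ν =>
        obtain ⟨r, hr, hTj, hσ⟩ := hexpr.exists_rpow hk
        rw [hσ, map_mul, hbase, groundGerm_const, ht, hTj, germShift_rpow_term]
      | P =>
        obtain ⟨Y, hY, h1, h2⟩ := hexpr.exists_prod hk
        have hmem : elemOf 𝓔.t Y ∈ 𝓔.stage j := elemOf_mem_stageOf H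
          (fun s hs p hp => (hY.admissible s hs p hp).2)
          fun s hs p hp => hF.lt_of_mem (Or.inr h2) s hs p hp
        have hσ : 𝓔.σ (𝓔.t j) = 𝓔.σ (elemOf 𝓔.t Y) * 𝓔.t j := by
          rw [← h1, RingEquiv.apply_symm_apply, Tower.quotient, mul_assoc,
            Ring.inverse_mul_cancel _ ((H j).isUnit (by simp [hk])), mul_one]
        rw [hσ, map_mul, ih j hj _ hmem, hΦ (elemOf _ _),
          toGerm_ev_elemOf hexpr hd hchar hF hev hAPS hY, ht, h2, germShift_prod_term]
      | S =>
        obtain ⟨Y, hY, h1, h2⟩ := hexpr.exists_sum hk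
        have hmem : elemOf 𝓔.t Y ∈ 𝓔.stage j := elemOf_mem_stageOf H
          (fun s hs p hp => (hY.admissible s hs p hp).2)
          fun s hs p hp => hF.lt_of_mem (Or.inl h2) s hs p hp
        have hσ : 𝓔.σ (𝓔.t j) = 𝓔.t j + 𝓔.σ (elemOf 𝓔.t Y) := by
          rw [← h1, RingEquiv.apply_symm_apply, Tower.difference, add_sub_cancel]
        rw [hσ, map_add, ih j hj _ hmem, hΦ (elemOf _ _),
          toGerm_ev_elemOf hexpr hd hchar hF hev hAPS hY, ht, h2, germShift_sum_term]

lemma isReducedList_iff (hF : IsOrderedFamily T) {kind : Fin e → MonomialKind}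
    (hkind : ∀ j, kind j = kindOf (T j)) {Y : MonomialList (Fin e) (GroundField K₀ d v)} :
    IsReducedList AdmissiblePower (mapMonomials T Y) ↔ IsReducedList (KindAdmissible kind) Y :=
  isReducedList_mapMonomials hF.injective fun j z => by
    rw [admissiblePower_iff (hF.sigmaPi j), ← hkind]; rfl

lemma exists_list_of_mem_sumProdOver (hF : IsOrderedFamily T) {kind : Fin e → MonomialKind}
    (hkind : ∀ j, kind j = kindOf (T j)) {A : SPTerm K₀ d v}
    (hA : A ∈ SumProdOver (Set.range T)) : ∃ Y, IsReducedList (KindAdmissible kind) Y ∧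
      A = Term.ofMonomials (mapMonomials T Y) := by
  obtain ⟨_, X, ⟨hX, rfl⟩, hrange⟩ := hA
  obtain ⟨Y, rfl⟩ := exists_eq_mapMonomials hrange
  exact ⟨Y, (isReducedList_iff hF hkind).mp hX, rfl⟩

/-- A family which is modelled by an `RΠΣ`-extension is `σ`-reduced. -/
theorem isSigmaReduced_of_tower (hd : d ≤ 1) (hchar : d = 1 → CharZero K₀)
    (hF : IsOrderedFamily T) (hR : 𝓔.IsRPiSigma (groundShift K₀ d v)) (hM : ModelsFamily 𝓔 T) :
    IsSigmaReduced (Set.range T) := by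
  obtain ⟨ev, L, Z, l, hev, hexpr⟩ := hM
  obtain ⟨hAPS, hconst⟩ := hR
  have H := hAPS.holds
  obtain ⟨Φ, hΦ⟩ := exists_evaluation_ringHom hexpr hd hchar hF hev hAPS
  have hinj : Function.Injective Φ :=
    Tower.injective_of_isRPiSigma hAPS hconst (germShift K₀ v) Φ fun x =>
      evaluation_shift hexpr hd hchar hF hev hAPS Φ hΦ e x (by rw [hAPS.stage_top]; trivial)
  have hnt : Nontrivial 𝓔.E := hAPS.injective.nontrivial
  refine ⟨?_, ?_, ?_, ?_⟩
  · rintro _ ⟨i, rfl⟩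
    exact hF.sigmaPi i
  · intro A hA B hB hAB
    obtain ⟨Y, hY, rfl⟩ := exists_list_of_mem_sumProdOver hF (hexpr.kind_eq hAPS) hA
    obtain ⟨Y', hY', rfl⟩ := exists_list_of_mem_sumProdOver hF (hexpr.kind_eq hAPS) hB
    -- Ultimately equal values are equal germs, and `Φ` is injective.
    have h1 : elemOf 𝓔.t Y = elemOf 𝓔.t Y' := by
      apply hinj
      rw [hΦ, hΦ, toGerm_ev_elemOf hexpr hd hchar hF hev hAPS hY,
        toGerm_ev_elemOf hexpr hd hchar hF hev hAPS hY', toGerm_eq_iff]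
      exact hAB
    exact operandPerm_ofMonomials hY hY' (perm_of_elemOf_eq H
      (powProdIndependent_of_free H hAPS.free e le_rfl) hY hY' h1)
  · rintro l A (⟨i, hi⟩ | ⟨i, hi⟩) B hB
    · obtain ⟨j, _, rfl⟩ := hF.ordered i l A (Or.inl hi) hB
      exact ⟨j, rfl⟩
    · obtain ⟨j, _, rfl⟩ := hF.ordered i l A (Or.inr hi) hB
      exact ⟨j, rfl⟩
  · rintro _ ⟨i, rfl⟩
    exact hF.reduced i

end Models

/-! ## The structure of the summands and multiplicands -/

section Body

variable {K₀ : Type u} [Field K₀] {d v e : ℕ} {T : Fin e → SPTerm K₀ d v}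

/-- The lower bound of a sum or product. -/
def lowerBound : SPTerm K₀ d v → ℕ
  | .sum l _ => l
  | .prod l _ => l
  | .rpow _ => 1
  | _ => 0

/-- Collects what the tower needs from the sum-product reduced form: indices in place of terms, all
below `i`, and the bounds from which `L ≤ l` will follow. A factor `RPow(r)` has lower bound `1` and
so contributes `0`. -/
lemma IsOrderedFamily.exists_body (hF : IsOrderedFamily T) {i : Fin e} {l : ℕ}
    {A : SPTerm K₀ d v} (h : T i = .sum l A ∨ T i = .prod l A) :
    ∃ Y : MonomialList (Fin e) (GroundField K₀ d v),
      IsReducedList (KindAdmissible fun j => kindOf (T j)) Y ∧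
      A = Term.ofMonomials (mapMonomials T Y) ∧ (∀ s ∈ Y, groundL K₀ d v s.1 ≤ l) ∧
      ∀ s ∈ Y, ∀ p ∈ s.2, p.1 < i ∧ T p.1 ∈ A.atoms ∧ lowerBound (T p.1) - 1 ≤ l := by
  have hmem : Term.sum l A ∈ (Term.single (T i)).allAtoms ∨
      Term.prod l A ∈ (Term.single (T i)).allAtoms := by
    rcases h with h | h
    · left; rw [h]; simp [Term.single, Term.allAtoms]
    · right; rw [h]; simp [Term.single, Term.allAtoms]
  obtain ⟨_, ⟨X, ⟨hX, rfl⟩, hL⟩, hbound⟩ := (hF.reduced i).2 l A hmem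
  have hrange : ∀ t ∈ X, ∀ p ∈ t.2, p.1 ∈ Set.range T := by
    intro t ht p hp
    obtain ⟨j, _, hj⟩ := hF.ordered i l _ h (atoms_subset_ofMonomials ht hp
      (mem_atoms_self (hX.admissible t ht p hp).isSigma_or_isPi))
    exact ⟨j, hj.symm⟩
  obtain ⟨Y, rfl⟩ := exists_eq_mapMonomials hrange
  refine ⟨Y, (isReducedList_iff hF fun _ => rfl).mp hX, rfl, fun s hs => ?_, fun s hs p hp => ?_⟩
  · exact hL (s.1, s.2.map fun p => (T p.1, p.2)) (List.mem_map_of_mem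
      (f := fun s : GroundField K₀ d v × List (Fin e × ℤ) =>
        (s.1, s.2.map fun p => (T p.1, p.2))) hs)
  · have hat : T p.1 ∈ (Term.ofMonomials (mapMonomials T Y)).atoms :=
      atoms_subset_ofMonomials (X := mapMonomials T Y)
        (t := (s.1, s.2.map fun p => (T p.1, p.2))) (List.mem_map_of_mem
          (f := fun s : GroundField K₀ d v × List (Fin e × ℤ) =>
            (s.1, s.2.map fun p => (T p.1, p.2))) hs)
        (p := (T p.1, p.2)) (List.mem_map_of_mem (f := fun p : Fin e × ℤ => (T p.1, p.2)) hp)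
        (mem_atoms_self (hF.sigmaPi p.1))
    refine ⟨hF.lt_of_mem h s hs p hp, hat, ?_⟩
    have hall := atoms_subset_allAtoms _ hat
    cases hc : T p.1 with
    | sum l' B =>
      rw [hc] at hall
      exact le_trans (Nat.sub_le _ _) (hbound l' B (Or.inl hall))
    | prod l' B =>
      rw [hc] at hall
      exact le_trans (Nat.sub_le _ _) (hbound l' B (Or.inr hall))
    | rpow r => exact Nat.zero_le _
    | base g => exact Nat.zero_le _
    | pow a z => exact Nat.zero_le _
    | add a b => exact Nat.zero_le _
    | mul a b => exact Nat.zero_le _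

/-- The multiplicand of a product is a single monomial without sums. -/
lemma IsOrderedFamily.exists_multiplicand (hF : IsOrderedFamily T) {i : Fin e} {l : ℕ}
    {A : SPTerm K₀ d v} (h : T i = .prod l A)
    {Y : MonomialList (Fin e) (GroundField K₀ d v)}
    (hY : A = Term.ofMonomials (mapMonomials T Y))
    (hat : ∀ s ∈ Y, ∀ p ∈ s.2, T p.1 ∈ A.atoms) :
    ∃ f ps, Y = [(f, ps)] ∧ f ≠ 0 ∧ groundZ K₀ d v f ≤ l ∧ ∀ p ∈ ps, kindOf (T p.1) ≠ .S := by
  rcases hF.sigmaPi i with ⟨l', f, _, h'⟩ | ⟨r, _, h'⟩ | ⟨l', f, p, hp, hf, hl, h'⟩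
  · rw [h] at h'; cases h'
  · rw [h] at h'; cases h'
  · rw [h] at h'
    cases h'
    -- The multiplicand has the shape `f ⊙ p`. The empty list yields the term `0`, and two or more
    -- monomials have an outermost `⊕`, so exactly one monomial is possible.
    rcases Y with _ | ⟨s, _ | ⟨s', Y⟩⟩
    · cases hY
    · obtain ⟨g, ps⟩ := s
      simp only [Term.ofMonomials, mapMonomials, List.map_cons, List.map_nil, Term.addList,
        List.foldl_nil, Term.mul.injEq, Term.base.injEq] at hY
      obtain ⟨rfl, hY⟩ := hY
      refine ⟨f, ps, rfl, hf, hl, fun q hq hS => ?_⟩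
      obtain ⟨l', B, hB⟩ := (kindOf_eq_S_iff (hF.sigmaPi q.1)).mp hS
      have h1 := hat _ List.mem_cons_self q hq
      rw [hB] at h1
      rcases h1 with h1 | h1
      · exact h1
      · exact hp.sum_notMem_atoms l' B h1
    · have : ∀ (Z : List (SPTerm K₀ d v)) (a b x y : SPTerm K₀ d v),
          Z.foldl Term.add (Term.add a b) ≠ Term.mul x y := by
        intro Z
        induction Z with
        | nil => intro a b x y h; cases h
        | cons z Z ih => intro a b x y h; exact ih _ _ _ _ h
      exact absurd hY.symm (this _ _ _ _ _)

end Body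

/-! ## Groups of power products -/

section PowerGroup

variable {G : Type*} [Field G] {R : Type*} [CommRing R] [Algebra G R] {e : ℕ}

variable (G) in
/-- Elements `h t_1^{m_1} ⋯ t_{i-1}^{m_{i-1}}` with `h ≠ 0` and `m_j = 0` unless `Q j`. -/
def InPowerGroup (t : Fin e → R) (Q : Fin e → Prop) (i : Fin e) (x : R) : Prop :=
  ∃ (h : G) (m : Fin e → ℤ), h ≠ 0 ∧ (∀ j, m j ≠ 0 → j < i ∧ Q j) ∧
    x = algebraMap G R h * powProd t m

variable {kind : Fin e → MonomialKind} {t : Fin e → R} {Q : Fin e → Prop} {i : Fin e}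

lemma domain_of_imp (hQ : ∀ j, Q j → kind j ≠ .S) {m : Fin e → ℤ}
    (hm : ∀ j, m j ≠ 0 → j < i ∧ Q j) (j : Fin e) : m j ∈ (kind j).domain := by
  by_cases h : m j = 0
  · rw [h]; exact MonomialKind.zero_mem_domain _
  · exact MonomialKind.domain_of_ne (hQ j (hm j h).2) _

lemma InPowerGroup.algebraMap {h : G} (hh : h ≠ 0) :
    InPowerGroup G t Q i (algebraMap G R h) :=
  ⟨h, 0, hh, fun _ h0 => absurd rfl h0, by rw [powProd_zero, mul_one]⟩

lemma InPowerGroup.mul (H : ∀ j, (kind j).Holds (t j)) (hQ : ∀ j, Q j → kind j ≠ .S) {x y : R}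
    (hx : InPowerGroup G t Q i x) (hy : InPowerGroup G t Q i y) :
    InPowerGroup G t Q i (x * y) := by
  obtain ⟨h, m, hh, hm, rfl⟩ := hx
  obtain ⟨h', m', hh', hm', rfl⟩ := hy
  refine ⟨h * h', m + m', mul_ne_zero hh hh', fun j hj => ?_, ?_⟩
  · by_cases h0 : m j = 0
    · exact hm' j (by rwa [Pi.add_apply, h0, zero_add] at hj)
    · exact hm j h0
  · rw [powProd_add H (domain_of_imp hQ hm) (domain_of_imp hQ hm'), map_mul]
    ring

lemma InPowerGroup.exists_inv (H : ∀ j, (kind j).Holds (t j)) (hQ : ∀ j, Q j → kind j ≠ .S)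
    {x : R} (hx : InPowerGroup G t Q i x) : ∃ y, InPowerGroup G t Q i y ∧ x * y = 1 := by
  obtain ⟨h, m, hh, hm, rfl⟩ := hx
  have hm' : ∀ j, (-m) j ≠ 0 → j < i ∧ Q j := fun j hj => hm j (by simpa using hj)
  refine ⟨_, ⟨h⁻¹, -m, inv_ne_zero hh, hm', rfl⟩, ?_⟩
  rw [mul_mul_mul_comm, ← map_mul, mul_inv_cancel₀ hh, map_one, one_mul,
    ← powProd_add H (domain_of_imp hQ hm) (domain_of_imp hQ hm'), add_neg_cancel, powProd_zero]

lemma InPowerGroup.isUnit (H : ∀ j, (kind j).Holds (t j)) (hQ : ∀ j, Q j → kind j ≠ .S)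
    {x : R} (hx : InPowerGroup G t Q i x) : IsUnit x := by
  obtain ⟨y, _, h⟩ := hx.exists_inv H hQ
  exact IsUnit.of_mul_eq_one y h

lemma InPowerGroup.intPow (H : ∀ j, (kind j).Holds (t j)) (hQ : ∀ j, Q j → kind j ≠ .S)
    {x : R} (hx : InPowerGroup G t Q i x) (z : ℤ) : InPowerGroup G t Q i (intPow x z) := by
  have hone : InPowerGroup G t Q i (1 : R) := by
    have := InPowerGroup.algebraMap (t := t) (Q := Q) (i := i) (one_ne_zero (α := G))
    rwa [map_one] at this
  have hpow : ∀ {x : R}, InPowerGroup G t Q i x → ∀ n : ℕ, InPowerGroup G t Q i (x ^ n) := by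
    intro x hx n
    induction n with
    | zero => rwa [pow_zero]
    | succ n ih => rw [pow_succ]; exact ih.mul H hQ hx
  cases z with
  | ofNat n => exact hpow hx n
  | negSucc n =>
    obtain ⟨y, hy, hxy⟩ := hx.exists_inv H hQ
    have : Ring.inverse x = y := by
      have h1 := Ring.inverse_mul_cancel x (hx.isUnit H hQ)
      calc Ring.inverse x = Ring.inverse x * (x * y) := by rw [hxy, mul_one]
        _ = y := by rw [← mul_assoc, h1, one_mul]
    change InPowerGroup G t Q i (Ring.inverse x ^ (n + 1))
    rw [this]
    exact hpow hy _

lemma inPowerGroup_t {j : Fin e} (hj : j < i) (hQj : Q j) : InPowerGroup G t Q i (t j) := by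
  refine ⟨1, Pi.single j 1, one_ne_zero, fun k hk => ?_, ?_⟩
  · by_cases h : k = j
    · subst h; exact ⟨hj, hQj⟩
    · rw [Pi.single_eq_of_ne h] at hk; exact absurd rfl hk
  · rw [powProd_single, intPow_one, map_one, one_mul]

lemma InPowerGroup.mono {i' : Fin e} (hi : i ≤ i') {x : R} (hx : InPowerGroup G t Q i x) :
    InPowerGroup G t Q i' x := by
  obtain ⟨h, m, hh, hm, rfl⟩ := hx
  exact ⟨h, m, hh, fun j hj => ⟨lt_of_lt_of_le (hm j hj).1 hi, (hm j hj).2⟩, rfl⟩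

lemma InPowerGroup.list_prod (H : ∀ j, (kind j).Holds (t j)) (hQ : ∀ j, Q j → kind j ≠ .S)
    {l : List R} (hl : ∀ x ∈ l, InPowerGroup G t Q i x) : InPowerGroup G t Q i l.prod := by
  induction l with
  | nil =>
    have := InPowerGroup.algebraMap (t := t) (Q := Q) (i := i) (one_ne_zero (α := G))
    rwa [map_one] at this
  | cons x l ih =>
    rw [List.prod_cons]
    exact (hl x List.mem_cons_self).mul H hQ (ih fun y hy => hl y (List.mem_cons_of_mem _ hy))

lemma InPowerGroup.mem_stageOf (H : ∀ j, (kind j).Holds (t j)) (hQ : ∀ j, Q j → kind j ≠ .S)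
    {x : R} (hx : InPowerGroup G t Q i x) : x ∈ stageOf G kind t i := by
  obtain ⟨h, m, hh, hm, rfl⟩ := hx
  exact mul_mem (Subalgebra.algebraMap_mem _ _)
    (powProd_mem_stageOf H (domain_of_imp hQ hm) fun j hj => (hm j hj).1)

lemma InPowerGroup.elemOf_singleton (H : ∀ j, (kind j).Holds (t j))
    (hQ : ∀ j, Q j → kind j ≠ .S) {f : G} (hf : f ≠ 0) {ps : List (Fin e × ℤ)}
    (hps : ∀ p ∈ ps, p.1 < i ∧ Q p.1) : InPowerGroup G t Q i (elemOf t [(f, ps)]) := by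
  unfold elemOf
  rw [List.map_singleton, List.sum_singleton]
  refine (InPowerGroup.algebraMap hf).mul H hQ (InPowerGroup.list_prod H hQ fun x hx => ?_)
  obtain ⟨p, hp, rfl⟩ := List.mem_map.mp hx
  exact (inPowerGroup_t (hps p hp).1 (hps p hp).2).intPow H hQ p.2

end PowerGroup

/-! ## Stability of the stages under an automorphism -/

section StageShift

variable {G : Type*} [Field G] {R : Type*} [CommRing R] [Algebra G R] {e : ℕ}
  {kind : Fin e → MonomialKind} {t : Fin e → R}

lemma map_mem_stageOf {f : R →+* R} {n : ℕ}
    (hG : ∀ g : G, f (algebraMap G R g) ∈ stageOf G kind t n)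
    (ht : ∀ j : Fin e, (j : ℕ) < n → f (t j) ∈ stageOf G kind t n)
    (hinv : ∀ j : Fin e, (j : ℕ) < n → kind j = .P →
      f (Ring.inverse (t j)) ∈ stageOf G kind t n) {x : R} (hx : x ∈ stageOf G kind t n) :
    f x ∈ stageOf G kind t n := by
  induction hx using Algebra.adjoin_induction with
  | mem x hx =>
    obtain ⟨j, hj, rfl | ⟨hk, rfl⟩⟩ := hx
    · exact ht j hj
    · exact hinv j hj hk
  | algebraMap r => exact hG r
  | add x y _ _ hx hy => rw [map_add]; exact add_mem hx hy
  | mul x y _ _ hx hy => rw [map_mul]; exact mul_mem hx hy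

lemma eq_of_mul_eq_one {a b c : R} (h : a * b = 1) (h' : a * c = 1) : b = c := by
  calc b = b * (a * c) := by rw [h', mul_one]
    _ = a * b * c := by ring
    _ = c := by rw [h, one_mul]

/-- The stages are stable under the automorphism and its inverse. -/
lemma shift_mem_stageOf (H : ∀ j, (kind j).Holds (t j)) (σ : R ≃+* R) (σG : G ≃+* G)
    (hσG : ∀ g, σ (algebraMap G R g) = algebraMap G R (σG g))
    (hunit : ∀ i, kind i ≠ .S → ∃ x ∈ stageOf G kind t i, ∃ x' ∈ stageOf G kind t i,
      x * x' = 1 ∧ σ (t i) = σ x * t i)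
    (hsum : ∀ i, kind i = .S → ∃ x ∈ stageOf G kind t i, σ (t i) = t i + σ x) (n : ℕ) :
    (∀ y ∈ stageOf G kind t n, σ y ∈ stageOf G kind t n) ∧
      ∀ y ∈ stageOf G kind t n, σ.symm y ∈ stageOf G kind t n := by
  induction n using Nat.strong_induction_on with
  | _ n ih =>
    have hle : ∀ j : Fin e, (j : ℕ) < n → stageOf G kind t j ≤ stageOf G kind t n :=
      fun j hj => stageOf_mono hj.le
    have hinv : ∀ j : Fin e, (j : ℕ) < n → kind j = .P →
        Ring.inverse (t j) ∈ stageOf G kind t n := fun j hj hk =>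
      Algebra.subset_adjoin ⟨j, hj, Or.inr ⟨hk, rfl⟩⟩
    constructor
    · refine fun y hy => map_mem_stageOf (f := (σ : R →+* R)) (fun g => ?_) (fun j hj => ?_)
        (fun j hj hk => ?_) hy
      · change σ _ ∈ _
        rw [hσG]; exact Subalgebra.algebraMap_mem _ _
      · change σ _ ∈ _
        by_cases hk : kind j = .S
        · obtain ⟨x, hx, h⟩ := hsum j hk
          rw [h]
          exact add_mem (mem_stageOf hj) (hle j hj ((ih j hj).1 x hx))
        · obtain ⟨x, hx, _, _, _, h⟩ := hunit j hk
          rw [h]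
          exact mul_mem (hle j hj ((ih j hj).1 x hx)) (mem_stageOf hj)
      · change σ _ ∈ _
        obtain ⟨x, _, x', hx', h1, h⟩ := hunit j (by simp [hk])
        have hu : IsUnit (t j) := (H j).isUnit (by simp [hk])
        have : σ (Ring.inverse (t j)) = σ x' * Ring.inverse (t j) := by
          refine eq_of_mul_eq_one (a := σ (t j)) ?_ ?_
          · rw [← map_mul, Ring.mul_inverse_cancel _ hu, map_one]
          · rw [h, mul_mul_mul_comm, ← map_mul, h1, map_one, Ring.mul_inverse_cancel _ hu, one_mul]
        rw [this]
        exact mul_mem (hle j hj ((ih j hj).1 x' hx')) (hinv j hj hk)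
    · refine fun y hy => map_mem_stageOf (f := (σ.symm : R →+* R)) (fun g => ?_) (fun j hj => ?_)
        (fun j hj hk => ?_) hy
      · change σ.symm _ ∈ _
        have : σ.symm (algebraMap G R g) = algebraMap G R (σG.symm g) := by
          rw [RingEquiv.symm_apply_eq, hσG, RingEquiv.apply_symm_apply]
        rw [this]; exact Subalgebra.algebraMap_mem _ _
      · change σ.symm _ ∈ _
        by_cases hk : kind j = .S
        · obtain ⟨x, hx, h⟩ := hsum j hk
          have : σ.symm (t j) = t j - x := by
            rw [RingEquiv.symm_apply_eq, map_sub, h, add_sub_cancel_right]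
          rw [this]
          exact sub_mem (mem_stageOf hj) (hle j hj hx)
        · obtain ⟨x, _, x', hx', h1, h⟩ := hunit j hk
          -- From `σ(t_j) = σ(x) t_j` the preimage of `t_j` is `x⁻¹ t_j`; this is why `x` and its
          -- inverse themselves are required to lie in the stage.
          have : σ.symm (t j) = x' * t j := by
            rw [RingEquiv.symm_apply_eq, map_mul, h, ← mul_assoc, ← map_mul, mul_comm x', h1,
              map_one, one_mul]
          rw [this]
          exact mul_mem (hle j hj hx') (mem_stageOf hj)
      · change σ.symm _ ∈ _
        obtain ⟨x, hx, x', _, h1, h⟩ := hunit j (by simp [hk])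
        have hu : IsUnit (t j) := (H j).isUnit (by simp [hk])
        have : σ.symm (Ring.inverse (t j)) = x * Ring.inverse (t j) := by
          rw [RingEquiv.symm_apply_eq, map_mul]
          refine eq_of_mul_eq_one (a := t j) (Ring.mul_inverse_cancel _ hu) ?_
          have h2 : σ (t j) * σ (Ring.inverse (t j)) = 1 := by
            rw [← map_mul, Ring.mul_inverse_cancel _ hu, map_one]
          rw [h] at h2
          rw [← h2]; ring
        rw [this]
        exact mul_mem (hle j hj hx) (hinv j hj hk)

lemma map_ringInverse {R' : Type*} [CommRing R'] (f : R →+* R') {x : R} (hx : IsUnit x) :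
    f (Ring.inverse x) = Ring.inverse (f x) :=
  eq_of_mul_eq_one (a := f x) (by rw [← map_mul, Ring.mul_inverse_cancel _ hx, map_one])
    (Ring.mul_inverse_cancel _ (hx.map f))

lemma map_stageOf {R' : Type*} [CommRing R'] [Algebra G R'] (H : ∀ j, (kind j).Holds (t j))
    (f : R →ₐ[G] R') (i : ℕ) :
    (stageOf G kind t i).map f = stageOf G kind (fun j => f (t j)) i := by
  unfold stageOf
  rw [AlgHom.map_adjoin]
  congr 1
  have hinv : ∀ j, kind j = .P → f (Ring.inverse (t j)) = Ring.inverse (f (t j)) := fun j hk =>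
    map_ringInverse (f : R →+* R') ((H j).isUnit (by simp [hk]))
  ext y
  constructor
  · rintro ⟨x, ⟨j, hj, rfl | ⟨hk, rfl⟩⟩, rfl⟩
    · exact ⟨j, hj, Or.inl rfl⟩
    · exact ⟨j, hj, Or.inr ⟨hk, hinv j hk⟩⟩
  · rintro ⟨j, hj, rfl | ⟨hk, rfl⟩⟩
    · exact ⟨_, ⟨j, hj, Or.inl rfl⟩, rfl⟩
    · exact ⟨_, ⟨j, hj, Or.inr ⟨hk, rfl⟩⟩, hinv j hk⟩

lemma map_elemOf {R' : Type*} [CommRing R'] [Algebra G R'] (H : ∀ j, (kind j).Holds (t j))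
    (f : R →ₐ[G] R') {Y : MonomialList (Fin e) G}
    (hY : ∀ s ∈ Y, ∀ p ∈ s.2, p.2 ∈ (kind p.1).exponents) :
    f (elemOf t Y) = elemOf (fun j => f (t j)) Y := by
  unfold elemOf
  rw [map_list_sum, List.map_map]
  congr 1
  refine List.map_congr_left fun s hs => ?_
  rw [Function.comp_apply, map_mul, AlgHom.commutes, map_list_prod, List.map_map]
  congr 2
  refine List.map_congr_left fun p hp => ?_
  exact map_intPow (H p.1) (f : R →+* R') (MonomialKind.exponents_subset_domain _ (hY s hs p hp))

/-- An injectively indexed relation can be collected into one function of the exponent vector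
without merging coefficients. -/
lemma powProdIndependent_of_linearCombination
    (h : ∀ c : (Fin e → ℤ) →₀ G, (∀ m ∈ c.support, IsExponent kind e m) →
      Finsupp.linearCombination G (powProd t) c = 0 → c = 0) : PowProdIndependent G kind t e := by
  classical
  intro ι s m g hm hinj h0 a ha
  have hc := h (∑ b ∈ s, Finsupp.single (m b) (g b)) (fun m' hm' => by
      obtain ⟨b, hb, hb'⟩ := Finset.mem_biUnion.mp (Finsupp.support_finsetSum hm')
      rw [Finset.mem_singleton.mp (Finsupp.support_single_subset hb')]
      exact hm b hb)
    (by
      rw [map_sum, ← h0]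
      exact Finset.sum_congr rfl fun b _ => Finsupp.linearCombination_single _ _ _)
  have := DFunLike.congr_fun hc (m a)
  rw [Finsupp.finsetSum_apply, Finset.sum_eq_single a
    (fun b hb hne => Finsupp.single_eq_of_ne fun h => hne (hinj hb ha h.symm))
    (fun h => absurd ha h), Finsupp.single_eq_same] at this
  exact this

/-- Carries independence from the ambient ring back to the subring generated by the monomials. -/
lemma PowProdIndependent.of_map {R' : Type*} [CommRing R'] [Algebra G R']
    (H : ∀ j, (kind j).Holds (t j)) (f : R →ₐ[G] R')
    (hind : PowProdIndependent G kind (fun j => f (t j)) e) : PowProdIndependent G kind t e := by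
  intro ι s m g hm hinj h0
  refine hind s m g hm hinj ?_
  rw [← map_zero f, ← h0, map_sum]
  refine Finset.sum_congr rfl fun a ha => ?_
  rw [map_smul]
  congr 1
  exact (map_powProd H (f : R →+* R') (hm a ha).domain).symm

end StageShift

/-! ## The tower generated by elements of a difference ring -/

section SubTower

variable {G : Type u} [Field G] {R : Type u} [CommRing R] [Algebra G R] {e : ℕ}

/-- The tower that is generated by elements of a difference ring. -/
def subTower (kind : Fin e → MonomialKind) (t : Fin e → R) (σ : R ≃+* R)
    (h : ∀ y ∈ stageOf G kind t e, σ y ∈ stageOf G kind t e)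
    (h' : ∀ y ∈ stageOf G kind t e, σ.symm y ∈ stageOf G kind t e) : Tower G e where
  E := stageOf G kind t e
  σ :=
    { toFun := fun x => ⟨σ x, h x x.2⟩
      invFun := fun x => ⟨σ.symm x, h' x x.2⟩
      left_inv := fun x => Subtype.ext (σ.symm_apply_apply x)
      right_inv := fun x => Subtype.ext (σ.apply_symm_apply x)
      map_mul' := fun x y => Subtype.ext (map_mul σ (x : R) y)
      map_add' := fun x y => Subtype.ext (map_add σ (x : R) y) }
  t := fun j => ⟨t j, mem_stageOf j.2⟩
  kind := kind

variable {kind : Fin e → MonomialKind} {t : Fin e → R} {σ : R ≃+* R}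
  {h : ∀ y ∈ stageOf G kind t e, σ y ∈ stageOf G kind t e}
  {h' : ∀ y ∈ stageOf G kind t e, σ.symm y ∈ stageOf G kind t e}

variable (σ h h') in
/-- The inclusion of the tower. -/
def subTowerVal : (subTower kind t σ h h').E →ₐ[G] R := (stageOf G kind t e).val

lemma subTowerVal_injective : Function.Injective (subTowerVal σ h h') := Subtype.val_injective

lemma subTowerVal_shift (x : (subTower kind t σ h h').E) :
    subTowerVal σ h h' ((subTower kind t σ h h').σ x) = σ (subTowerVal σ h h' x) := rfl

lemma subTowerVal_t (j : Fin e) : subTowerVal σ h h' ((subTower kind t σ h h').t j) = t j := rfl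

/-- A `P`-monomial has to be invertible inside the subring; its inverse is among the generators. -/
lemma subTower_holds (H : ∀ j, (kind j).Holds (t j)) (j : Fin e) :
    ((subTower kind t σ h h').kind j).Holds ((subTower kind t σ h h').t j) := by
  have hH := H j
  change (kind j).Holds ((subTower kind t σ h h').t j)
  cases hk : kind j with
  | A ν =>
    rw [hk] at hH
    exact ⟨hH.1, subTowerVal_injective (by rw [map_pow, subTowerVal_t, hH.2, map_one])⟩
  | P =>
    rw [hk] at hH
    have hinv : Ring.inverse (t j) ∈ stageOf G kind t e :=
      Algebra.subset_adjoin ⟨j, j.2, Or.inr ⟨hk, rfl⟩⟩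
    exact IsUnit.of_mul_eq_one (⟨_, hinv⟩ : (subTower kind t σ h h').E)
      (subTowerVal_injective (Ring.mul_inverse_cancel _ hH))
  | S => trivial

lemma mem_subTower_stage_iff (H : ∀ j, (kind j).Holds (t j)) {i : ℕ}
    {x : (subTower kind t σ h h').E} :
    x ∈ (subTower kind t σ h h').stage i ↔ subTowerVal σ h h' x ∈ stageOf G kind t i := by
  have hmap := map_stageOf (subTower_holds (σ := σ) (h := h) (h' := h') H) (subTowerVal σ h h') i
  have hmap' : ((subTower kind t σ h h').stage i).map (subTowerVal σ h h') = stageOf G kind t i :=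
    hmap
  rw [← hmap', Subalgebra.mem_map]
  constructor
  · exact fun hx => ⟨x, hx, rfl⟩
  · rintro ⟨y, hy, hyx⟩
    rwa [← subTowerVal_injective hyx]

/-- Freeness is the independence of the power products. The other axioms are inherited through the
inclusion, because the stages are stable under `σ`. -/
lemma subTower_isAPS [Nontrivial R] (H : ∀ j, (kind j).Holds (t j)) (σG : G ≃+* G)
    (hσG : ∀ g, σ (algebraMap G R g) = algebraMap G R (σG g))
    (hunit : ∀ i, kind i ≠ .S → ∃ x ∈ stageOf G kind t i, ∃ x' ∈ stageOf G kind t i,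
      x * x' = 1 ∧ σ (t i) = σ x * t i)
    (hsum : ∀ i, kind i = .S → ∃ x ∈ stageOf G kind t i, σ (t i) = t i + σ x)
    (hroot : ∀ i ν, kind i = .A ν → ∃ g : G, IsPrimitiveRoot g ν ∧
      σ (t i) = algebraMap G R g * t i)
    (hind : PowProdIndependent G kind t e) : (subTower kind t σ h h').IsAPS σG := by
  set 𝓔 := subTower kind t σ h h' with h𝓔
  have hstage := shift_mem_stageOf H σ σG hσG hunit hsum
  have hle : ∀ i : Fin e, stageOf G kind t i ≤ stageOf G kind t e := fun i => stageOf_mono i.2.le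
  have hnt : Nontrivial 𝓔.E := inferInstanceAs (Nontrivial (stageOf G kind t e))
  refine ⟨(algebraMap G 𝓔.E).injective, fun g => subTowerVal_injective (hσG g), ?_, fun i => ?_,
    fun i ν hk => ?_, fun i hk => ?_, fun i hk => ?_⟩
  · rw [Algebra.eq_top_iff]
    exact fun x => (mem_subTower_stage_iff H).mpr x.2
  · exact free_of_powProdIndependent (subTower_holds H)
      (PowProdIndependent.of_map (subTower_holds H) (subTowerVal σ h h') hind) i
  · obtain ⟨g, hg, hσ⟩ := hroot i ν hk
    have hH := subTower_holds (σ := σ) (h := h) (h' := h') H i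
    rw [hk] at hH
    exact ⟨hH.1, hH.2, algebraMap G 𝓔.E g, Subalgebra.algebraMap_mem _ _,
      hg.map_of_injective (algebraMap G 𝓔.E).injective, subTowerVal_injective hσ⟩
  · obtain ⟨x, hx, x', hx', h1, hσ⟩ := hunit i (by rw [show kind i = .P from hk]; simp)
    have hH := subTower_holds (σ := σ) (h := h) (h' := h') H i
    rw [hk] at hH
    have h2 := (hstage i).1 x hx
    have h3 := (hstage i).1 x' hx'
    refine ⟨hH, ⟨σ x, hle i h2⟩, (mem_subTower_stage_iff H).mpr h2, ⟨σ x', hle i h3⟩,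
      (mem_subTower_stage_iff H).mpr h3, subTowerVal_injective ?_, subTowerVal_injective hσ⟩
    change σ x * σ x' = 1
    rw [← map_mul, h1, map_one]
  · obtain ⟨x, hx, hσ⟩ := hsum i hk
    have h2 := (hstage i).1 x hx
    exact ⟨⟨σ x, hle i h2⟩, (mem_subTower_stage_iff H).mpr h2, subTowerVal_injective hσ⟩

end SubTower

/-! ## The tower of a canonical reduced family -/

section Construction

variable {K₀ : Type u} [Field K₀] {d v e : ℕ} {T : Fin e → SPTerm K₀ d v}

lemma toGerm_list_sum {ι : Type*} (l : List ι) (a : ι → ℕ → ConstField K₀ v) :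
    toGerm (fun n => (l.map fun i => a i n).sum) = (l.map fun i => toGerm (a i)).sum := by
  induction l with
  | nil => rfl
  | cons x l ih =>
    simp only [List.map_cons, List.sum_cons]
    rw [toGerm_add, ih]

lemma toGerm_ofMonomials [Algebra (GroundField K₀ d v) (SeqGerm K₀ v)] (hd : d ≤ 1)
    (hchar : d = 1 → CharZero K₀)
    (halg : ∀ g, algebraMap (GroundField K₀ d v) (SeqGerm K₀ v) g = groundGerm K₀ hd hchar g)
    (hT : ∀ i, IsSigma (T i) ∨ IsPi (T i)) {Y : MonomialList (Fin e) (GroundField K₀ d v)}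
    (hY : ∀ s ∈ Y, ∀ p ∈ s.2, p.2 ∈ (kindOf (T p.1)).exponents) :
    toGerm (termValue (Term.ofMonomials (mapMonomials T Y))) =
      elemOf (fun j => toGerm (termValue (T j))) Y := by
  have h1 : termValue (Term.ofMonomials (mapMonomials T Y)) = fun n =>
      (Y.map fun s => groundEv K₀ d v s.1 n *
        powProd (fun j => termValue (T j) n) (exponentOf s.2)).sum :=
    funext fun n => termValue_ofMonomials hd hchar hT hY n
  rw [h1, toGerm_list_sum]
  unfold elemOf
  congr 1
  refine List.map_congr_left fun s hs => ?_
  have H := fun j => termValue_holds_germ hd hchar (hT j)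
  obtain ⟨h2, h3⟩ := prod_map_intPow H (hY s hs)
  rw [h2, toGerm_mul, toGerm_powProd hd hchar hT h3, halg, groundGerm_apply]

lemma coefOf_monomialList {G : Type*} [Field G] (c : (Fin e → ℤ) →₀ G) :
    coefOf (monomialList c) = c := by
  unfold coefOf monomialList
  rw [List.map_map]
  conv_rhs => rw [← Finsupp.sum_single c]
  rw [Finsupp.sum, ← Finset.sum_map_toList]
  congr 1
  refine List.map_congr_left fun m _ => ?_
  rw [Function.comp_apply, exponentOf_powerList]

/-- The germs of the sums and products of a canonical reduced family have linearly independent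
power products. -/
lemma powProdIndependent_germs [Algebra (GroundField K₀ d v) (SeqGerm K₀ v)] (hd : d ≤ 1)
    (hchar : d = 1 → CharZero K₀)
    (halg : ∀ g, algebraMap (GroundField K₀ d v) (SeqGerm K₀ v) g = groundGerm K₀ hd hchar g)
    (hF : IsOrderedFamily T) (hcan : IsCanonicalReduced (Set.range T)) :
    PowProdIndependent (GroundField K₀ d v) (fun j => kindOf (T j))
      (fun j => toGerm (termValue (T j))) e := by
  refine powProdIndependent_of_linearCombination fun c hc h0 => ?_
  have H := fun j => termValue_holds_germ hd hchar (hF.sigmaPi j)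
  have hY := isReducedList_monomialList hc
  have hexp : ∀ s ∈ monomialList c, ∀ p ∈ s.2, p.2 ∈ (kindOf (T p.1)).exponents :=
    fun s hs p hp => (hY.admissible s hs p hp).2
  have hX := (isReducedList_iff hF fun _ => rfl).mpr hY
  -- A relation between the germs is read as an expression over the family whose value is ultimately
  -- that of the term `0`.
  have hA : Term.ofMonomials (mapMonomials T (monomialList c)) ∈ SumProdOver (Set.range T) := by
    refine ⟨isSumProd_ofMonomials hX.admissible, _, ⟨hX, rfl⟩, fun t ht p hp => ?_⟩
    obtain ⟨s, _, rfl⟩ := List.mem_map.mp ht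
    obtain ⟨q, _, rfl⟩ := List.mem_map.mp hp
    exact ⟨q.1, rfl⟩
  have hB : (Term.base 0 : SPTerm K₀ d v) ∈ SumProdOver (Set.range T) :=
    ⟨.base 0, [], ⟨⟨by simp, by simp, by simp, List.Pairwise.nil⟩, rfl⟩, by simp⟩
  have hval := toGerm_ofMonomials hd hchar halg hF.sigmaPi hexp
  rw [elemOf_eq_linearCombination H hexp, coefOf_monomialList, h0] at hval
  have hperm := hcan _ hA _ hB (toGerm_eq_iff.mp (hval.trans
    (toGerm_eq_iff.mpr ⟨0, fun n _ => (groundEv_zero n).symm⟩ :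
      (toGerm fun _ => 0) = toGerm (termValue (Term.base 0 : SPTerm K₀ d v)))))
  -- Canonicity makes this expression a rearrangement of `0`, which contains no operation; so it has
  -- no monomials and the relation is trivial.
  have hcount := hperm.operandCount_eq
  by_contra hne
  have hpos := Term.operandCount_ofMonomials_pos (X := mapMonomials T (monomialList c)) (by
    intro h1
    apply hne
    rw [← coefOf_monomialList c]
    have h2 : monomialList c = [] := List.map_eq_nil_iff.mp h1
    rw [h2]; rfl)
  rw [hcount] at hpos
  exact lt_irrefl 0 hpos

/-- The shift of the monomials of the tower follows the recurrences of the sums and products. -/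
structure Realizes (𝓔 : Tower (GroundField K₀ d v) e) (T : Fin e → SPTerm K₀ d v) : Prop where
  kind_eq : ∀ j, 𝓔.kind j = kindOf (T j)
  rpow : ∀ i r, T i = .rpow r → 𝓔.σ (𝓔.t i) =
    algebraMap (GroundField K₀ d v) 𝓔.E (algebraMap _ (GroundField K₀ d v) r) * 𝓔.t i
  prod : ∀ i l Y, T i = .prod l (Term.ofMonomials (mapMonomials T Y)) →
    IsReducedList (KindAdmissible fun j => kindOf (T j)) Y →
    𝓔.σ (𝓔.t i) = 𝓔.σ (elemOf 𝓔.t Y) * 𝓔.t i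
  sum : ∀ i l Y, T i = .sum l (Term.ofMonomials (mapMonomials T Y)) →
    IsReducedList (KindAdmissible fun j => kindOf (T j)) Y →
    𝓔.σ (𝓔.t i) = 𝓔.t i + 𝓔.σ (elemOf 𝓔.t Y)

/-- The tower is a subring of germs with the shift of germs as automorphism. Freeness comes from
canonicity, and the constants are controlled by `exists_const_of_germShift_eq`. -/
theorem exists_realizes (hd : d ≤ 1) (hchar : d = 1 → CharZero K₀) (hF : IsOrderedFamily T)
    (hcan : IsCanonicalReduced (Set.range T)) : ∃ 𝓔 : Tower (GroundField K₀ d v) e,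
      𝓔.IsRPiSigma (groundShift K₀ d v) ∧ Realizes 𝓔 T := by
  let _ : Algebra (GroundField K₀ d v) (SeqGerm K₀ v) := (groundGerm K₀ hd hchar).toAlgebra
  have halg : ∀ g, algebraMap (GroundField K₀ d v) (SeqGerm K₀ v) g = groundGerm K₀ hd hchar g :=
    fun _ => rfl
  let kind : Fin e → MonomialKind := fun j => kindOf (T j)
  let t : Fin e → SeqGerm K₀ v := fun j => toGerm (termValue (T j))
  have H : ∀ j, (kind j).Holds (t j) := fun j => termValue_holds_germ hd hchar (hF.sigmaPi j)
  have hσG : ∀ g, germShift K₀ v (algebraMap (GroundField K₀ d v) _ g) =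
      algebraMap _ _ (groundShift K₀ d v g) := fun g => by
    rw [halg, halg, germShift_groundGerm]
  have hrpow : ∀ i r, T i = .rpow r → germShift K₀ v (t i) =
      algebraMap (GroundField K₀ d v) _ (algebraMap _ (GroundField K₀ d v) r) * t i := by
    intro i r hi
    simp only [t, hi]
    rw [germShift_rpow_term, halg, groundGerm_const]
  have hprod : ∀ i l Y, T i = .prod l (Term.ofMonomials (mapMonomials T Y)) →
      IsReducedList (KindAdmissible kind) Y →
      germShift K₀ v (t i) = germShift K₀ v (elemOf t Y) * t i := by
    intro i l Y hi hY
    rw [← toGerm_ofMonomials hd hchar halg hF.sigmaPi fun s hs p hp =>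
      (hY.admissible s hs p hp).2]
    simp only [t, hi]
    exact germShift_prod_term _ _
  have hsum : ∀ i l Y, T i = .sum l (Term.ofMonomials (mapMonomials T Y)) →
      IsReducedList (KindAdmissible kind) Y →
      germShift K₀ v (t i) = t i + germShift K₀ v (elemOf t Y) := by
    intro i l Y hi hY
    rw [← toGerm_ofMonomials hd hchar halg hF.sigmaPi fun s hs p hp =>
      (hY.admissible s hs p hp).2]
    simp only [t, hi]
    exact germShift_sum_term _ _
  have hunit' : ∀ i, kind i ≠ .S → ∃ x ∈ stageOf (GroundField K₀ d v) kind t i,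
      ∃ x' ∈ stageOf (GroundField K₀ d v) kind t i,
      x * x' = 1 ∧ germShift K₀ v (t i) = germShift K₀ v x * t i := by
    intro i hi
    -- `RPow(r)` contributes the constant `r`, and `Prod(l, A)` the single monomial `A`; both are
    -- power products in earlier `A`- and `P`-monomials, hence invertible within the stage.
    have hgroup : ∃ x, InPowerGroup (GroundField K₀ d v) t (fun j => kind j ≠ .S) i x ∧
        germShift K₀ v (t i) = germShift K₀ v x * t i := by
      cases hTi : T i with
      | rpow r =>
        rcases hF.sigmaPi i with ⟨_, _, _, h⟩ | ⟨r', hr, h⟩ | ⟨_, _, _, _, _, _, h⟩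
        · rw [hTi] at h; cases h
        · rw [hTi] at h
          cases h
          refine ⟨_, InPowerGroup.algebraMap (h := algebraMap _ (GroundField K₀ d v) r) ?_, ?_⟩
          · rw [Ne, map_eq_zero]; exact hr.ne_zero
          · rw [hrpow i r hTi, hσG, groundShift_const]
        · rw [hTi] at h; cases h
      | prod l A =>
        obtain ⟨Y, hY, hA, _, hp⟩ := hF.exists_body (Or.inr hTi)
        obtain ⟨f, ps, rfl, hf, _, hps⟩ := hF.exists_multiplicand hTi hA fun s hs p hp' =>
          (hp s hs p hp').2.1
        rw [hA] at hTi
        exact ⟨_, InPowerGroup.elemOf_singleton H (fun _ h => h) hf fun p hp' =>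
          ⟨(hp _ List.mem_cons_self p hp').1, hps p hp'⟩, hprod i l _ hTi hY⟩
      | _ => simp only [kind, hTi] at hi; exact absurd rfl hi
    obtain ⟨x, hx, hσ⟩ := hgroup
    obtain ⟨x', hx', h1⟩ := hx.exists_inv H fun _ h => h
    exact ⟨x, hx.mem_stageOf H fun _ h => h, x', hx'.mem_stageOf H fun _ h => h, h1, hσ⟩
  have hsum' : ∀ i, kind i = .S → ∃ x ∈ stageOf (GroundField K₀ d v) kind t i,
      germShift K₀ v (t i) = t i + germShift K₀ v x := by
    intro i hi
    obtain ⟨l, A, hTi⟩ := (kindOf_eq_S_iff (hF.sigmaPi i)).mp hi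
    obtain ⟨Y, hY, hA, _, hp⟩ := hF.exists_body (Or.inl hTi)
    rw [hA] at hTi
    exact ⟨_, elemOf_mem_stageOf H (fun s hs p hp => (hY.admissible s hs p hp).2)
      (fun s hs p hp' => (hp s hs p hp').1), hsum i l Y hTi hY⟩
  have hroot : ∀ i ν, kind i = .A ν → ∃ g : GroundField K₀ d v, IsPrimitiveRoot g ν ∧
      germShift K₀ v (t i) = algebraMap _ _ g * t i := by
    intro i ν hi
    cases hTi : T i with
    | rpow r =>
      simp only [kind, hTi, kindOf, MonomialKind.A.injEq] at hi
      subst hi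
      exact ⟨_, (IsPrimitiveRoot.orderOf r).map_of_injective
        (algebraMap (ConstField K₀ v) (GroundField K₀ d v)).injective, hrpow i r hTi⟩
    | _ => simp [kind, hTi, kindOf] at hi
  have hst := shift_mem_stageOf H (germShift K₀ v) (groundShift K₀ d v) hσG hunit' hsum' e
  have hind : PowProdIndependent (GroundField K₀ d v) kind t e :=
    powProdIndependent_germs hd hchar halg hF hcan
  have hmap : ∀ Y : MonomialList (Fin e) (GroundField K₀ d v),
      IsReducedList (KindAdmissible kind) Y →
      subTowerVal (germShift K₀ v) hst.1 hst.2
        (elemOf (subTower kind t (germShift K₀ v) hst.1 hst.2).t Y) = elemOf t Y := fun Y hY =>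
    map_elemOf (subTower_holds H) (subTowerVal (germShift K₀ v) hst.1 hst.2) fun s hs p hp =>
      (hY.admissible s hs p hp).2
  refine ⟨subTower kind t (germShift K₀ v) hst.1 hst.2, ⟨?_, ?_⟩, fun _ => rfl, ?_, ?_, ?_⟩
  · exact subTower_isAPS H (groundShift K₀ d v) hσG hunit' hsum' hroot hind
  · refine Set.Subset.antisymm (fun c hc => ?_) ?_
    · obtain ⟨κ, hκ⟩ := exists_const_of_germShift_eq
        (congrArg (subTowerVal (germShift K₀ v) hst.1 hst.2) (show _ = _ from hc))
      refine ⟨algebraMap _ _ κ, groundShift_const κ, ?_⟩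
      refine subTowerVal_injective (h := hst.1) (h' := hst.2) ?_
      rw [AlgHom.commutes, halg, groundGerm_const]
      exact hκ.symm
    · rintro _ ⟨g, hg, rfl⟩
      refine subTowerVal_injective (h := hst.1) (h' := hst.2) ?_
      rw [subTowerVal_shift, AlgHom.commutes, hσG, show groundShift K₀ d v g = g from hg]
  · intro i r hi
    exact subTowerVal_injective (h := hst.1) (h' := hst.2) (hrpow i r hi)
  · intro i l Y hi hY
    refine subTowerVal_injective (h := hst.1) (h' := hst.2) ?_
    rw [subTowerVal_shift, map_mul, subTowerVal_shift, hmap Y hY]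
    exact hprod i l Y hi hY
  · intro i l Y hi hY
    refine subTowerVal_injective (h := hst.1) (h' := hst.2) ?_
    rw [subTowerVal_shift, map_add, subTowerVal_shift, hmap Y hY]
    exact hsum i l Y hi hY

end Construction

/-! ## Uniqueness of coordinates with respect to power products -/

section Coordinates

variable {G : Type*} [Field G] {R : Type*} [CommRing R] [Algebra G R] {e : ℕ}
  {kind : Fin e → MonomialKind} {t : Fin e → R}

-- Coordinates can be read off from any expansion with pairwise different admissible exponents.
-- Quantities defined through coordinates, such as `familyEv` and `familyL`, can thus be computed
-- from whichever expansion is at hand.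
open Classical in
lemma PowProdIndependent.coordinates_eq (hind : PowProdIndependent G kind t e)
    {c : (Fin e → ℤ) →₀ G} (hc : ∀ m ∈ c.support, IsExponent kind e m) {ι : Type} {s : Finset ι}
    {m : ι → Fin e → ℤ} {g : ι → G} (hm : ∀ a ∈ s, IsExponent kind e (m a)) (hinj : Set.InjOn m s)
    (h : ∑ m ∈ c.support, c m • powProd t m = ∑ a ∈ s, g a • powProd t (m a)) :
    c.support ⊆ s.image m ∧ ∀ a ∈ s, c (m a) = g a := by
  have hsub : (∑ a ∈ s, Finsupp.single (m a) (g a)).support ⊆ s.image m := fun m' hm' => by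
    obtain ⟨b, hb, hb'⟩ := Finset.mem_biUnion.mp (Finsupp.support_finsetSum hm')
    rw [Finset.mem_singleton.mp (Finsupp.support_single_subset hb')]
    exact Finset.mem_image_of_mem m hb
  have hceq : c = ∑ a ∈ s, Finsupp.single (m a) (g a) := by
    refine sub_eq_zero.mp (hind.linearCombination_injOn (fun m' hm' => ?_) ?_)
    · rcases Finset.mem_union.mp (Finsupp.support_sub hm') with h1 | h1
      · exact hc m' h1
      · obtain ⟨a, ha, rfl⟩ := Finset.mem_image.mp (hsub h1)
        exact hm a ha
    · rw [map_sub, sub_eq_zero, Finsupp.linearCombination_apply, Finsupp.sum, h, map_sum]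
      exact Finset.sum_congr rfl fun b _ => (Finsupp.linearCombination_single _ _ _).symm
  refine ⟨hceq ▸ hsub, fun a ha => ?_⟩
  rw [hceq, Finsupp.finsetSum_apply, Finset.sum_eq_single a
    (fun b hb hne => Finsupp.single_eq_of_ne fun h => hne (hinj hb ha h.symm))
    (fun h => absurd ha h), Finsupp.single_eq_same]

lemma PowProdIndependent.coordinates_sum (hind : PowProdIndependent G kind t e)
    {c : (Fin e → ℤ) →₀ G} (hc : ∀ m ∈ c.support, IsExponent kind e m) {ι : Type} {s : Finset ι}
    {m : ι → Fin e → ℤ} {g : ι → G} (hm : ∀ a ∈ s, IsExponent kind e (m a)) (hinj : Set.InjOn m s)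
    (h : ∑ m ∈ c.support, c m • powProd t m = ∑ a ∈ s, g a • powProd t (m a))
    {M : Type*} [AddCommMonoid M] (F : G → (Fin e → ℤ) → M) (hF : ∀ m, F 0 m = 0) :
    ∑ m ∈ c.support, F (c m) m = ∑ a ∈ s, F (g a) (m a) := by
  classical
  obtain ⟨h1, h2⟩ := hind.coordinates_eq hc hm hinj h
  rw [Finset.sum_subset h1 fun m' _ hm' => by rw [Finsupp.notMem_support_iff.mp hm', hF],
    Finset.sum_image hinj]
  exact Finset.sum_congr rfl fun a ha => by rw [h2 a ha]

/-- Nonzero coefficients are needed here because a supremum, unlike a sum of terms with `F 0 m = 0`,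
may notice superfluous terms. -/
lemma PowProdIndependent.coordinates_sup (hind : PowProdIndependent G kind t e)
    {c : (Fin e → ℤ) →₀ G} (hc : ∀ m ∈ c.support, IsExponent kind e m) {ι : Type} {s : Finset ι}
    {m : ι → Fin e → ℤ} {g : ι → G} (hm : ∀ a ∈ s, IsExponent kind e (m a)) (hinj : Set.InjOn m s)
    (h : ∑ m ∈ c.support, c m • powProd t m = ∑ a ∈ s, g a • powProd t (m a))
    (hg : ∀ a ∈ s, g a ≠ 0) (F : G → (Fin e → ℤ) → ℕ) :
    (c.support.sup fun m => F (c m) m) = s.sup fun a => F (g a) (m a) := by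
  classical
  obtain ⟨h1, h2⟩ := hind.coordinates_eq hc hm hinj h
  have h3 : c.support = s.image m := by
    refine Finset.Subset.antisymm h1 fun m' hm' => ?_
    obtain ⟨a, ha, rfl⟩ := Finset.mem_image.mp hm'
    rw [Finsupp.mem_support_iff, h2 a ha]
    exact hg a ha
  rw [h3, Finset.sup_image]
  exact Finset.sup_congr rfl fun a ha => by rw [Function.comp_apply, h2 a ha]

/-- Coordinates of the elements of a tower with respect to the power products. -/
structure IsCoordinates (kind : Fin e → MonomialKind) (t : Fin e → R)
    (coord : R → (Fin e → ℤ) →₀ G) : Prop where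
  isExponent : ∀ x, ∀ m ∈ (coord x).support, IsExponent kind e m
  sum_eq : ∀ x, ∑ m ∈ (coord x).support, coord x m • powProd t m = x

lemma exists_isCoordinates (H : ∀ j, (kind j).Holds (t j)) (htop : stageOf G kind t e = ⊤) :
    ∃ coord : R → (Fin e → ℤ) →₀ G, IsCoordinates kind t coord := by
  choose coord h1 h2 using fun x : R => exists_sum_of_mem_stageOf H
    (show x ∈ stageOf G kind t e by rw [htop]; trivial)
  exact ⟨coord, h1, fun x => (h2 x).symm⟩

variable {coord : R → (Fin e → ℤ) →₀ G}

lemma IsCoordinates.isExponent_of_mem_stageOf (hcoord : IsCoordinates kind t coord)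
    (hind : PowProdIndependent G kind t e) (H : ∀ j, (kind j).Holds (t j)) {i : Fin e} {x : R}
    (hx : x ∈ stageOf G kind t i) : ∀ m ∈ (coord x).support, IsExponent kind i m := by
  classical
  obtain ⟨g, hg, h⟩ := exists_sum_of_mem_stageOf H hx
  have h1 := (hind.coordinates_eq (hcoord.isExponent x) (s := g.support) (m := id) (g := g)
    (fun m hm j => ⟨(hg m hm j).1, fun _ => j.2⟩) Function.injective_id.injOn
    ((hcoord.sum_eq x).trans h)).1
  rw [Finset.image_id] at h1
  exact fun m hm => hg m (h1 hm)

lemma IsCoordinates.support_nonempty (hcoord : IsCoordinates kind t coord) {x : R} (hx : x ≠ 0) :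
    (coord x).support.Nonempty := by
  by_contra h
  apply hx
  rw [← hcoord.sum_eq x, Finset.not_nonempty_iff_eq_empty.mp h, Finset.sum_empty]

lemma IsCoordinates.sum_sigma (hcoord : IsCoordinates kind t coord)
    (hind : PowProdIndependent G kind t e) (H : ∀ j, (kind j).Holds (t j)) {i : Fin e}
    {S : Finset ℤ} {c : ℤ → R} (hc : ∀ k ∈ S, c k ∈ stageOf G kind t i) :
    ∑ k ∈ S, c k * intPow (t i) k = ∑ a ∈ S.sigma fun k => (coord (c k)).support,
        coord (c a.1) a.2 • powProd t (Function.update a.2 i a.1) := by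
  rw [← sum_sigma_powProd (g := fun k => coord (c k)) fun k hk =>
    hcoord.isExponent_of_mem_stageOf hind H (hc k hk)]
  exact Finset.sum_congr rfl fun k _ => by rw [hcoord.sum_eq]

end Coordinates

/-! ## The evaluation induced by a family of sums and products -/

section FamilyEvaluation

variable {K₀ : Type u} [Field K₀] {d v e : ℕ}

/-- The evaluation of the element with coordinates `c`. -/
def familyEv (T : Fin e → SPTerm K₀ d v) (c : (Fin e → ℤ) →₀ GroundField K₀ d v) (n : ℕ) :
    ConstField K₀ v :=
  ∑ m ∈ c.support, groundEv K₀ d v (c m) n * powProd (fun j => termValue (T j) n) m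

/-- The bound contributed by the monomials that occur in a power product. -/
def exponentBound (T : Fin e → SPTerm K₀ d v) (m : Fin e → ℤ) : ℕ :=
  Finset.univ.sup fun j => if m j = 0 then 0 else lowerBound (T j) - 1

/-- The `o`-function on the element with coordinates `c`. -/
def familyL (T : Fin e → SPTerm K₀ d v) (c : (Fin e → ℤ) →₀ GroundField K₀ d v) : ℕ :=
  c.support.sup fun m => max (groundL K₀ d v (c m)) (exponentBound T m)

/-- The `z`-function on the element with coordinates `c`. -/
def familyZ (c : (Fin e → ℤ) →₀ GroundField K₀ d v) : ℕ :=
  c.support.sup fun m => groundZ K₀ d v (c m)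

variable {T : Fin e → SPTerm K₀ d v}

lemma exponentBound_zero : exponentBound T 0 = 0 := by simp [exponentBound]

lemma exponentBound_le {m : Fin e → ℤ} {l : ℕ} (h : ∀ j, m j ≠ 0 → lowerBound (T j) - 1 ≤ l) :
    exponentBound T m ≤ l := by
  refine Finset.sup_le fun j _ => ?_
  split_ifs with hj
  · exact Nat.zero_le _
  · exact h j hj

lemma le_exponentBound {m : Fin e → ℤ} {j : Fin e} (h : m j ≠ 0) :
    lowerBound (T j) - 1 ≤ exponentBound T m := by
  have := Finset.le_sup (f := fun j => if m j = 0 then 0 else lowerBound (T j) - 1)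
    (Finset.mem_univ j)
  rw [if_neg h] at this
  exact this

variable {𝓔 : Tower (GroundField K₀ d v) e}
  {coord : 𝓔.E → (Fin e → ℤ) →₀ GroundField K₀ d v}

lemma familyEv_eq_sum (hcoord : IsCoordinates 𝓔.kind 𝓔.t coord)
    (hind : PowProdIndependent (GroundField K₀ d v) 𝓔.kind 𝓔.t e) {ι : Type} {s : Finset ι}
    {m : ι → Fin e → ℤ} {g : ι → GroundField K₀ d v} (hm : ∀ a ∈ s, IsExponent 𝓔.kind e (m a))
    (hinj : Set.InjOn m s) {x : 𝓔.E} (h : x = ∑ a ∈ s, g a • powProd 𝓔.t (m a)) (n : ℕ) :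
    familyEv T (coord x) n =
      ∑ a ∈ s, groundEv K₀ d v (g a) n * powProd (fun j => termValue (T j) n) (m a) :=
  hind.coordinates_sum (hcoord.isExponent x) hm hinj ((hcoord.sum_eq x).trans h)
    (fun g m => groundEv K₀ d v g n * powProd (fun j => termValue (T j) n) m)
    fun m => by rw [groundEv_zero, zero_mul]

lemma familyL_eq_sup (hcoord : IsCoordinates 𝓔.kind 𝓔.t coord)
    (hind : PowProdIndependent (GroundField K₀ d v) 𝓔.kind 𝓔.t e) {ι : Type} {s : Finset ι}
    {m : ι → Fin e → ℤ} {g : ι → GroundField K₀ d v} (hm : ∀ a ∈ s, IsExponent 𝓔.kind e (m a))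
    (hinj : Set.InjOn m s) {x : 𝓔.E} (h : x = ∑ a ∈ s, g a • powProd 𝓔.t (m a))
    (hg : ∀ a ∈ s, g a ≠ 0) :
    familyL T (coord x) = s.sup fun a => max (groundL K₀ d v (g a)) (exponentBound T (m a)) :=
  hind.coordinates_sup (hcoord.isExponent x) hm hinj ((hcoord.sum_eq x).trans h) hg
    (fun g m => max (groundL K₀ d v g) (exponentBound T m))

lemma isExponent_zero (H : ∀ j, (𝓔.kind j).Holds (𝓔.t j)) : IsExponent 𝓔.kind e 0 :=
  fun j => ⟨(H j).zero_mem_exponents, fun _ => j.2⟩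

lemma familyEv_base (hcoord : IsCoordinates 𝓔.kind 𝓔.t coord)
    (hind : PowProdIndependent (GroundField K₀ d v) 𝓔.kind 𝓔.t e)
    (H : ∀ j, (𝓔.kind j).Holds (𝓔.t j)) (g : GroundField K₀ d v) (n : ℕ) :
    familyEv T (coord (algebraMap _ 𝓔.E g)) n = groundEv K₀ d v g n := by
  rw [familyEv_eq_sum hcoord hind (s := {()}) (m := fun _ => 0) (g := fun _ => g)
    (fun _ _ => isExponent_zero H) (by simp)
    (by rw [Finset.sum_singleton, powProd_zero, Algebra.algebraMap_eq_smul_one]),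
    Finset.sum_singleton, powProd_zero, mul_one]

lemma familyL_base (hcoord : IsCoordinates 𝓔.kind 𝓔.t coord)
    (hind : PowProdIndependent (GroundField K₀ d v) 𝓔.kind 𝓔.t e)
    (H : ∀ j, (𝓔.kind j).Holds (𝓔.t j)) (g : GroundField K₀ d v) :
    familyL T (coord (algebraMap _ 𝓔.E g)) = groundL K₀ d v g := by
  by_cases hg : g = 0
  · rw [familyL_eq_sup hcoord hind (s := (∅ : Finset Unit)) (m := fun _ => 0) (g := fun _ => g)
      (by simp) (by simp) (by rw [hg, map_zero, Finset.sum_empty]) (by simp), hg, groundL_zero]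
    rfl
  · rw [familyL_eq_sup hcoord hind (s := {()}) (m := fun _ => 0) (g := fun _ => g)
      (fun _ _ => isExponent_zero H) (by simp)
      (by rw [Finset.sum_singleton, powProd_zero, Algebra.algebraMap_eq_smul_one])
      (fun _ _ => hg), Finset.sup_singleton, exponentBound_zero, Nat.max_zero]

lemma familyZ_eq (hcoord : IsCoordinates 𝓔.kind 𝓔.t coord)
    (hind : PowProdIndependent (GroundField K₀ d v) 𝓔.kind 𝓔.t e)
    (H : ∀ j, (𝓔.kind j).Holds (𝓔.t j)) {g : GroundField K₀ d v} (hg : g ≠ 0) {m : Fin e → ℤ}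
    (hm : ∀ j, m j ∈ (𝓔.kind j).domain) :
    familyZ (coord (algebraMap _ 𝓔.E g * powProd 𝓔.t m)) = groundZ K₀ d v g := by
  refine (hind.coordinates_sup (hcoord.isExponent _) (s := {()})
    (m := fun _ j => (𝓔.kind j).reduce (m j)) (g := fun _ => g)
    (fun _ _ j => ⟨(H j).reduce_mem (hm j), fun _ => j.2⟩) (by simp) ((hcoord.sum_eq _).trans
      (by rw [Finset.sum_singleton, powProd_reduce H, Algebra.smul_def])) (fun _ _ => hg)
    (fun g _ => groundZ K₀ d v g)).trans ?_
  rw [Finset.sup_singleton]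

lemma familyEv_t (hcoord : IsCoordinates 𝓔.kind 𝓔.t coord)
    (hind : PowProdIndependent (GroundField K₀ d v) 𝓔.kind 𝓔.t e)
    (H : ∀ j, (𝓔.kind j).Holds (𝓔.t j)) (i : Fin e) (n : ℕ) :
    familyEv T (coord (𝓔.t i)) n = termValue (T i) n := by
  rw [familyEv_eq_sum hcoord hind (s := {()}) (m := fun _ => Pi.single i 1) (g := fun _ => 1)
    (fun _ _ j => ⟨?_, fun _ => j.2⟩) (by simp)
    (by rw [Finset.sum_singleton, powProd_single, intPow_one, one_smul]),
    Finset.sum_singleton, powProd_single, intPow_one, groundEv_one, one_mul]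
  by_cases hj : j = i
  · subst hj; rw [Pi.single_eq_same]; exact (H j).one_mem_exponents
  · rw [Pi.single_eq_of_ne hj]; exact (H j).zero_mem_exponents

lemma familyEv_elemOf (hcoord : IsCoordinates 𝓔.kind 𝓔.t coord)
    (hind : PowProdIndependent (GroundField K₀ d v) 𝓔.kind 𝓔.t e)
    (H : ∀ j, (𝓔.kind j).Holds (𝓔.t j)) (hd : d ≤ 1) (hchar : d = 1 → CharZero K₀)
    (hF : IsOrderedFamily T) (hkind : ∀ j, 𝓔.kind j = kindOf (T j))
    {Y : MonomialList (Fin e) (GroundField K₀ d v)}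
    (hY : IsReducedList (KindAdmissible 𝓔.kind) Y) (n : ℕ) :
    familyEv T (coord (elemOf 𝓔.t Y)) n =
      termValue (Term.ofMonomials (mapMonomials T Y)) n := by
  rw [familyEv_eq_sum hcoord hind (s := Finset.univ) (m := fun a : Fin Y.length => exponentOf Y[a].2)
      (g := fun a => Y[a].1)
      (fun a _ => hY.isExponent (fun j => (H j).zero_mem_exponents) (List.getElem_mem _)
        fun p _ => p.1.2) hY.injective_exponentOf.injOn
      (elemOf_eq_sum H fun s hs p hp => (hY.admissible s hs p hp).2),
    termValue_ofMonomials hd hchar hF.sigmaPi fun s hs p hp => by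
      rw [← hkind]; exact (hY.admissible s hs p hp).2]
  exact Fin.sum_univ_fun_getElem Y fun s => groundEv K₀ d v s.1 n *
      powProd (fun j => termValue (T j) n) (exponentOf s.2)

lemma familyL_elemOf_le (hcoord : IsCoordinates 𝓔.kind 𝓔.t coord)
    (hind : PowProdIndependent (GroundField K₀ d v) 𝓔.kind 𝓔.t e)
    (H : ∀ j, (𝓔.kind j).Holds (𝓔.t j)) {Y : MonomialList (Fin e) (GroundField K₀ d v)}
    (hY : IsReducedList (KindAdmissible 𝓔.kind) Y) {l : ℕ}
    (h1 : ∀ s ∈ Y, groundL K₀ d v s.1 ≤ l)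
    (h2 : ∀ s ∈ Y, ∀ p ∈ s.2, lowerBound (T p.1) - 1 ≤ l) :
    familyL T (coord (elemOf 𝓔.t Y)) ≤ l := by
  rw [familyL_eq_sup hcoord hind (s := Finset.univ) (m := fun a : Fin Y.length => exponentOf Y[a].2)
      (g := fun a => Y[a].1)
      (fun a _ => hY.isExponent (fun j => (H j).zero_mem_exponents) (List.getElem_mem _)
        fun p _ => p.1.2) hY.injective_exponentOf.injOn
      (elemOf_eq_sum H fun s hs p hp => (hY.admissible s hs p hp).2)
      fun a _ => hY.coeff_ne_zero _ (List.getElem_mem _)]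
  refine Finset.sup_le fun a _ => max_le (h1 _ (List.getElem_mem _)) (exponentBound_le fun j hj => ?_)
  exact h2 _ (List.getElem_mem _) _
    (exists_mem_of_exponentOf_ne_zero (hY.nodup _ (List.getElem_mem _)) hj)

lemma familyEv_expansion (hcoord : IsCoordinates 𝓔.kind 𝓔.t coord)
    (hind : PowProdIndependent (GroundField K₀ d v) 𝓔.kind 𝓔.t e)
    (H : ∀ j, (𝓔.kind j).Holds (𝓔.t j)) {i : Fin e} {S : Finset ℤ} {c : ℤ → 𝓔.E}
    (hS : ∀ k ∈ S, k ∈ (𝓔.kind i).exponents) (hc : ∀ k ∈ S, c k ∈ 𝓔.stage i) (n : ℕ) :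
    familyEv T (coord (∑ k ∈ S, c k * intPow (𝓔.t i) k)) n =
      ∑ k ∈ S, familyEv T (coord (c k)) n * termValue (T i) n ^ k := by
  have hexp := fun k hk => hcoord.isExponent_of_mem_stageOf hind H (hc k hk)
  rw [familyEv_eq_sum hcoord hind
    (fun a ha j => ⟨(sigma_isExponent (g := fun k => coord (c k)) hS hexp a ha j).1, fun _ => j.2⟩)
    (sigma_injOn hexp) (hcoord.sum_sigma hind H hc), Finset.sum_sigma]
  refine Finset.sum_congr rfl fun k hk => ?_
  rw [familyEv, Finset.sum_mul]
  refine Finset.sum_congr rfl fun m hm => ?_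
  rw [powProd_eq_update _ (Function.update m i k) i, Function.update_self, Function.update_idem,
    ← (hexp k hk m hm).apply_self, Function.update_eq_self, intPow_field, mul_assoc]

lemma exponentBound_update {m : Fin e → ℤ} {i : Fin e} (hm : m i = 0) (k : ℤ) :
    exponentBound T (Function.update m i k) =
      max (if k = 0 then 0 else lowerBound (T i) - 1) (exponentBound T m) := by
  apply le_antisymm
  · refine exponentBound_le fun j hj => ?_
    by_cases hji : j = i
    · subst hji
      rw [Function.update_self] at hj
      rw [if_neg hj]
      exact le_max_left _ _
    · rw [Function.update_of_ne hji] at hj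
      exact le_max_of_le_right (le_exponentBound hj)
  · refine max_le ?_ (exponentBound_le fun j hj => ?_)
    · split_ifs with hk
      · exact Nat.zero_le _
      · exact le_exponentBound (by rwa [Function.update_self])
    · have hji : j ≠ i := by rintro rfl; exact hj hm
      exact le_exponentBound (by rwa [Function.update_of_ne hji])

/-- A vanishing `c k` would contribute no power product at all, and only an exponent `k ≠ 0` brings
in the bound of `t_i`; hence the two conditions on `S`. -/
lemma familyL_expansion (hcoord : IsCoordinates 𝓔.kind 𝓔.t coord)
    (hind : PowProdIndependent (GroundField K₀ d v) 𝓔.kind 𝓔.t e)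
    (H : ∀ j, (𝓔.kind j).Holds (𝓔.t j)) {i : Fin e} {S : Finset ℤ} {c : ℤ → 𝓔.E}
    (hS : ∀ k ∈ S, k ∈ (𝓔.kind i).exponents) (hc : ∀ k ∈ S, c k ∈ 𝓔.stage i)
    (h0 : ∀ k ∈ S, c k ≠ 0) (hk : ∃ k ∈ S, k ≠ 0) :
    familyL T (coord (∑ k ∈ S, c k * intPow (𝓔.t i) k)) =
      max (lowerBound (T i) - 1) (S.sup fun k => familyL T (coord (c k))) := by
  have hexp := fun k hk => hcoord.isExponent_of_mem_stageOf hind H (hc k hk)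
  rw [familyL_eq_sup hcoord hind
    (fun a ha j => ⟨(sigma_isExponent (g := fun k => coord (c k)) hS hexp a ha j).1, fun _ => j.2⟩)
    (sigma_injOn hexp) (hcoord.sum_sigma hind H hc)
    fun a ha => Finsupp.mem_support_iff.mp (Finset.mem_sigma.mp ha).2, Finset.sup_sigma]
  have hle : ∀ k ∈ S, ∀ m ∈ (coord (c k)).support,
      max (groundL K₀ d v (coord (c k) m)) (exponentBound T m) ≤
        S.sup fun k => familyL T (coord (c k)) := fun k hk m hm =>
    le_trans (Finset.le_sup (f := fun m => max (groundL K₀ d v (coord (c k) m))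
      (exponentBound T m)) hm) (Finset.le_sup (f := fun k => familyL T (coord (c k))) hk)
  have hge : ∀ k ∈ S, ∀ m ∈ (coord (c k)).support,
      max (groundL K₀ d v (coord (c k) m)) (exponentBound T (Function.update m i k)) ≤
      S.sup fun k => (coord (c k)).support.sup fun m =>
        max (groundL K₀ d v (coord (c k) m)) (exponentBound T (Function.update m i k)) :=
    fun k hk m hm => le_trans (Finset.le_sup (f := fun m =>
        max (groundL K₀ d v (coord (c k) m)) (exponentBound T (Function.update m i k))) hm)
      (Finset.le_sup (f := fun k => (coord (c k)).support.sup fun m =>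
        max (groundL K₀ d v (coord (c k) m)) (exponentBound T (Function.update m i k))) hk)
  apply le_antisymm
  · refine Finset.sup_le fun k hk => Finset.sup_le fun m hm => ?_
    obtain ⟨h1, h2⟩ := max_le_iff.mp (hle k hk m hm)
    rw [exponentBound_update (hexp k hk m hm).apply_self]
    refine max_le (le_max_of_le_right h1) (max_le_max ?_ h2)
    split_ifs
    · exact Nat.zero_le _
    · exact le_rfl
  · refine max_le ?_ (Finset.sup_le fun k hk => Finset.sup_le fun m hm => ?_)
    · obtain ⟨k, hk, hk0⟩ := hk
      obtain ⟨m, hm⟩ := hcoord.support_nonempty (h0 k hk)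
      refine le_trans ?_ (hge k hk m hm)
      exact le_max_of_le_right (le_exponentBound (by rwa [Function.update_self]))
    · refine le_trans ?_ (hge k hk m hm)
      rw [exponentBound_update (hexp k hk m hm).apply_self]
      exact max_le_max le_rfl (le_max_right _ _)

end FamilyEvaluation

/-! ## Towers that realize a family -/

section RealizedFamily

variable {K₀ : Type u} [Field K₀] {d v e : ℕ} {T : Fin e → SPTerm K₀ d v}
  {𝓔 : Tower (GroundField K₀ d v) e}

lemma IsOrderedFamily.exists_rpow (hF : IsOrderedFamily T) {i : Fin e} {ν : ℕ}
    (h : kindOf (T i) = .A ν) : ∃ r, IsNontrivialRootOfUnity r ∧ T i = .rpow r := by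
  rcases hF.sigmaPi i with ⟨l, f, _, h'⟩ | ⟨r, hr, h'⟩ | ⟨l, f, p, _, _, _, h'⟩
  · rw [h'] at h; cases h
  · exact ⟨r, hr, h'⟩
  · rw [h'] at h; cases h

lemma Realizes.symm_quotient_rpow (hR : Realizes 𝓔 T) (hAPS : 𝓔.IsAPS (groundShift K₀ d v))
    {i : Fin e} {r : ConstField K₀ v} (h : T i = .rpow r) :
    𝓔.σ.symm (𝓔.quotient i) =
      algebraMap (GroundField K₀ d v) 𝓔.E (algebraMap _ (GroundField K₀ d v) r) := by
  have hu := (hAPS.holds i).isUnit (by rw [hR.kind_eq, h]; simp [kindOf])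
  rw [RingEquiv.symm_apply_eq, hAPS.shift_base, groundShift_const, Tower.quotient, hR.rpow i r h,
    mul_assoc, Ring.mul_inverse_cancel _ hu, mul_one]

lemma Realizes.symm_quotient_prod (hR : Realizes 𝓔 T) (hAPS : 𝓔.IsAPS (groundShift K₀ d v))
    {i : Fin e} {l : ℕ} {Y : MonomialList (Fin e) (GroundField K₀ d v)}
    (h : T i = .prod l (Term.ofMonomials (mapMonomials T Y)))
    (hY : IsReducedList (KindAdmissible fun j => kindOf (T j)) Y) :
    𝓔.σ.symm (𝓔.quotient i) = elemOf 𝓔.t Y := by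
  have hu := (hAPS.holds i).isUnit (by rw [hR.kind_eq, h]; simp [kindOf])
  rw [RingEquiv.symm_apply_eq, Tower.quotient, hR.prod i l Y h hY, mul_assoc,
    Ring.mul_inverse_cancel _ hu, mul_one]

lemma Realizes.symm_difference_sum (hR : Realizes 𝓔 T)
    {i : Fin e} {l : ℕ} {Y : MonomialList (Fin e) (GroundField K₀ d v)}
    (h : T i = .sum l (Term.ofMonomials (mapMonomials T Y)))
    (hY : IsReducedList (KindAdmissible fun j => kindOf (T j)) Y) :
    𝓔.σ.symm (𝓔.difference i) = elemOf 𝓔.t Y := by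
  rw [RingEquiv.symm_apply_eq, Tower.difference, hR.sum i l Y h hY, add_sub_cancel_left]

lemma Realizes.isExprOf (hR : Realizes 𝓔 T) (hAPS : 𝓔.IsAPS (groundShift K₀ d v))
    (hF : IsOrderedFamily T) : IsExprOf 𝓔 (fun i => lowerBound (T i)) T := by
  intro i
  have hkind : 𝓔.kind = fun j => kindOf (T j) := funext hR.kind_eq
  have htrans : ∀ {x : 𝓔.E} {Y : MonomialList (Fin e) (GroundField K₀ d v)},
      IsReducedList (KindAdmissible fun j => kindOf (T j)) Y → x = elemOf 𝓔.t Y →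
      IsTranslation 𝓔 T x (Term.ofMonomials (mapMonomials T Y)) := fun {x Y} hY hx =>
    ⟨Y, by rw [← hkind] at hY; exact hY, hx, rfl⟩
  cases hk : 𝓔.kind i with
  | A ν =>
    obtain ⟨r, hr, h⟩ := hF.exists_rpow ((hR.kind_eq i).symm.trans hk)
    exact ⟨r, hr, h, hR.rpow i r h⟩
  | P =>
    obtain ⟨l, A, h⟩ := kindOf_eq_P_iff.mp ((hR.kind_eq i).symm.trans hk)
    obtain ⟨Y, hY, rfl, _, _⟩ := hF.exists_body (Or.inr h)
    exact ⟨_, htrans hY (hR.symm_quotient_prod hAPS h hY), by simp only [h, lowerBound]⟩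
  | S =>
    obtain ⟨l, A, h⟩ := (kindOf_eq_S_iff (hF.sigmaPi i)).mp ((hR.kind_eq i).symm.trans hk)
    obtain ⟨Y, hY, rfl, _, _⟩ := hF.exists_body (Or.inl h)
    exact ⟨_, htrans hY (hR.symm_difference_sum h hY), by simp only [h, lowerBound]⟩

/-- Each axiom becomes a statement about coordinates, where the three functions are defined monomial
by monomial. The lower bounds required by the sum-product reduced form supply the inequalities for
`l_i`. -/
lemma Realizes.isInducedEvaluation (hR : Realizes 𝓔 T) (hAPS : 𝓔.IsAPS (groundShift K₀ d v))
    (hd : d ≤ 1) (hchar : d = 1 → CharZero K₀) (hF : IsOrderedFamily T)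
    (hind : PowProdIndependent (GroundField K₀ d v) 𝓔.kind 𝓔.t e)
    {coord : 𝓔.E → (Fin e → ℤ) →₀ GroundField K₀ d v} (hcoord : IsCoordinates 𝓔.kind 𝓔.t coord) :
    IsInducedEvaluation 𝓔 (fun x => familyEv T (coord x)) (fun x => familyL T (coord x))
      (fun x => familyZ (coord x)) (fun i => lowerBound (T i)) := by
  classical
  have H := hAPS.holds
  have hkind : (fun j => kindOf (T j)) = 𝓔.kind := (funext hR.kind_eq).symm
  -- Coefficients are extended by `0` from the admissible exponents to all integers.
  have hext : ∀ (i : Fin e) (c : (𝓔.kind i).exponents →₀ 𝓔.stage i), ∃ c' : ℤ → 𝓔.E,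
      ∀ k : (𝓔.kind i).exponents, c' k = (c k : 𝓔.E) := fun i c =>
    ⟨fun z => if h : z ∈ (𝓔.kind i).exponents then c ⟨z, h⟩ else 0, fun k => dif_pos k.2⟩
  let emb : ∀ i : Fin e, (𝓔.kind i).exponents ↪ ℤ := fun i => Function.Embedding.subtype _
  have hsum : ∀ (i : Fin e) (c : (𝓔.kind i).exponents →₀ 𝓔.stage i) (c' : ℤ → 𝓔.E),
      (∀ k : (𝓔.kind i).exponents, c' k = (c k : 𝓔.E)) →
      ∑ k ∈ c.support, (c k : 𝓔.E) * intPow (𝓔.t i) k =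
        ∑ k ∈ c.support.map (emb i), c' k * intPow (𝓔.t i) k := fun i c c' hc' => by
    rw [Finset.sum_map]
    exact Finset.sum_congr rfl fun k _ => by rw [← hc' k]; rfl
  have hS : ∀ (i : Fin e) (c : (𝓔.kind i).exponents →₀ 𝓔.stage i),
      ∀ k ∈ c.support.map (emb i), k ∈ (𝓔.kind i).exponents := fun i c k hk => by
    obtain ⟨k, _, rfl⟩ := Finset.mem_map.mp hk
    exact k.2
  have hc : ∀ (i : Fin e) (c : (𝓔.kind i).exponents →₀ 𝓔.stage i) (c' : ℤ → 𝓔.E),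
      (∀ k : (𝓔.kind i).exponents, c' k = (c k : 𝓔.E)) →
      ∀ k ∈ c.support.map (emb i), c' k ∈ 𝓔.stage i := fun i c c' hc' k hk => by
    obtain ⟨k, _, rfl⟩ := Finset.mem_map.mp hk
    have := (c k).2
    rw [← hc' k] at this
    exact this
  refine ⟨familyEv_base hcoord hind H, familyL_base hcoord hind H, fun h m hh hm => ?_,
    fun i c n => ?_, fun i c hnot => ?_, fun i ν hk => ?_, fun i hk => ?_, fun i hk => ?_⟩
  · refine familyZ_eq hcoord hind H hh fun j => ?_
    by_cases h0 : m j = 0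
    · rw [h0]; exact MonomialKind.zero_mem_domain _
    · exact MonomialKind.domain_of_ne (hm j h0) _
  · obtain ⟨c', hc'⟩ := hext i c
    rw [hsum i c c' hc', familyEv_expansion hcoord hind H (hS i c) (hc i c c' hc'),
      familyEv_t hcoord hind H, Finset.sum_map]
    exact Finset.sum_congr rfl fun k _ => by rw [← hc' k]; rfl
  · obtain ⟨c', hc'⟩ := hext i c
    rw [hsum i c c' hc', familyL_expansion hcoord hind H (hS i c) (hc i c c' hc'), Finset.sup_map]
    · congr 1
      exact Finset.sup_congr rfl fun k _ => by rw [← hc' k]; rfl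
    · intro k hk
      obtain ⟨k, hk', rfl⟩ := Finset.mem_map.mp hk
      have h1 := Finsupp.mem_support_iff.mp hk'
      have h2 := hc' k
      intro h3
      apply h1
      apply Subtype.ext
      exact h2.symm.trans h3
    -- If only the exponent `0` occurred, the element would already lie in the preceding stage.
    · by_contra hall
      push Not at hall
      apply hnot
      refine sum_mem fun k hk => mul_mem (c k).2 ?_
      rw [hall k (Finset.mem_map.mpr ⟨k, hk, rfl⟩), intPow_zero]
      exact one_mem _
  · obtain ⟨r, hr, h⟩ := hF.exists_rpow ((hR.kind_eq i).symm.trans hk)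
    refine ⟨by simp only [h, lowerBound], fun n => ?_⟩
    rw [familyEv_t hcoord hind H, hR.symm_quotient_rpow hAPS h, h]
    exact Finset.prod_congr rfl fun k _ => by
      rw [familyEv_base hcoord hind H, groundEv_const]
  · obtain ⟨l, A, h⟩ := kindOf_eq_P_iff.mp ((hR.kind_eq i).symm.trans hk)
    obtain ⟨Y, hY, rfl, h1, h2⟩ := hF.exists_body (Or.inr h)
    have hl : lowerBound (T i) = l := by rw [h]; rfl
    have hq := hR.symm_quotient_prod hAPS h hY
    rw [hkind] at hY
    rw [hq, hl]
    refine ⟨max_le (familyL_elemOf_le hcoord hind H hY h1 fun s hs p hp => (h2 s hs p hp).2.2) ?_,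
      fun n => ?_⟩
    -- The multiplicand is `f` times a power product, so its `Z` is that of `f`, which is bounded by
    -- the definition of `Prod(l, f ⊙ p)`.
    · obtain ⟨f, ps, rfl, hf, hZ, hps⟩ :=
        hF.exists_multiplicand h rfl fun s hs p hp => (h2 s hs p hp).2.1
      have hadm := fun p hp => (hY.admissible _ List.mem_cons_self p hp).2
      obtain ⟨h3, h4⟩ := prod_map_intPow H hadm
      have : elemOf 𝓔.t [(f, ps)] = algebraMap _ 𝓔.E f * powProd 𝓔.t (exponentOf ps) := by
        unfold elemOf
        rw [List.map_singleton, List.sum_singleton, h3]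
      rw [this, familyZ_eq hcoord hind H hf h4]
      exact hZ
    · rw [familyEv_t hcoord hind H, h]
      exact Finset.prod_congr rfl fun k _ =>
        (familyEv_elemOf hcoord hind H hd hchar hF hR.kind_eq hY k).symm
  · obtain ⟨l, A, h⟩ := (kindOf_eq_S_iff (hF.sigmaPi i)).mp ((hR.kind_eq i).symm.trans hk)
    obtain ⟨Y, hY, rfl, h1, h2⟩ := hF.exists_body (Or.inl h)
    have hl : lowerBound (T i) = l := by rw [h]; rfl
    have hq := hR.symm_difference_sum h hY
    rw [hkind] at hY
    rw [hq, hl]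
    refine ⟨familyL_elemOf_le hcoord hind H hY h1 fun s hs p hp => (h2 s hs p hp).2.2,
      fun n => ?_⟩
    rw [familyEv_t hcoord hind H, h]
    exact Finset.sum_congr rfl fun k _ =>
      (familyEv_elemOf hcoord hind H hd hchar hF hR.kind_eq hY k).symm

theorem Realizes.modelsFamily (hR : Realizes 𝓔 T) (hAPS : 𝓔.IsAPS (groundShift K₀ d v))
    (hd : d ≤ 1) (hchar : d = 1 → CharZero K₀) (hF : IsOrderedFamily T) : ModelsFamily 𝓔 T := by
  have hnt : Nontrivial 𝓔.E := hAPS.injective.nontrivial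
  obtain ⟨coord, hcoord⟩ := exists_isCoordinates hAPS.holds hAPS.stage_top
  exact ⟨_, _, _, _, hR.isInducedEvaluation hAPS hd hchar hF
    (powProdIndependent_of_free hAPS.holds hAPS.free e le_rfl) hcoord, hR.isExprOf hAPS hF⟩

/-- The quotients `σ(t_i) / t_i` are power products in the monomials which satisfy `Q`, if the
multiplicands are built from such monomials. -/
lemma Realizes.inPowerGroup (hR : Realizes 𝓔 T) (hAPS : 𝓔.IsAPS (groundShift K₀ d v))
    (hF : IsOrderedFamily T) {Q : Fin e → Prop} (hQ : ∀ j, Q j → 𝓔.kind j ≠ .S)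
    (hstep : ∀ i l A, Q i → T i = .prod l A → ∀ j, T j ∈ A.atoms → 𝓔.kind j ≠ .S → Q j)
    (i : Fin e) (hi : Q i) : ∃ α, InPowerGroup (GroundField K₀ d v) 𝓔.t Q i α ∧
      𝓔.σ (𝓔.t i) = α * 𝓔.t i := by
  have H := hAPS.holds
  induction i using WellFoundedLT.induction with
  | _ i ih =>
    cases hk : 𝓔.kind i with
    | A ν =>
      obtain ⟨r, hr, h⟩ := hF.exists_rpow ((hR.kind_eq i).symm.trans hk)
      refine ⟨_, InPowerGroup.algebraMap ?_, hR.rpow i r h⟩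
      rw [Ne, FaithfulSMul.algebraMap_eq_zero_iff]
      exact hr.ne_zero
    | P =>
      obtain ⟨l, A, h⟩ := kindOf_eq_P_iff.mp ((hR.kind_eq i).symm.trans hk)
      obtain ⟨Y, hY, rfl, h1, h2⟩ := hF.exists_body (Or.inr h)
      obtain ⟨f, ps, rfl, hf, -, hps⟩ :=
        hF.exists_multiplicand h rfl fun s hs p hp => (h2 s hs p hp).2.1
      refine ⟨_, ?_, hR.prod i l _ h hY⟩
      -- The quotient is the shift of the multiplicand. Its factors contribute `σ(t_p) = α t_p` with
      -- `t_p` earlier, and the induction hypothesis places `α` in the power group.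
      unfold elemOf
      rw [List.map_singleton, List.sum_singleton, map_mul, hAPS.shift_base, map_list_prod,
        List.map_map]
      refine (InPowerGroup.algebraMap ((map_ne_zero_iff _
        (groundShift K₀ d v).injective).mpr hf)).mul H hQ
          (InPowerGroup.list_prod H hQ fun x hx => ?_)
      obtain ⟨p, hp, rfl⟩ := List.mem_map.mp hx
      obtain ⟨hlt, hat, _⟩ := h2 _ List.mem_cons_self p hp
      have hS : 𝓔.kind p.1 ≠ .S := by rw [hR.kind_eq]; exact hps p hp
      have hQp := hstep i l _ hi h p.1 hat hS
      obtain ⟨α, hα, hσ⟩ := ih p.1 hlt hQp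
      have : 𝓔.σ (intPow (𝓔.t p.1) p.2) = intPow (𝓔.σ (𝓔.t p.1)) p.2 :=
        map_intPow (H p.1) (𝓔.σ : 𝓔.E →+* 𝓔.E) (MonomialKind.domain_of_ne hS _)
      rw [Function.comp_apply, this, hσ]
      exact ((hα.mono hlt.le).mul H hQ (inPowerGroup_t hlt hQp)).intPow H hQ p.2
    | S => exact absurd hk (hQ i hi)

lemma Realizes.isSimple (hR : Realizes 𝓔 T) (hAPS : 𝓔.IsAPS (groundShift K₀ d v))
    (hF : IsOrderedFamily T) : 𝓔.IsSimple := by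
  intro i hi
  obtain ⟨_, ⟨h, m, hh, hm, rfl⟩, hσ⟩ := hR.inPowerGroup hAPS hF
    (Q := fun j => 𝓔.kind j ≠ .S) (fun _ h => h) (fun _ _ _ _ _ _ _ h => h) i hi
  exact ⟨h, m, hh, hm, hσ⟩

/-- A multiplicand contains no sums, and by `hno` no `RPow`; so the power group may be restricted to
`P`-monomials. -/
lemma Realizes.isBasic (hR : Realizes 𝓔 T) (hAPS : 𝓔.IsAPS (groundShift K₀ d v))
    (hF : IsOrderedFamily T)
    (hno : ∀ (i : Fin e) (l : ℕ) (A : SPTerm K₀ d v), T i = .prod l A →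
      ∀ r, Term.rpow r ∉ A.atoms) : 𝓔.IsBasic (groundShift K₀ d v) := by
  refine ⟨fun i hi => ?_, fun i ν hi => ?_⟩
  · obtain ⟨_, ⟨h, m, hh, hm, rfl⟩, hσ⟩ := hR.inPowerGroup hAPS hF
      (Q := fun j => 𝓔.kind j = .P) (fun _ h => by simp [h]) (fun i l A _ h j hj hS => by
        cases hk : 𝓔.kind j with
        | A ν =>
          obtain ⟨r, _, hr⟩ := hF.exists_rpow ((hR.kind_eq j).symm.trans hk)
          rw [hr] at hj
          exact absurd hj (hno i l A h r)
        | P => rfl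
        | S => exact absurd hk hS) i hi
    exact ⟨h, m, hh, hm, hσ⟩
  · obtain ⟨r, hr, h⟩ := hF.exists_rpow ((hR.kind_eq i).symm.trans hi)
    refine ⟨_, ?_, groundShift_const r, hR.rpow i r h⟩
    rw [Ne, FaithfulSMul.algebraMap_eq_zero_iff]
    exact hr.ne_zero

end RealizedFamily

end SigmaReduction

end

/-! ### The two equivalences. -/

open SigmaReduction in
theorem mainTheorem3 {K₀ : Type*} [Field K₀] (d v e : ℕ) (hd : d ≤ 1)
    (hchar : d = 1 → CharZero K₀)
    (T : Fin e → SPTerm K₀ d v) (hinj : Function.Injective T)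
    (hSigmaPi : IsSigmaPiSet (Set.range T))
    (hreduced : ∀ i, IsSumProductReduced (Term.single (T i)))
    (hordered : ∀ (i : Fin e) (l : ℕ) (A : SPTerm K₀ d v),
      (T i = .sum l A ∨ T i = .prod l A) → A.atoms ⊆ {B | ∃ j < i, B = T j}) :
    ((∀ (i : Fin e) (l : ℕ) (A : SPTerm K₀ d v), T i = .prod l A → ∀ r, Term.rpow r ∉ A.atoms) →
      ((∃ 𝓔 : Tower (GroundField K₀ d v) e,
          𝓔.IsRPiSigma (groundShift K₀ d v) ∧ 𝓔.IsBasic (groundShift K₀ d v) ∧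
            ModelsFamily 𝓔 T) ↔
        IsSigmaReduced (Set.range T))) ∧
    ((∃ 𝓔 : Tower (GroundField K₀ d v) e,
        𝓔.IsRPiSigma (groundShift K₀ d v) ∧ 𝓔.IsSimple ∧ ModelsFamily 𝓔 T) ↔
      IsSigmaReduced (Set.range T)) := by
  have hF : IsOrderedFamily T := ⟨hinj, fun i => hSigmaPi _ ⟨i, rfl⟩, hreduced, hordered⟩
  refine ⟨fun hno => ⟨?_, fun hW => ?_⟩, ?_, fun hW => ?_⟩
  · rintro ⟨𝓔, hRPS, _, hM⟩
    exact isSigmaReduced_of_tower hd hchar hF hRPS hM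
  -- The tower of germs is used here and in the second part; only the information on its quotients
  -- differs.
  · obtain ⟨𝓔, hRPS, hR⟩ := exists_realizes hd hchar hF hW.canonical
    exact ⟨𝓔, hRPS, hR.isBasic hRPS.1 hF hno, hR.modelsFamily hRPS.1 hd hchar hF⟩
  · rintro ⟨𝓔, hRPS, _, hM⟩
    exact isSigmaReduced_of_tower hd hchar hF hRPS hM
  · obtain ⟨𝓔, hRPS, hR⟩ := exists_realizes hd hchar hF hW.canonical
    exact ⟨𝓔, hRPS, hR.isSimple hRPS.1 hF, hR.modelsFamily hRPS.1 hd hchar hF⟩
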